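/- Let $a_1,a_2,a_3\ge 1$ be integers, $w=a_1+a_2+a_3$, and for $\tau=\tau_1+i\tau_2$ in the upper half plane put $$C_{a_1,a_2,a_3}(\tau)=\sum_{(m_r,n_r)}\ \prod_{r=1}^{3}\left(\frac{\tau_2}{\pi|m_r+n_r\tau|^2}\right)^{a_r},$$ the sum being over all $(m_1,n_1),(m_2,n_2),(m_3,n_3)\in\mathbb Z^2\setminus\{(0,0)\}$ with $m_1+m_2+m_3=n_1+n_2+n_3=0$. Its constant Fourier mode $C^{(0)}_{a_1,a_2,a_3}(\tau_2)=\int_0^1 C_{a_1,a_2,a_3}(\tau_1+i\tau_2)\,d\tau_1$ can be written, for $\tau_2>0$, as $$C^{(0)}_{a_1,a_2,a_3}(\tau_2)=\mathcal L(\tau_2)+\mathcal E(\tau_2),$$ where $\mathcal L$ is a Laurent polynomial in $\tau_2$ with real coefficients and exponents between $1-w$ and $w$, and $\mathcal E(\tau_2)=O(e^{-\kappa\tau_2})$ as $\tau_2\to\infty$ for some $\kappa>0$; these conditions determine $\mathcal E$. There are rational numbers $f_+(s;n)$, $f_-(s;n)$ and $f(s;n,m)$, independent of $\tau_2$, such that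 for all $\tau_2>0$ $$\mathcal E(\tau_2)=\sum_{s=1}^{w-2}\sum_{n=1}^{\infty}\left(\left(f_+(s;n)(4\pi\tau_2)^s+f_-(s;n)(4\pi\tau_2)^{1-s}\right)\mathrm{Ei}(4\pi n\tau_2)+e^{-4\pi n\tau_2}\sum_{m=2-w}^{w-3}f(s;n,m)(4\pi\tau_2)^m\right),$$ where $\mathrm{Ei}(x)=\Gamma(0,x)=\int_x^\infty e^{-t}\,\frac{dt}{t}$ for $x>0$, and the series over $n$ converges absolutely for each $s$. -/

import Mathlib

open Real Filter MeasureTheory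

noncomputable section

namespace ModularGraph

/-- The summation range of the Kronecker–Eisenstein sum attached to a graph with two vertices joined
by `l` edges: lattice momenta `(m_r, n_r)`, all different from `(0, 0)`, whose sum vanishes. -/
def Momenta (l : ℕ) : Type :=
  {p : Fin l → ℤ × ℤ // (∀ r, p r ≠ 0) ∧ ∑ r, p r = 0}

/-- The modular graph function
`C_{a_1, …, a_l}(τ) = ∑' ∏_r (τ₂ / (π |m_r + n_r τ|²)) ^ a_r`, meaningful for `Im τ > 0`. -/
def modularC {l : ℕ} (a : Fin l → ℕ) (τ : ℂ) : ℝ :=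
  ∑' p : Momenta l,
    ∏ r, (τ.im / (π * ‖((p.1 r).1 : ℂ) + ((p.1 r).2 : ℂ) * τ‖ ^ 2)) ^ a r

/-- The constant Fourier mode `∫₀¹ C_{a_1, …, a_l}(τ₁ + i τ₂) dτ₁`, as a function of `τ₂ > 0`. -/
def constantMode {l : ℕ} (a : Fin l → ℕ) (t : ℝ) : ℝ :=
  ∫ x in (0 : ℝ)..1, modularC a (⟨x, t⟩ : ℂ)

/-- `E` is the exponentially decaying part of the constant Fourier mode of `C_{a₁, a₂, a₃}`:
on `τ₂ > 0` the constant mode is a Laurent polynomial in `τ₂` with exponents between `1 - w` and `w`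
(where `w = a₁ + a₂ + a₃`) plus `E`, and `E` decays exponentially as `τ₂ → ∞`. These conditions
determine `E` on `τ₂ > 0`. -/
structure IsExponentialPart (a₁ a₂ a₃ : ℕ) (E : ℝ → ℝ) : Prop where
  laurent_add : ∃ c : ℤ → ℝ, ∀ t : ℝ, 0 < t →
    constantMode ![a₁, a₂, a₃] t =
      (∑ k ∈ Finset.Icc (1 - ((a₁ + a₂ + a₃ : ℕ) : ℤ)) ((a₁ + a₂ + a₃ : ℕ) : ℤ), c k * t ^ k) + E t
  decay : ∃ κ : ℝ, 0 < κ ∧ E =O[atTop] fun t => Real.exp (-κ * t)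

/-- The exponential integral in the normalization `Ei(x) = Γ(0, x) = ∫_x^∞ e^{-t} / t dt`,
for `x > 0`. -/
def Ei (x : ℝ) : ℝ := ∫ t in Set.Ioi x, Real.exp (-t) / t

/-- The term of index `(s, n)` of the expansion, for weight `w`, as a function of `t = τ₂`. -/
def expTerm (w : ℕ) (fp fm : ℕ → ℕ → ℚ) (f : ℕ → ℕ → ℤ → ℚ) (s n : ℕ) (t : ℝ) : ℝ :=
  ((fp s n : ℝ) * (4 * π * t) ^ (s : ℤ) + (fm s n : ℝ) * (4 * π * t) ^ (1 - (s : ℤ)))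
      * Ei (4 * π * n * t)
    + Real.exp (-(4 * π * n * t))
      * ∑ m ∈ Finset.Icc (2 - (w : ℤ)) ((w : ℤ) - 3), (f s n m : ℝ) * (4 * π * t) ^ m

end ModularGraph

end

noncomputable section

/-! Put `y = 4πτ₂`, fix the momenta `n_r`, and Poisson-resum each edge factor over `m_r`. For `n ≠
0` the inverse Fourier transform of an edge factor is, by partial fractions, a rational combination
of terms `y^p |n|^q |v|^j e^{-y|n||v|/2}` (`fourier_edgeFourier`); for `n = 0` the sum over `m` is a
Bernoulli polynomial times a rational multiple of `y^a`. The constraint `Σ m_r = 0` becomes an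
integral over `u ∈ [0,1]` of the product of the three resummed factors, with dual windings `l_r`,
and the average over `τ₁` keeps only the `l` with `n · l = 0` (`hasSum_kernInt`).

For a surviving pair with all `n_r ≠ 0`, the exponent `½ Σ |n_r| |u + l_r|` is affine on `[0,1]`,
with integer values `N₀` and `N₁` at the ends, and its slope `β = N₁ - N₀` never vanishes. A
polynomial times `e^{-y(N₀ + βu)}` therefore integrates exactly to boundary terms: rational numbers
times powers of `y` times `e^{-yN₀}` or `e^{-yN₁}` (`Windings.integralTerm_eq`). Terms with exponent
zero go to the Laurent polynomial. For each `n ≥ 1` finitely many terms carry `e^{-ny}`, so the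
coefficients stay rational after regrouping (`exists_regroup`).

If exactly one momentum vanishes, a Bernoulli polynomial replaces one factor and the same
integration applies (`Ladder.integralTerm_eq`). Its last boundary term would have the forbidden
power `y^{1-w}` next to an exponential, but its coefficient does not depend on the winding and the
sum telescopes to a pure monomial (`Ladder.isExpFamily_top`). If all momenta vanish the result is a
multiple of `y^w`.

Thus the exponential part needs no `Ei` terms: `f_±` may be taken zero, with everything in a single
value of `s`. Uniqueness of the exponential part (`IsExponentialPart.unique`) transfers the result
to any admissible `E`. -/

namespace ModularGraph

/-! ### Partial fractions and the Fourier transform of `|x|^j e^{-c|x|}` -/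

/-- Partial fractions of `1 / (z ^ a * w ^ b)` in terms of `z + w`, with rational coefficients. -/
theorem exists_partial_fractions (k a b : ℕ) (hk : a + b = k + 1) :
    ∃ c d : ℕ → ℚ, ∀ z w : ℂ, z ≠ 0 → w ≠ 0 → z + w ≠ 0 →
      ((z ^ a * w ^ b)⁻¹ : ℂ) =
        ∑ j ∈ Finset.range a, (c j : ℂ) * ((z + w) ^ (k - j))⁻¹ * (z ^ (j + 1))⁻¹ +
        ∑ j ∈ Finset.range b, (d j : ℂ) * ((z + w) ^ (k - j))⁻¹ * (w ^ (j + 1))⁻¹ := by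
  induction k generalizing a b with
  | zero =>
    have : (a = 1 ∧ b = 0) ∨ (a = 0 ∧ b = 1) := by omega
    rcases this with ⟨rfl, rfl⟩ | ⟨rfl, rfl⟩
    · exact ⟨fun _ => 1, fun _ => 1, fun z w _ _ _ => by simp⟩
    · exact ⟨fun _ => 1, fun _ => 1, fun z w _ _ _ => by simp⟩
  | succ k ih =>
    rcases Nat.eq_zero_or_pos a with rfl | ha
    · refine ⟨0, fun j => if j = k + 1 then 1 else 0, fun z w _ _ _ => ?_⟩
      have hb : b = k + 2 := by omega
      subst hb
      rw [Finset.range_zero, Finset.sum_empty, zero_add, Finset.sum_eq_single (k + 1)]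
      · simp
      · intro j _ hj; simp [hj]
      · simp
    rcases Nat.eq_zero_or_pos b with rfl | hb
    · refine ⟨fun j => if j = k + 1 then 1 else 0, 0, fun z w _ _ _ => ?_⟩
      have hb : a = k + 2 := by omega
      subst hb
      rw [Finset.sum_eq_single (k + 1)]
      · simp
      · intro j _ hj; simp [hj]
      · simp
    obtain ⟨a, rfl⟩ := Nat.exists_eq_succ_of_ne_zero ha.ne'
    obtain ⟨b, rfl⟩ := Nat.exists_eq_succ_of_ne_zero hb.ne'
    obtain ⟨c₁, d₁, h₁⟩ := ih (a + 1) b (by omega)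
    obtain ⟨c₂, d₂, h₂⟩ := ih a (b + 1) (by omega)
    -- Each inductive decomposition is one term short in the variable whose power was lowered; the
    -- `if` pads it with a zero coefficient.
    refine ⟨fun j => c₁ j + if j < a then c₂ j else 0, fun j => (if j < b then d₁ j else 0) + d₂ j,
      fun z w hz hw hzw => ?_⟩
    -- The identity `1/(zw) = (1/z + 1/w)/(z + w)` lowers the total degree by one.
    have key : ((z ^ (a + 1) * w ^ (b + 1))⁻¹ : ℂ) =
        (z + w)⁻¹ * ((z ^ (a + 1) * w ^ b)⁻¹ + (z ^ a * w ^ (b + 1))⁻¹) := by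
      field_simp
      ring
    have hpow : ∀ j, j ≤ k → ((z + w) ^ (k + 1 - j))⁻¹ = (z + w)⁻¹ * ((z + w) ^ (k - j))⁻¹ := by
      intro j hj
      rw [Nat.succ_sub hj, pow_succ', mul_inv]
    have e₁ : ∀ (A : ℕ) (g : ℕ → ℚ) (v : ℂ), A ≤ k + 1 →
        (z + w)⁻¹ * ∑ j ∈ Finset.range A, (g j : ℂ) * ((z + w) ^ (k - j))⁻¹ * (v ^ (j + 1))⁻¹ =
        ∑ j ∈ Finset.range A, (g j : ℂ) * ((z + w) ^ (k + 1 - j))⁻¹ * (v ^ (j + 1))⁻¹ := by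
      intro A g v hA
      rw [Finset.mul_sum]
      refine Finset.sum_congr rfl fun j hj => ?_
      rw [hpow j (by have := Finset.mem_range.1 hj; omega)]
      ring
    have e₂ : ∀ (A : ℕ) (g : ℕ → ℚ) (v : ℂ),
        ∑ j ∈ Finset.range (A + 1), (((if j < A then g j else 0 : ℚ)) : ℂ) *
          ((z + w) ^ (k + 1 - j))⁻¹ * (v ^ (j + 1))⁻¹ =
        ∑ j ∈ Finset.range A, (g j : ℂ) * ((z + w) ^ (k + 1 - j))⁻¹ * (v ^ (j + 1))⁻¹ := by
      intro A g v
      rw [Finset.sum_range_succ]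
      simp only [lt_irrefl, if_false, Rat.cast_zero, zero_mul, add_zero]
      refine Finset.sum_congr rfl fun j hj => ?_
      rw [if_pos (Finset.mem_range.1 hj)]
    rw [key, h₁ z w hz hw hzw, h₂ z w hz hw hzw]
    simp only [mul_add, Rat.cast_add, add_mul, Finset.sum_add_distrib]
    rw [e₁ _ _ _ (by omega), e₁ _ _ _ (by omega), e₁ _ _ _ (by omega), e₁ _ _ _ (by omega),
      e₂, e₂]
    ring

/-- Averaging the decomposition with its image under `z ↔ w` gives both poles equal weights, the
shape in which the Fourier transform of the even function `|x|^j e^{-c|x|}` appears. -/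
theorem exists_symmetric_partial_fractions (a : ℕ) (ha : 1 ≤ a) :
    ∃ c : ℕ → ℚ, ∀ z w : ℂ, z ≠ 0 → w ≠ 0 → z + w ≠ 0 →
      ((z * w)⁻¹ ^ a : ℂ) = ∑ j ∈ Finset.range a, (c j : ℂ) *
        ((z + w) ^ (2 * a - 1 - j))⁻¹ * ((z ^ (j + 1))⁻¹ + (w ^ (j + 1))⁻¹) := by
  obtain ⟨c, d, h⟩ := exists_partial_fractions (2 * a - 1) a a (by omega)
  refine ⟨fun j => (c j + d j) / 2, fun z w hz hw hzw => ?_⟩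
  have h₁ := h z w hz hw hzw
  have h₂ := h w z hw hz (by rwa [add_comm])
  rw [mul_comm (w ^ a), add_comm w z] at h₂
  rw [inv_pow, mul_pow]
  have : ((z ^ a * w ^ a)⁻¹ : ℂ) = ((z ^ a * w ^ a)⁻¹ + (z ^ a * w ^ a)⁻¹) / 2 := by ring
  rw [this]
  nth_rewrite 1 [h₁]
  rw [h₂, ← Finset.sum_add_distrib, ← Finset.sum_add_distrib, ← Finset.sum_add_distrib,
    Finset.sum_div]
  refine Finset.sum_congr rfl fun j _ => ?_
  push_cast
  ring

theorem integrableOn_pow_mul_cexp (j : ℕ) {r : ℂ} (hr : 0 < r.re) :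
    IntegrableOn (fun x : ℝ => (x : ℂ) ^ j * Complex.exp (-(r * x))) (Set.Ioi 0) := by
  have h := integrableOn_rpow_mul_exp_neg_mul_rpow (p := 1) (s := j) (b := r.re)
    (by have : (0 : ℝ) ≤ j := Nat.cast_nonneg j
        linarith) one_pos hr
  refine Integrable.mono' h (by fun_prop) ?_
  refine (ae_restrict_iff' measurableSet_Ioi).2 (Eventually.of_forall fun x hx => ?_)
  have hx : 0 < x := hx
  simp [Complex.norm_exp, abs_of_pos hx]

theorem integral_pow_mul_cexp (j : ℕ) {r : ℂ} (hr : 0 < r.re) :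
    ∫ x : ℝ in Set.Ioi 0, (x : ℂ) ^ j * Complex.exp (-(r * x)) = (j.factorial : ℂ) / r ^ (j + 1) := by
  have hr0 : r ≠ 0 := by rintro rfl; simp at hr
  have lim : ∀ j : ℕ, Tendsto (fun x : ℝ => -((x : ℂ) ^ j * Complex.exp (-(r * x))) / r) atTop
      (nhds 0) := by
    intro j
    rw [tendsto_zero_iff_norm_tendsto_zero]
    have h1 := (Real.tendsto_pow_mul_exp_neg_atTop_nhds_zero j).comp
      (tendsto_id.const_mul_atTop hr)
    have h2 := h1.const_mul ((r.re ^ j)⁻¹ / ‖r‖)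
    rw [mul_zero] at h2
    refine h2.congr' ?_
    filter_upwards [eventually_gt_atTop 0] with x hx
    simp only [Function.comp, id, norm_div, norm_neg, norm_mul, norm_pow, Complex.norm_exp,
      Complex.norm_real, Real.norm_eq_abs, abs_of_pos hx, Complex.neg_re, Complex.mul_re,
      Complex.ofReal_re, Complex.ofReal_im, mul_zero, sub_zero, mul_pow]
    field_simp
  have der : ∀ x : ℝ, HasDerivAt (fun x : ℝ => Complex.exp (-(r * x)))
      (Complex.exp (-(r * x)) * (-r)) x := by
    intro x
    have h : HasDerivAt (fun z : ℂ => Complex.exp (-(r * z))) (Complex.exp (-(r * x)) * (-r)) (x:ℂ) := by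
      have := ((hasDerivAt_id (x : ℂ)).const_mul r).neg.cexp
      simpa using this
    exact h.comp_ofReal
  induction j with
  | zero =>
    have := integral_Ioi_of_hasDerivAt_of_tendsto' (a := 0)
      (f := fun x : ℝ => -((x : ℂ) ^ 0 * Complex.exp (-(r * x))) / r)
      (f' := fun x : ℝ => (x : ℂ) ^ 0 * Complex.exp (-(r * x))) (m := 0)
      (fun x _ => by
        have := ((der x).neg).div_const r
        simp only [pow_zero, one_mul]
        refine this.congr_deriv ?_
        field_simp) (integrableOn_pow_mul_cexp 0 hr) (lim 0)
    rw [this]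
    simp [neg_div]
  | succ j ih =>
    have h := integral_Ioi_of_hasDerivAt_of_tendsto' (a := 0)
      (f := fun x : ℝ => -((x : ℂ) ^ (j + 1) * Complex.exp (-(r * x))) / r)
      (f' := fun x : ℝ => (x : ℂ) ^ (j + 1) * Complex.exp (-(r * x)) -
        ((j + 1 : ℂ) / r) * ((x : ℂ) ^ j * Complex.exp (-(r * x)))) (m := 0)
      (fun x _ => by
        have hp : HasDerivAt (fun x : ℝ => (x : ℂ) ^ (j + 1)) ((j + 1 : ℂ) * (x : ℂ) ^ j) x := by
          have h : HasDerivAt (fun z : ℂ => z ^ (j + 1)) ((j + 1 : ℂ) * (x : ℂ) ^ j) (x : ℂ) := by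
            simpa using hasDerivAt_pow (j + 1) (x : ℂ)
          exact h.comp_ofReal
        have := (hp.mul (der x)).neg.div_const r
        refine this.congr_deriv ?_
        field_simp
        ring)
      ((integrableOn_pow_mul_cexp (j + 1) hr).sub ((integrableOn_pow_mul_cexp j hr).const_mul _))
      (lim (j + 1))
    rw [integral_sub (integrableOn_pow_mul_cexp (j + 1) hr)
      ((integrableOn_pow_mul_cexp j hr).const_mul _), integral_const_mul, ih] at h
    have h' := eq_add_of_sub_eq h
    rw [h']
    simp only [Complex.ofReal_zero, ne_eq, Nat.succ_ne_zero, not_false_eq_true, zero_pow, zero_mul,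
      neg_zero, zero_div, sub_zero, zero_add, Nat.factorial_succ]
    push_cast
    field_simp
    ring

/-- The Fourier transform of `|x| ^ j * exp (-c |x|)`. -/
theorem integral_abs_pow_mul_exp (j : ℕ) {c : ℝ} (hc : 0 < c) (v : ℝ) :
    Integrable (fun x : ℝ => Complex.exp (-(Complex.I * v * x)) *
        ((|x| ^ j * Real.exp (-(c * |x|)) : ℝ) : ℂ)) ∧
    ∫ x : ℝ, Complex.exp (-(Complex.I * v * x)) * ((|x| ^ j * Real.exp (-(c * |x|)) : ℝ) : ℂ) =
      (j.factorial : ℂ) * (((c + Complex.I * v) ^ (j + 1))⁻¹ + ((c - Complex.I * v) ^ (j + 1))⁻¹) := by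
  have r1 : 0 < ((c : ℂ) + Complex.I * v).re := by simpa
  have r2 : 0 < ((c : ℂ) - Complex.I * v).re := by simpa
  set F : ℝ → ℂ := fun x => Complex.exp (-(Complex.I * v * x)) *
    ((|x| ^ j * Real.exp (-(c * |x|)) : ℝ) : ℂ) with hF
  have eq1 : Set.EqOn F (fun x : ℝ => (x : ℂ) ^ j * Complex.exp (-((c + Complex.I * v) * x)))
      (Set.Ioi 0) := by
    intro x hx
    have hx : 0 < x := hx
    simp only [hF, abs_of_pos hx]
    push_cast
    rw [show -(((c : ℂ) + Complex.I * v) * x) = -(Complex.I * v * x) + -(c * x) by ring,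
      Complex.exp_add]
    ring
  have eq2 : Set.EqOn (fun x => F (-x))
      (fun x : ℝ => (x : ℂ) ^ j * Complex.exp (-((c - Complex.I * v) * x))) (Set.Ioi 0) := by
    intro x hx
    have hx : 0 < x := hx
    simp only [hF, abs_neg, abs_of_pos hx]
    push_cast
    rw [show -(((c : ℂ) - Complex.I * v) * x) = -(Complex.I * v * (-x)) + -(c * x) by ring,
      Complex.exp_add]
    ring
  have i1 : IntegrableOn F (Set.Ioi 0) :=
    (integrableOn_pow_mul_cexp j r1).congr_fun eq1.symm measurableSet_Ioi
  have i2' : IntegrableOn (fun x => F (-x)) (Set.Ioi 0) :=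
    (integrableOn_pow_mul_cexp j r2).congr_fun eq2.symm measurableSet_Ioi
  have i2 : IntegrableOn F (Set.Iic 0) := by
    have h : IntegrableOn (fun x => F (-x)) (Set.Ici (-0)) := by
      rw [neg_zero]
      exact (integrableOn_Ici_iff_integrableOn_Ioi (by simp)).mpr i2'
    simpa using h.comp_neg_Iic
  refine ⟨?_, ?_⟩
  · rw [← integrableOn_univ, ← Set.Iic_union_Ioi (a := (0 : ℝ))]
    exact i2.union i1
  · rw [← intervalIntegral.integral_Iic_add_Ioi i2 i1, setIntegral_congr_fun measurableSet_Ioi eq1,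
      integral_pow_mul_cexp j r1]
    have := integral_comp_neg_Ioi (0 : ℝ) F
    rw [neg_zero] at this
    rw [← this, setIntegral_congr_fun measurableSet_Ioi eq2, integral_pow_mul_cexp j r2]
    ring

/-! ### Bounds for edge factors on the lattice -/

/-- The factor of a single edge, at `τ = x + i t`. -/
def edge (a : ℕ) (t x : ℝ) (n m : ℤ) : ℝ :=
  (t / (π * ‖(m : ℂ) + (n : ℂ) * (⟨x, t⟩ : ℂ)‖ ^ 2)) ^ a

theorem normSq_lattice (t x : ℝ) (n m : ℤ) :
    ‖(m : ℂ) + (n : ℂ) * (⟨x, t⟩ : ℂ)‖ ^ 2 = (m + n * x) ^ 2 + (n * t) ^ 2 := by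
  rw [Complex.sq_norm, Complex.normSq_apply]
  simp
  ring

theorem edge_nonneg (a : ℕ) {t : ℝ} (ht : 0 < t) (x : ℝ) (n m : ℤ) : 0 ≤ edge a t x n m := by
  unfold edge; positivity

theorem edge_zero {a : ℕ} (ha : 1 ≤ a) (t x : ℝ) : edge a t x 0 0 = 0 := by
  simp [edge, Nat.one_le_iff_ne_zero.1 ha]

/-- The sup norm of a lattice point. -/
def size (n m : ℤ) : ℝ := max |(n : ℝ)| |(m : ℝ)|

theorem size_nonneg (n m : ℤ) : 0 ≤ size n m := le_max_of_le_left (abs_nonneg _)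

theorem one_le_abs_cast {n : ℤ} (h : n ≠ 0) : 1 ≤ |(n : ℝ)| := by
  exact_mod_cast Int.one_le_abs h

theorem one_le_size {n m : ℤ} (h : ¬ (n = 0 ∧ m = 0)) : 1 ≤ size n m := by
  by_cases hn : n = 0
  · exact le_max_of_le_right (one_le_abs_cast fun hm => h ⟨hn, hm⟩)
  · exact le_max_of_le_left (one_le_abs_cast hn)

/-- The comparison of `|m + nτ|` with the sup norm is uniform in `x ∈ [0,1]`, as needed to dominate
the integral over `x`. -/
theorem size_sq_le {t x : ℝ} (ht : 0 < t) (hx : x ∈ Set.Icc (0 : ℝ) 1) (n m : ℤ) :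
    size n m ^ 2 ≤ 2 * (1 + (t ^ 2)⁻¹) * ((m + n * x) ^ 2 + (n * t) ^ 2) := by
  have h1 : size n m ≤ |m + n * x| + |(n : ℝ)| := by
    refine max_le (by linarith [abs_nonneg (m + n * x)]) ?_
    have : (m : ℝ) = (m + n * x) + -(n * x) := by ring
    calc |(m : ℝ)| = |(m + n * x) + -(n * x)| := by rw [← this]
      _ ≤ |m + n * x| + |(n : ℝ) * x| := by rw [← abs_neg ((n : ℝ) * x)]; exact abs_add_le _ _
      _ ≤ |m + n * x| + |(n : ℝ)| := by
        rw [abs_mul, abs_of_nonneg hx.1]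
        have := mul_le_mul_of_nonneg_left hx.2 (abs_nonneg (n : ℝ))
        linarith
  have h2 : size n m ^ 2 ≤ (|m + n * x| + |(n : ℝ)|) ^ 2 :=
    pow_le_pow_left₀ (size_nonneg n m) h1 2
  have h3 : (|m + n * x| + |(n : ℝ)|) ^ 2 ≤ 2 * ((m + n * x) ^ 2 + (n : ℝ) ^ 2) := by
    have e1 := sq_abs ((m : ℝ) + n * x)
    have e2 := sq_abs (n : ℝ)
    nlinarith [sq_nonneg (|(m : ℝ) + n * x| - |(n : ℝ)|)]
  have h4 : (n : ℝ) ^ 2 = (t ^ 2)⁻¹ * (n * t) ^ 2 := by field_simp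
  have h5 : 0 < (t ^ 2)⁻¹ := by positivity
  have h6 : 0 ≤ (t ^ 2)⁻¹ * (m + n * x) ^ 2 := by positivity
  have h7 : 0 ≤ (n * t) ^ 2 := by positivity
  rw [h4] at h3
  linarith

theorem exists_edge_le (a : ℕ) (ha : 1 ≤ a) {t : ℝ} (ht : 0 < t) :
    ∃ K : ℝ, 0 ≤ K ∧ ∀ x ∈ Set.Icc (0 : ℝ) 1, ∀ n m : ℤ,
      edge a t x n m ≤ K * (size n m ^ 2)⁻¹ := by
  refine ⟨(t * (2 * (1 + (t ^ 2)⁻¹)) / π) ^ a, by positivity, fun x hx n m => ?_⟩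
  by_cases h : n = 0 ∧ m = 0
  · rw [h.1, h.2, edge_zero ha]
    simp [size]
  have h1 := one_le_size h
  have h2 := size_sq_le ht hx n m
  have hκ : 0 < 2 * (1 + (t ^ 2)⁻¹) := by positivity
  set κ := 2 * (1 + (t ^ 2)⁻¹)
  have hs : 0 < size n m ^ 2 := by positivity
  have hD : 0 < ((m : ℝ) + n * x) ^ 2 + (n * t) ^ 2 := by
    by_contra hc
    nlinarith
  unfold edge
  rw [normSq_lattice]
  have h3 : t / (π * ((m + n * x) ^ 2 + (n * t) ^ 2)) ≤ (t * κ / π) * (size n m ^ 2)⁻¹ := by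
    rw [div_le_iff₀ (by positivity)]
    have : t = (t * κ / π) * (size n m ^ 2)⁻¹ * (π * (size n m ^ 2 / κ)) := by
      field_simp
    have h4 : size n m ^ 2 / κ ≤ (m + n * x) ^ 2 + (n * t) ^ 2 := by
      rw [div_le_iff₀ hκ]; linarith
    calc t = (t * κ / π) * (size n m ^ 2)⁻¹ * (π * (size n m ^ 2 / κ)) := this
      _ ≤ _ := by gcongr
  calc (t / (π * ((m + n * x) ^ 2 + (n * t) ^ 2))) ^ a
      ≤ ((t * κ / π) * (size n m ^ 2)⁻¹) ^ a := by gcongr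
    _ = (t * κ / π) ^ a * (size n m ^ 2)⁻¹ ^ a := mul_pow _ _ _
    _ ≤ (t * κ / π) ^ a * (size n m ^ 2)⁻¹ := by
      gcongr
      -- Nonzero lattice points have size at least 1, so the power `a ≥ 1` can be weakened to the
      -- first.
      exact pow_le_of_le_one (by positivity) (inv_le_one_of_one_le₀ (one_le_pow₀ h1))
        (Nat.one_le_iff_ne_zero.1 ha)

theorem summable_edge (a : ℕ) (ha : 1 ≤ a) {t x : ℝ} (ht : 0 < t) (hx : x ∈ Set.Icc (0 : ℝ) 1)
    (n : ℤ) : Summable fun m : ℤ => edge a t x n m := by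
  obtain ⟨K, hK, h⟩ := exists_edge_le a ha ht
  have hs : Summable fun m : ℤ => K * ((m : ℝ) ^ 2)⁻¹ := by
    have := (Real.summable_one_div_int_pow (p := 2)).2 (by norm_num)
    simpa using this.mul_left K
  refine Summable.of_norm_bounded_eventually hs ?_
  have : {m : ℤ | ¬ ‖edge a t x n m‖ ≤ K * ((m : ℝ) ^ 2)⁻¹} ⊆ {0} := by
    intro m hm
    by_contra h0
    apply hm
    rw [Real.norm_of_nonneg (edge_nonneg a ht x n m)]
    refine (h x hx n m).trans ?_
    have h1 := one_le_abs_cast h0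
    have : (m : ℝ) ^ 2 ≤ size n m ^ 2 := by
      rw [← sq_abs (m : ℝ)]
      exact pow_le_pow_left₀ (abs_nonneg _) (le_max_right _ _) 2
    have h2 : 0 < (m : ℝ) ^ 2 := by rw [← sq_abs]; positivity
    gcongr
  exact (Set.finite_singleton (0 : ℤ)).subset this

/-! ### Poisson resummation of an edge -/

/-- Coefficients of the Fourier transform of the edge factor. -/
def edgeCoeff (a j : ℕ) : ℚ :=
  if h : 1 ≤ a then Classical.choose (exists_symmetric_partial_fractions a h) j / j.factorial else 0

/-- The explicit `j!` is split off because `integral_abs_pow_mul_exp` produces it. -/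
theorem edgeCoeff_spec {a : ℕ} (ha : 1 ≤ a) {z w : ℂ} (hz : z ≠ 0) (hw : w ≠ 0) (hzw : z + w ≠ 0) :
      ((z * w)⁻¹ ^ a : ℂ) = ∑ j ∈ Finset.range a, (edgeCoeff a j : ℂ) * j.factorial *
        ((z + w) ^ (2 * a - 1 - j))⁻¹ * ((z ^ (j + 1))⁻¹ + (w ^ (j + 1))⁻¹) := by
  rw [Classical.choose_spec (exists_symmetric_partial_fractions a ha) z w hz hw hzw]
  refine Finset.sum_congr rfl fun j _ => ?_
  rw [edgeCoeff, dif_pos ha]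
  push_cast
  have : (j.factorial : ℂ) ≠ 0 := by exact_mod_cast j.factorial_ne_zero
  field_simp

/-- The edge factor after Poisson resummation over `m`, as a function of `y = 4 π t`. -/
def kern (a : ℕ) (y : ℝ) (n l : ℤ) (u : ℝ) : ℝ :=
  if n = 0 then
    if l = 0 then ((-1) ^ (a + 1) / (2 * a).factorial : ℚ) * y ^ (a : ℤ) * bernoulliFun (2 * a) u
    else 0
  else ∑ j ∈ Finset.range a, (edgeCoeff a j : ℝ) * y ^ ((j : ℤ) + 1 - a) *
    |(n : ℝ)| ^ ((j : ℤ) + 1 - 2 * a) * (|u + l| ^ j * exp (-(y * |(n : ℝ)| / 2 * |u + l|)))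

/-- The inverse Fourier transform of the edge factor. -/
def edgeFourier (a : ℕ) (y : ℝ) (n : ℤ) (v : ℝ) : ℝ :=
  ∑ j ∈ Finset.range a, (edgeCoeff a j : ℝ) * y ^ ((j : ℤ) + 1 - a) *
    |(n : ℝ)| ^ ((j : ℤ) + 1 - 2 * a) * (|v| ^ j * exp (-(y * |(n : ℝ)| / 2 * |v|)))

/-- With `c = y|n|/2 = 2πt|n|` and `V = 2πiv` one has `(c + V)(c - V) = 4π²(v² + n²t²)`, so the edge
factor is `y^a ((c + V)(c - V))^{-a}`. Since `(c + V) + (c - V) = y|n|` does not involve `v`,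
symmetric partial fractions leave only simple transforms in `v`. -/
theorem fourier_edgeFourier {a : ℕ} (ha : 1 ≤ a) {t : ℝ} (ht : 0 < t) {n : ℤ} (hn : n ≠ 0) (v : ℝ) :
    ∫ s : ℝ, Complex.exp (-(Complex.I * (2 * π * v : ℝ) * s)) * (edgeFourier a (4 * π * t) n s : ℂ) =
      (((t / (π * (v ^ 2 + (n * t) ^ 2))) ^ a : ℝ) : ℂ) := by
  have hn' : 0 < |(n : ℝ)| := by positivity
  set y := 4 * π * t with hy
  have hy0 : 0 < y := by positivity
  have hc : 0 < y * |(n : ℝ)| / 2 := by positivity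
  set c := y * |(n : ℝ)| / 2 with hcdef
  have hterm := fun j => integral_abs_pow_mul_exp j hc (2 * π * v)
  have e1 : ∀ s : ℝ, Complex.exp (-(Complex.I * (2 * π * v : ℝ) * s)) * (edgeFourier a y n s : ℂ) =
      ∑ j ∈ Finset.range a, ((edgeCoeff a j : ℝ) * y ^ ((j : ℤ) + 1 - a) *
        |(n : ℝ)| ^ ((j : ℤ) + 1 - 2 * a) : ℝ) *
        (Complex.exp (-(Complex.I * (2 * π * v : ℝ) * s)) *
          ((|s| ^ j * Real.exp (-(c * |s|)) : ℝ) : ℂ)) := by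
    intro s
    rw [edgeFourier, Complex.ofReal_sum, Finset.mul_sum]
    refine Finset.sum_congr rfl fun j _ => ?_
    simp only [hcdef]
    push_cast
    ring
  simp_rw [e1]
  rw [integral_finsetSum _ fun j _ => (hterm j).1.const_mul _]
  simp_rw [integral_const_mul, (hterm _).2]
  set V : ℂ := Complex.I * ((2 * π * v : ℝ) : ℂ) with hV
  have hz : (c : ℂ) + V ≠ 0 := fun h => by
    have := congrArg Complex.re h
    simp [hV] at this
    linarith
  have hw : (c : ℂ) - V ≠ 0 := fun h => by
    have := congrArg Complex.re h
    simp [hV] at this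
    linarith
  have hzw : (c : ℂ) + V + (c - V) = ((y * |(n : ℝ)| : ℝ) : ℂ) := by
    rw [hcdef]; push_cast; ring
  have hzw0 : (c : ℂ) + V + (c - V) ≠ 0 := by
    rw [hzw]; exact_mod_cast (by positivity : y * |(n : ℝ)| ≠ 0)
  have hprod : ((c : ℂ) + V) * (c - V) = ((4 * π ^ 2 * (v ^ 2 + (n * t) ^ 2) : ℝ) : ℂ) := by
    have : ((c : ℂ) + V) * (c - V) = c ^ 2 - V ^ 2 := by ring
    rw [this, hV, mul_pow, Complex.I_sq]
    have h2 : c ^ 2 = 4 * π ^ 2 * (n * t) ^ 2 := by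
      rw [hcdef, hy, div_pow, mul_pow, sq_abs]; ring
    rw [← Complex.ofReal_pow c, h2]
    push_cast
    ring
  have hmain : ((t / (π * (v ^ 2 + (n * t) ^ 2)) : ℝ) : ℂ) =
      y * (((c : ℂ) + V) * (c - V))⁻¹ := by
    rw [hprod, hy, ← Complex.ofReal_inv, ← Complex.ofReal_mul]
    congr 1
    have : v ^ 2 + (n * t) ^ 2 ≠ 0 := by positivity
    field_simp
  rw [Complex.ofReal_pow, hmain, mul_pow, edgeCoeff_spec ha hz hw hzw0, hzw, Finset.mul_sum]
  refine Finset.sum_congr rfl fun j hj => ?_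
  have hj := Finset.mem_range.1 hj
  have hpow : ((y : ℝ) ^ ((j : ℤ) + 1 - a) * |(n : ℝ)| ^ ((j : ℤ) + 1 - 2 * a)) =
      y ^ a * ((y * |(n : ℝ)|) ^ (2 * a - 1 - j))⁻¹ := by
    have h3 : ((2 * a - 1 - j : ℕ) : ℤ) = 2 * a - 1 - j := by omega
    clear_value y
    rw [← zpow_natCast (y * |(n : ℝ)|), h3, ← zpow_neg, mul_zpow, ← mul_assoc, ← zpow_natCast y a,
      ← zpow_add₀ hy0.ne']
    congr 2 <;> ring
  have hpow' : (((y : ℝ) ^ ((j : ℤ) + 1 - a) * |(n : ℝ)| ^ ((j : ℤ) + 1 - 2 * a) : ℝ) : ℂ) =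
      (y : ℂ) ^ a * ((((y * |(n : ℝ)|) : ℝ) : ℂ) ^ (2 * a - 1 - j))⁻¹ := by
    rw [hpow]; push_cast; rfl
  rw [mul_assoc (edgeCoeff a j : ℝ), Complex.ofReal_mul, hpow']
  push_cast
  ring

theorem kern_of_ne_zero (a : ℕ) (y : ℝ) {n : ℤ} (hn : n ≠ 0) (l : ℤ) (u : ℝ) :
    kern a y n l u = edgeFourier a y n (u + l) := by
  rw [kern, if_neg hn, edgeFourier]

theorem continuous_edgeFourier (a : ℕ) (y : ℝ) (n : ℤ) : Continuous (edgeFourier a y n) := by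
  unfold edgeFourier; fun_prop

theorem isBigO_edgeFourier (a : ℕ) {y : ℝ} (hy : 0 < y) {n : ℤ} (hn : n ≠ 0) :
    edgeFourier a y n =O[cocompact ℝ] fun s : ℝ => |s| ^ (-2 : ℝ) := by
  have hc : 0 < y * |(n : ℝ)| / 2 := by positivity
  have key : ∀ j : ℕ, (fun s : ℝ => s ^ j * exp (-(y * |(n : ℝ)| / 2 * s))) =O[atTop]
      fun s : ℝ => s ^ (-2 : ℝ) := by
    intro j
    have h1 := (isLittleO_exp_neg_mul_rpow_atTop hc (-2 - j)).isBigO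
    have h2 := (Asymptotics.isBigO_refl (fun s : ℝ => s ^ j) atTop).mul h1
    refine (h2.congr' (Eventually.of_forall fun s => ?_) ?_)
    · simp only [neg_mul]
    · filter_upwards [eventually_gt_atTop 0] with s hs
      rw [← Real.rpow_natCast, ← Real.rpow_add hs]
      congr 1
      ring
  have key2 : ∀ j : ℕ, (fun s : ℝ => |s| ^ j * exp (-(y * |(n : ℝ)| / 2 * |s|))) =O[cocompact ℝ]
      fun s : ℝ => |s| ^ (-2 : ℝ) := fun j =>
    (key j).comp_tendsto (tendsto_norm_cocompact_atTop (E := ℝ))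
  exact Asymptotics.IsBigO.fun_sum fun j _ => (key2 j).const_mul_left _

/-- Poisson summation for `g(s) = e^{-2πinxs}` times `edgeFourier`: the phase shifts the frequency
from `m` to `m + nx`, so the Fourier transform at `m` is the edge factor. -/
theorem tsum_edge_mul_cexp_of_ne_zero {a : ℕ} (ha : 1 ≤ a) {t x : ℝ} (ht : 0 < t)
    (hx : x ∈ Set.Icc (0 : ℝ) 1) {n : ℤ} (hn : n ≠ 0) (u : ℝ) :
    ∑' m : ℤ, (edge a t x n m : ℂ) * Complex.exp (2 * π * Complex.I * m * u) =
      ∑' l : ℤ, (kern a (4 * π * t) n l u : ℂ) *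
        Complex.exp (-(2 * π * Complex.I * (n * x) * (u + l))) := by
  set g : ℝ → ℂ := fun s => Complex.exp (-(2 * π * Complex.I * (n * x) * s)) *
    (edgeFourier a (4 * π * t) n s : ℂ) with hg
  have hgc : Continuous g := by
    have := continuous_edgeFourier a (4 * π * t) n
    fun_prop
  have hF : ∀ m : ℤ, FourierTransform.fourier g (m : ℝ) = (edge a t x n m : ℂ) := by
    intro m
    rw [Real.fourier_real_eq_integral_exp_smul, edge, normSq_lattice,
      ← fourier_edgeFourier ha ht hn (m + n * x)]
    congr 1
    ext s
    rw [smul_eq_mul, hg, ← mul_assoc, ← Complex.exp_add]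
    congr 2
    push_cast
    ring
  have hbig : g =O[cocompact ℝ] fun s : ℝ => |s| ^ (-2 : ℝ) := by
    refine Asymptotics.IsBigO.trans
      (Asymptotics.IsBigO.of_bound 1 (Eventually.of_forall fun s => ?_))
      (isBigO_edgeFourier a (by positivity : 0 < 4 * π * t) hn)
    simp only [hg, norm_mul, Complex.norm_exp, Complex.norm_real]
    simp
  have hsum : Summable fun m : ℤ => FourierTransform.fourier g (m : ℝ) := by
    simp_rw [hF]
    exact_mod_cast summable_edge a ha ht hx n
  have := Real.tsum_eq_tsum_fourier_of_rpow_decay_of_summable hgc one_lt_two hbig hsum u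
  simp_rw [hF, fourier_coe_apply] at this
  refine Eq.trans ?_ (this.symm.trans ?_)
  · refine tsum_congr fun m => ?_
    congr 2
    push_cast
    ring
  · refine tsum_congr fun l => ?_
    rw [kern_of_ne_zero _ _ hn]
    simp only [hg]
    push_cast
    ring

/-- This is the Fourier series of the Bernoulli polynomial of degree `2a`. The term `m = 0` vanishes
on both sides, by the convention for division by zero and `a ≥ 1`. -/
theorem tsum_edge_mul_cexp_zero {a : ℕ} (ha : 1 ≤ a) {t : ℝ} (x : ℝ)
    {u : ℝ} (hu : u ∈ Set.Icc (0 : ℝ) 1) :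
    ∑' m : ℤ, (edge a t x 0 m : ℂ) * Complex.exp (2 * π * Complex.I * m * u) =
      kern a (4 * π * t) 0 0 u := by
  have h := (hasSum_one_div_pow_mul_fourier_mul_bernoulliFun (k := 2 * a) (by omega) hu).mul_left
    (((t / π) ^ a : ℝ) : ℂ)
  rw [kern, if_pos rfl, if_pos rfl]
  have e : (((t / π) ^ a : ℝ) : ℂ) * (-(2 * π * Complex.I) ^ (2 * a) / (2 * a).factorial *
      bernoulliFun (2 * a) u) = ((((-1) ^ (a + 1) / (2 * a).factorial : ℚ) *
        (4 * π * t) ^ (a : ℤ) * bernoulliFun (2 * a) u : ℝ) : ℂ) := by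
    have hI : (2 * π * Complex.I) ^ (2 * a) = (-1) ^ a * (4 * π ^ 2) ^ a := by
      rw [pow_mul, mul_pow, Complex.I_sq, ← mul_pow]
      congr 1
      ring
    rw [hI]
    push_cast
    rw [zpow_natCast, pow_succ, show (4 * π * t : ℂ) = (t / π) * (4 * π ^ 2) by
      have : (π : ℂ) ≠ 0 := by exact_mod_cast Real.pi_ne_zero
      field_simp, mul_pow (t / π : ℂ)]
    ring
  rw [← e, ← h.tsum_eq]
  refine tsum_congr fun m => ?_
  rw [fourier_coe_apply, edge, normSq_lattice]
  have : (t / (π * ((m + (0 : ℤ) * x) ^ 2 + ((0 : ℤ) * t) ^ 2))) ^ a =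
      (t / π) ^ a * (1 / (m : ℝ) ^ (2 * a)) := by
    rw [pow_mul]
    simp [div_pow, mul_pow]
    ring
  rw [this]
  push_cast
  rw [mul_assoc]
  congr 3
  ring

/-- For `n = 0` the Bernoulli polynomial is stored at `l = 0`, where the phase is trivial; this
gives both cases the same form. -/
theorem tsum_edge_mul_cexp {a : ℕ} (ha : 1 ≤ a) {t x u : ℝ} (ht : 0 < t)
    (hx : x ∈ Set.Icc (0 : ℝ) 1) (hu : u ∈ Set.Icc (0 : ℝ) 1) (n : ℤ) :
    ∑' m : ℤ, (edge a t x n m : ℂ) * Complex.exp (2 * π * Complex.I * m * u) =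
      ∑' l : ℤ, (kern a (4 * π * t) n l u : ℂ) *
        Complex.exp (-(2 * π * Complex.I * (n * x) * (u + l))) := by
  by_cases hn : n = 0
  · subst hn
    rw [tsum_edge_mul_cexp_zero ha x hu, tsum_eq_single 0]
    · simp
    · intro l hl
      simp [kern, hl]
  · exact tsum_edge_mul_cexp_of_ne_zero ha ht hx hn u

theorem continuous_kern (a : ℕ) (y : ℝ) (n l : ℤ) : Continuous (kern a y n l) := by
  by_cases hn : n = 0
  · by_cases hl : l = 0
    · have := continuous_bernoulliFun (k := 2 * a)
      have h : kern a y n l = fun u => ((-1) ^ (a + 1) / (2 * a).factorial : ℚ) * y ^ (a : ℤ) *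
          bernoulliFun (2 * a) u := by
        ext u; rw [kern, if_pos hn, if_pos hl]
      rw [h]
      fun_prop
    · have h : kern a y n l = fun _ => 0 := by
        ext u; rw [kern, if_pos hn, if_neg hl]
      rw [h]
      fun_prop
  · have h : kern a y n l = fun u => edgeFourier a y n (u + l) := by
      ext u; rw [kern_of_ne_zero _ _ hn]
    rw [h]
    exact (continuous_edgeFourier a y n).comp (by fun_prop)

theorem summable_pow_mul_exp_int (j : ℕ) {c : ℝ} (hc : 0 < c) :
    Summable fun l : ℤ => (|(l : ℝ)| + 1) ^ j * exp (-(c * (|(l : ℝ)| - 1))) := by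
  have h : Summable fun n : ℕ => ((n : ℝ) + 1) ^ j * exp (-(c * ((n : ℝ) - 1))) := by
    have h1 := (summable_nat_add_iff 1).2 (Real.summable_pow_mul_exp_neg_nat_mul j hc)
    refine (h1.mul_right (exp (2 * c))).congr fun n => ?_
    rw [mul_assoc, ← Real.exp_add]
    push_cast
    congr 2
    ring
  refine Summable.of_nat_of_neg ?_ ?_
  · simpa using h
  · simpa using h

/-- For `u ∈ [0,1]` the distance `|u + l|` differs from `|l|` by at most 1, so the exponential decay
in `l` is uniform in `u`. -/
theorem exists_kern_le (a : ℕ) {y : ℝ} (hy : 0 < y) (n : ℤ) :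
    ∃ M : ℤ → ℝ, Summable M ∧ ∀ l, ∀ u ∈ Set.Icc (0 : ℝ) 1, |kern a y n l u| ≤ M l := by
  by_cases hn : n = 0
  · obtain ⟨K, hK⟩ := isCompact_Icc.exists_bound_of_continuousOn
      (continuous_kern a y n 0).continuousOn (s := Set.Icc (0 : ℝ) 1)
    refine ⟨fun l => if l = 0 then K else 0, ?_, fun l u hu => ?_⟩
    · exact summable_of_ne_finset_zero (s := {0}) (by intro l hl; simp_all)
    · by_cases hl : l = 0
      · subst hl
        simpa using hK u hu
      · simp [kern, hn, hl]
  · have hc : 0 < y * |(n : ℝ)| / 2 := by positivity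
    refine ⟨fun l => ∑ j ∈ Finset.range a, |(edgeCoeff a j : ℝ) * y ^ ((j : ℤ) + 1 - a) *
      |(n : ℝ)| ^ ((j : ℤ) + 1 - 2 * a)| *
        ((|(l : ℝ)| + 1) ^ j * exp (-(y * |(n : ℝ)| / 2 * (|(l : ℝ)| - 1)))), ?_, fun l u hu => ?_⟩
    · exact summable_sum fun j _ => (summable_pow_mul_exp_int j hc).mul_left _
    · rw [kern, if_neg hn]
      refine (Finset.abs_sum_le_sum_abs _ _).trans (Finset.sum_le_sum fun j _ => ?_)
      rw [abs_mul]
      refine mul_le_mul_of_nonneg_left ?_ (abs_nonneg _)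
      rw [abs_of_nonneg (by positivity)]
      have hu' : |u| ≤ 1 := abs_le.2 ⟨by linarith [hu.1], hu.2⟩
      have h1 : |u + l| ≤ |(l : ℝ)| + 1 := by linarith [abs_add_le u l]
      have h2 : |(l : ℝ)| - 1 ≤ |u + l| := by
        have := abs_sub_abs_le_abs_sub (l : ℝ) (-u)
        rw [sub_neg_eq_add, abs_neg, add_comm (l : ℝ)] at this
        linarith
      gcongr

/-! ### Exchanging sums and integrals; convolution through Fourier series -/

theorem hasSum_integral_unit {ι E : Type*} [Countable ι] [NormedAddCommGroup E] [NormedSpace ℝ E]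
    {F : ι → ℝ → E} {f : ℝ → E} {M : ι → ℝ}
    (hF : ∀ i, Continuous (F i)) (hM : Summable M)
    (hb : ∀ i, ∀ u ∈ Set.Icc (0 : ℝ) 1, ‖F i u‖ ≤ M i)
    (hf : ∀ u ∈ Set.Icc (0 : ℝ) 1, HasSum (fun i => F i u) (f u)) :
    HasSum (fun i => ∫ u in (0 : ℝ)..1, F i u) (∫ u in (0 : ℝ)..1, f u) := by
  have hsub : ∀ u : ℝ, u ∈ Set.uIoc (0 : ℝ) 1 → u ∈ Set.Icc (0 : ℝ) 1 := by
    intro u hu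
    rw [Set.uIoc_of_le zero_le_one] at hu
    exact ⟨hu.1.le, hu.2⟩
  refine intervalIntegral.hasSum_integral_of_dominated_convergence (fun i _ => M i)
    (fun i => (hF i).aestronglyMeasurable) (fun i => Eventually.of_forall fun u hu => hb i u (hsub u hu))
    (Eventually.of_forall fun u _ => hM) ?_ (Eventually.of_forall fun u hu => hf u (hsub u hu))
  exact intervalIntegrable_const

theorem integral_cexp_int (k : ℤ) :
    ∫ u in (0 : ℝ)..1, Complex.exp (2 * π * Complex.I * k * u) = if k = 0 then 1 else 0 := by
  split_ifs with h
  · simp [h]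
  · have hc : (2 * π * Complex.I * k : ℂ) ≠ 0 := by
      have : (k : ℂ) ≠ 0 := by exact_mod_cast h
      have := Complex.two_pi_I_ne_zero
      positivity
    rw [integral_exp_mul_complex hc]
    have : Complex.exp (2 * π * Complex.I * k) = 1 := by
      rw [mul_comm]; exact Complex.exp_int_mul_two_pi_mul_I k
    simp [this]

theorem hasSum_mul_prod {f : ℤ → ℂ} {g : ℤ × ℤ → ℂ} (hf : Summable fun m => ‖f m‖)
    (hg : Summable fun m => ‖g m‖) :
    HasSum (fun q : ℤ × ℤ × ℤ => f q.1 * g q.2) ((∑' m, f m) * ∑' m, g m) := by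
  have h := summable_mul_of_summable_norm hf hg
  exact HasSum.mul hf.of_norm.hasSum hg.of_norm.hasSum h

theorem hasSum_mul₃ {f₁ f₂ f₃ : ℤ → ℂ} (h₁ : Summable fun m => ‖f₁ m‖)
    (h₂ : Summable fun m => ‖f₂ m‖) (h₃ : Summable fun m => ‖f₃ m‖) :
    HasSum (fun q : ℤ × ℤ × ℤ => f₁ q.1 * (f₂ q.2.1 * f₃ q.2.2))
      ((∑' m, f₁ m) * ((∑' m, f₂ m) * ∑' m, f₃ m)) := by
  rw [tsum_mul_tsum_of_summable_norm h₂ h₃]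
  exact hasSum_mul_prod (g := fun q : ℤ × ℤ => f₂ q.1 * f₃ q.2) h₁ (h₂.mul_norm h₃)

theorem summable_mul_prod {f : ℤ → ℝ} {g : ℤ × ℤ → ℝ} (hf : Summable f) (hg : Summable g)
    (nf : 0 ≤ f) (ng : 0 ≤ g) : Summable fun q : ℤ × ℤ × ℤ => f q.1 * g q.2 :=
  Summable.mul_of_nonneg hf hg nf ng

theorem summable_mul₃ {f₁ f₂ f₃ : ℤ → ℝ} (h₁ : Summable f₁) (h₂ : Summable f₂) (h₃ : Summable f₃)
    (n₁ : 0 ≤ f₁) (n₂ : 0 ≤ f₂) (n₃ : 0 ≤ f₃) :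
    Summable fun q : ℤ × ℤ × ℤ => f₁ q.1 * (f₂ q.2.1 * f₃ q.2.2) := by
  have h := Summable.mul_of_nonneg h₂ h₃ n₂ n₃
  exact summable_mul_prod (g := fun q : ℤ × ℤ => f₂ q.1 * f₃ q.2) h₁ h n₁
    fun q => mul_nonneg (n₂ q.1) (n₃ q.2)

theorem norm_cexp_int (m : ℤ) (u : ℝ) : ‖Complex.exp (2 * π * Complex.I * m * u)‖ = 1 := by
  simp [Complex.norm_exp]

theorem summable_norm_mul_cexp {f : ℤ → ℂ} (hf : Summable fun m => ‖f m‖) (u : ℝ) :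
    Summable fun m : ℤ => ‖f m * Complex.exp (2 * π * Complex.I * m * u)‖ := by
  simpa only [norm_mul, norm_cexp_int, mul_one] using hf

theorem integral_mul_cexp₃ (c₁ c₂ c₃ : ℂ) (i j k : ℤ) :
    (∫ u in (0 : ℝ)..1, c₁ * Complex.exp (2 * π * Complex.I * i * u) *
        (c₂ * Complex.exp (2 * π * Complex.I * j * u) *
        (c₃ * Complex.exp (2 * π * Complex.I * k * u)))) =
      if i + j + k = 0 then c₁ * (c₂ * c₃) else 0 := by
  have h : ∀ u : ℝ, c₁ * Complex.exp (2 * π * Complex.I * i * u) *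
      (c₂ * Complex.exp (2 * π * Complex.I * j * u) *
      (c₃ * Complex.exp (2 * π * Complex.I * k * u))) =
      c₁ * (c₂ * c₃) * Complex.exp (2 * π * Complex.I * ((i + j + k : ℤ) : ℂ) * u) := by
    intro u
    rw [show 2 * π * Complex.I * ((i + j + k : ℤ) : ℂ) * u =
      2 * π * Complex.I * i * u + 2 * π * Complex.I * j * u +
        2 * π * Complex.I * k * u by push_cast; ring, Complex.exp_add, Complex.exp_add]
    ring
  simp_rw [h]
  rw [intervalIntegral.integral_const_mul, integral_cexp_int]
  split_ifs <;> simp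

/-- Orthogonality of characters leaves a sum supported on a plane; here the plane is parametrized by
its first two coordinates. -/
theorem hasSum_prod_of_add_eq_zero {F : ℤ × ℤ × ℤ → ℂ} {s : ℂ}
    (h : HasSum (fun q : ℤ × ℤ × ℤ => if q.1 + q.2.1 + q.2.2 = 0 then F q else 0) s) :
    HasSum (fun p : ℤ × ℤ => F (p.1, p.2, -p.1 - p.2)) s := by
  have hinj : Function.Injective fun p : ℤ × ℤ => ((p.1, p.2, -p.1 - p.2) : ℤ × ℤ × ℤ) := by
    rintro ⟨a, b⟩ ⟨c, d⟩ h
    simp only [Prod.mk.injEq] at h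
    exact Prod.ext h.1 h.2.1
  rw [← hinj.hasSum_iff] at h
  · convert h using 1
    ext p
    simp only [Function.comp]
    rw [if_pos (by ring)]
  · rintro ⟨a, b, c⟩ hq
    rw [if_neg]
    intro h
    exact hq ⟨(a, b), by simp only [Prod.mk.injEq, true_and]; simp at h; omega⟩

theorem hasSum_integral_mul₃ {f₁ f₂ f₃ : ℤ → ℂ} (h₁ : Summable fun m => ‖f₁ m‖)
    (h₂ : Summable fun m => ‖f₂ m‖) (h₃ : Summable fun m => ‖f₃ m‖) :
    HasSum (fun q : ℤ × ℤ × ℤ => ∫ u in (0 : ℝ)..1,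
        f₁ q.1 * Complex.exp (2 * π * Complex.I * q.1 * u) *
        (f₂ q.2.1 * Complex.exp (2 * π * Complex.I * q.2.1 * u) *
        (f₃ q.2.2 * Complex.exp (2 * π * Complex.I * q.2.2 * u))))
      (∫ u in (0 : ℝ)..1, (∑' m : ℤ, f₁ m * Complex.exp (2 * π * Complex.I * m * u)) *
        ((∑' m : ℤ, f₂ m * Complex.exp (2 * π * Complex.I * m * u)) *
          ∑' m : ℤ, f₃ m * Complex.exp (2 * π * Complex.I * m * u))) := by
  have hM := summable_mul₃ h₁ h₂ h₃ (fun _ => norm_nonneg _) (fun _ => norm_nonneg _)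
      (fun _ => norm_nonneg _)
  refine hasSum_integral_unit (fun q => ?_) hM (fun q u _ => ?_) (fun u _ => ?_)
  · fun_prop
  · simp only [norm_mul, norm_cexp_int, mul_one, le_refl]
  · exact hasSum_mul₃ (f₁ := fun m : ℤ => f₁ m * Complex.exp (2 * π * Complex.I * m * u))
      (f₂ := fun m : ℤ => f₂ m * Complex.exp (2 * π * Complex.I * m * u))
      (f₃ := fun m : ℤ => f₃ m * Complex.exp (2 * π * Complex.I * m * u))
      (summable_norm_mul_cexp h₁ u) (summable_norm_mul_cexp h₂ u) (summable_norm_mul_cexp h₃ u)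

/-- The convolution of three summable sequences at `0`, as an integral of their Fourier series. -/
theorem hasSum_convolution {f₁ f₂ f₃ : ℤ → ℂ} (h₁ : Summable fun m => ‖f₁ m‖)
    (h₂ : Summable fun m => ‖f₂ m‖) (h₃ : Summable fun m => ‖f₃ m‖) :
    HasSum (fun p : ℤ × ℤ => f₁ p.1 * (f₂ p.2 * f₃ (-p.1 - p.2)))
      (∫ u in (0 : ℝ)..1, (∑' m : ℤ, f₁ m * Complex.exp (2 * π * Complex.I * m * u)) *
        ((∑' m : ℤ, f₂ m * Complex.exp (2 * π * Complex.I * m * u)) *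
          ∑' m : ℤ, f₃ m * Complex.exp (2 * π * Complex.I * m * u))) := by
  have key := hasSum_integral_mul₃ h₁ h₂ h₃
  simp only [integral_mul_cexp₃] at key
  exact hasSum_prod_of_add_eq_zero (F := fun q => f₁ q.1 * (f₂ q.2.1 * f₃ q.2.2)) key

/-! ### Absolute convergence of the lattice sum -/

/-- The square of the smallest of the three numbers is at most the product of the other two. -/
theorem pow_mul_le_of_nonneg {b₁ b₂ b₃ : ℝ} (h₁ : 0 ≤ b₁) (h₂ : 0 ≤ b₂) (h₃ : 0 ≤ b₃) :
    b₁ ^ 2 * b₂ ^ 2 * b₃ ^ 2 ≤ b₁ ^ 3 * b₂ ^ 3 + b₁ ^ 3 * b₃ ^ 3 + b₂ ^ 3 * b₃ ^ 3 := by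
  have key : ∀ {a b c : ℝ}, 0 ≤ a → 0 ≤ b → 0 ≤ c → c ≤ a → c ≤ b →
      a ^ 2 * b ^ 2 * c ^ 2 ≤ a ^ 3 * b ^ 3 := by
    intro a b c ha hb hc h1 h2
    calc a ^ 2 * b ^ 2 * c ^ 2 = a ^ 2 * b ^ 2 * (c * c) := by ring
      _ ≤ a ^ 2 * b ^ 2 * (a * b) := by gcongr
      _ = a ^ 3 * b ^ 3 := by ring
  have p₁₂ : 0 ≤ b₁ ^ 3 * b₂ ^ 3 := by positivity
  have p₁₃ : 0 ≤ b₁ ^ 3 * b₃ ^ 3 := by positivity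
  have p₂₃ : 0 ≤ b₂ ^ 3 * b₃ ^ 3 := by positivity
  rcases le_total b₁ b₂ with h12 | h12
  · rcases le_total b₁ b₃ with h13 | h13
    · linarith [key h₂ h₃ h₁ h12 h13]
    · linarith [key h₁ h₂ h₃ h13 (h13.trans h12)]
  · rcases le_total b₂ b₃ with h23 | h23
    · linarith [key h₁ h₃ h₂ h12 h23]
    · linarith [key h₁ h₂ h₃ (h23.trans h12) h23]

theorem summable_size_inv : Summable fun p : ℤ × ℤ => (size p.1 p.2)⁻¹ ^ 3 := by
  have h := EisensteinSeries.summable_one_div_norm_rpow (k := 3) (by norm_num)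
  have h2 := (finTwoArrowEquiv ℤ).symm.summable_iff.2 h
  refine h2.congr fun p => ?_
  have : ‖(finTwoArrowEquiv ℤ).symm p‖ = size p.1 p.2 := by
    rw [EisensteinSeries.norm_eq_max_natAbs, size]
    simp [Nat.cast_natAbs]
  simp only [Function.comp]
  rw [this, Real.rpow_neg (size_nonneg _ _), inv_pow]
  norm_cast

/-- Bound for the summand of the graph function. -/
def sizeBound (p : (ℤ × ℤ) × (ℤ × ℤ)) : ℝ :=
  (size p.1.1 p.2.1 ^ 2)⁻¹ * (size p.1.2 p.2.2 ^ 2)⁻¹ *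
    (size (-p.1.1 - p.1.2) (-p.2.1 - p.2.2) ^ 2)⁻¹

/-- The weakest decay, `|p₁|^{-2} |p₂|^{-2} |p₃|^{-2}`, is dominated by products of `|p|^{-3}` over
two of the momenta. Any two momenta determine the third, and `Σ |p|^{-3}` converges over the planar
lattice. -/
theorem summable_sizeBound : Summable sizeBound := by
  have h := summable_size_inv
  have hp : Summable fun q : (ℤ × ℤ) × (ℤ × ℤ) => (size q.1.1 q.1.2)⁻¹ ^ 3 * (size q.2.1 q.2.2)⁻¹ ^ 3 :=
    h.mul_of_nonneg h (fun q => by have := size_nonneg q.1 q.2; positivity)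
      (fun q => by have := size_nonneg q.1 q.2; positivity)
  have i12 : Function.Injective fun p : (ℤ × ℤ) × (ℤ × ℤ) =>
      (((p.1.1, p.2.1), (p.1.2, p.2.2)) : (ℤ × ℤ) × (ℤ × ℤ)) := by
    rintro ⟨⟨a, b⟩, ⟨c, d⟩⟩ ⟨⟨a', b'⟩, ⟨c', d'⟩⟩ h
    simp only [Prod.mk.injEq] at h ⊢
    omega
  have i13 : Function.Injective fun p : (ℤ × ℤ) × (ℤ × ℤ) =>
      (((p.1.1, p.2.1), (-p.1.1 - p.1.2, -p.2.1 - p.2.2)) : (ℤ × ℤ) × (ℤ × ℤ)) := by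
    rintro ⟨⟨a, b⟩, ⟨c, d⟩⟩ ⟨⟨a', b'⟩, ⟨c', d'⟩⟩ h
    simp only [Prod.mk.injEq] at h ⊢
    omega
  have i23 : Function.Injective fun p : (ℤ × ℤ) × (ℤ × ℤ) =>
      (((p.1.2, p.2.2), (-p.1.1 - p.1.2, -p.2.1 - p.2.2)) : (ℤ × ℤ) × (ℤ × ℤ)) := by
    rintro ⟨⟨a, b⟩, ⟨c, d⟩⟩ ⟨⟨a', b'⟩, ⟨c', d'⟩⟩ h
    simp only [Prod.mk.injEq] at h ⊢
    omega
  refine Summable.of_nonneg_of_le (fun p => ?_) (fun p => ?_)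
    (((hp.comp_injective i12).add (hp.comp_injective i13)).add (hp.comp_injective i23))
  · have h1 := size_nonneg
    unfold sizeBound
    positivity
  · simp only [sizeBound, ← inv_pow]
    exact pow_mul_le_of_nonneg (inv_nonneg.2 (size_nonneg _ _)) (inv_nonneg.2 (size_nonneg _ _))
      (inv_nonneg.2 (size_nonneg _ _))

theorem continuous_edge (a : ℕ) {t : ℝ} (ht : 0 < t) (n m : ℤ) :
    Continuous fun x => edge a t x n m := by
  by_cases h : n = 0 ∧ m = 0
  · have : (fun x => edge a t x n m) = fun _ => (0 : ℝ) ^ a := by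
      ext x
      simp [edge, h.1, h.2]
    rw [this]
    exact continuous_const
  · simp only [edge, normSq_lattice]
    refine Continuous.pow (Continuous.div continuous_const (by fun_prop) fun x => ?_) a
    by_cases hn : n = 0
    · have hm : m ≠ 0 := fun hm => h ⟨hn, hm⟩
      subst hn
      simp [hm, pi_ne_zero]
    · have : (0 : ℝ) < (n * t) ^ 2 := by positivity
      positivity

/-- The summand of the graph function at `τ = x + i t`; `p = ((n₁, n₂), (m₁, m₂))`. -/
def graphTerm (a₁ a₂ a₃ : ℕ) (t : ℝ) (p : (ℤ × ℤ) × (ℤ × ℤ)) (x : ℝ) : ℝ :=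
  edge a₁ t x p.1.1 p.2.1 * (edge a₂ t x p.1.2 p.2.2 *
    edge a₃ t x (-p.1.1 - p.1.2) (-p.2.1 - p.2.2))

theorem graphTerm_nonneg (a₁ a₂ a₃ : ℕ) {t : ℝ} (ht : 0 < t) (p : (ℤ × ℤ) × (ℤ × ℤ)) (x : ℝ) :
    0 ≤ graphTerm a₁ a₂ a₃ t p x :=
  mul_nonneg (edge_nonneg _ ht _ _ _) (mul_nonneg (edge_nonneg _ ht _ _ _) (edge_nonneg _ ht _ _ _))

theorem continuous_graphTerm (a₁ a₂ a₃ : ℕ) {t : ℝ} (ht : 0 < t) (p : (ℤ × ℤ) × (ℤ × ℤ)) :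
    Continuous (graphTerm a₁ a₂ a₃ t p) :=
  (continuous_edge _ ht _ _).mul ((continuous_edge _ ht _ _).mul (continuous_edge _ ht _ _))

theorem exists_graphTerm_le {a₁ a₂ a₃ : ℕ} (h₁ : 1 ≤ a₁) (h₂ : 1 ≤ a₂) (h₃ : 1 ≤ a₃) {t : ℝ}
    (ht : 0 < t) : ∃ K : ℝ, ∀ p, ∀ x ∈ Set.Icc (0 : ℝ) 1,
      ‖graphTerm a₁ a₂ a₃ t p x‖ ≤ K * sizeBound p := by
  obtain ⟨K₁, k₁, b₁⟩ := exists_edge_le a₁ h₁ ht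
  obtain ⟨K₂, k₂, b₂⟩ := exists_edge_le a₂ h₂ ht
  obtain ⟨K₃, k₃, b₃⟩ := exists_edge_le a₃ h₃ ht
  refine ⟨K₁ * K₂ * K₃, fun p x hx => ?_⟩
  rw [Real.norm_of_nonneg (graphTerm_nonneg _ _ _ ht _ _), graphTerm, sizeBound]
  calc _ ≤ K₁ * (size p.1.1 p.2.1 ^ 2)⁻¹ * (K₂ * (size p.1.2 p.2.2 ^ 2)⁻¹ *
        (K₃ * (size (-p.1.1 - p.1.2) (-p.2.1 - p.2.2) ^ 2)⁻¹)) := by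
        have e := fun a n m => edge_nonneg a ht x n m
        exact mul_le_mul (b₁ x hx _ _) (mul_le_mul (b₂ x hx _ _) (b₃ x hx _ _) (e _ _ _)
          (by positivity)) (mul_nonneg (e _ _ _) (e _ _ _)) (by positivity)
    _ = _ := by ring

/-- The index of the summand attached to a momentum configuration. -/
def momentaIndex (p : Momenta 3) : (ℤ × ℤ) × (ℤ × ℤ) :=
  (((p.1 0).2, (p.1 1).2), ((p.1 0).1, (p.1 1).1))

theorem momenta_two (p : Momenta 3) : p.1 2 = -p.1 0 - p.1 1 := by
  have h : p.1 0 + p.1 1 + p.1 2 = 0 := by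
    rw [← Fin.sum_univ_three]; exact p.2.2
  have key : ∀ a b c : ℤ × ℤ, a + b + c = 0 → c = -a - b := fun a b c h => by
    linear_combination h
  exact key _ _ _ h

theorem injective_momentaIndex : Function.Injective momentaIndex := by
  intro p q h
  simp only [momentaIndex, Prod.mk.injEq] at h
  have h0 : p.1 0 = q.1 0 := Prod.ext h.2.1 h.1.1
  have h1 : p.1 1 = q.1 1 := Prod.ext h.2.2 h.1.2
  apply Subtype.ext
  funext r
  fin_cases r
  · exact h0
  · exact h1
  · show p.1 2 = q.1 2
    rw [momenta_two, momenta_two, h0, h1]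

/-- An edge factor at zero momentum is `0`, so the condition that momenta be nonzero can be dropped
and the sum runs over a full product of integers. -/
theorem modularC_eq {a₁ a₂ a₃ : ℕ} (h₁ : 1 ≤ a₁) (h₂ : 1 ≤ a₂) (h₃ : 1 ≤ a₃) (t x : ℝ) :
    modularC ![a₁, a₂, a₃] ⟨x, t⟩ = ∑' p, graphTerm a₁ a₂ a₃ t p x := by
  rw [← injective_momentaIndex.tsum_eq]
  · refine tsum_congr fun p => ?_
    rw [Fin.prod_univ_three]
    simp only [graphTerm, edge, momentaIndex, momenta_two]
    simp [mul_assoc]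
  · rintro ⟨⟨n₁, n₂⟩, ⟨m₁, m₂⟩⟩ hp
    rw [Function.mem_support, graphTerm] at hp
    have n1 := left_ne_zero_of_mul hp
    have n2 := left_ne_zero_of_mul (right_ne_zero_of_mul hp)
    have n3 := right_ne_zero_of_mul (right_ne_zero_of_mul hp)
    have z : ∀ {a : ℕ} (_ : 1 ≤ a) {n m : ℤ}, edge a t x n m ≠ 0 → ((m, n) : ℤ × ℤ) ≠ 0 := by
      intro a ha n m h h0
      rw [Prod.mk_eq_zero] at h0
      rw [h0.1, h0.2, edge_zero ha] at h
      exact h rfl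
    refine ⟨⟨![(m₁, n₁), (m₂, n₂), (-m₁ - m₂, -n₁ - n₂)], ?_, ?_⟩, ?_⟩
    · intro r
      fin_cases r
      · exact z h₁ n1
      · exact z h₂ n2
      · exact z h₃ n3
    · rw [Fin.sum_univ_three]
      simp
    · simp [momentaIndex]

theorem hasSum_constantMode {a₁ a₂ a₃ : ℕ} (h₁ : 1 ≤ a₁) (h₂ : 1 ≤ a₂) (h₃ : 1 ≤ a₃) {t : ℝ}
    (ht : 0 < t) :
    HasSum (fun p => ∫ x in (0 : ℝ)..1, graphTerm a₁ a₂ a₃ t p x)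
      (constantMode ![a₁, a₂, a₃] t) := by
  obtain ⟨K, hK⟩ := exists_graphTerm_le h₁ h₂ h₃ ht
  have hs : Summable fun p => K * sizeBound p := summable_sizeBound.mul_left K
  unfold constantMode
  simp_rw [modularC_eq h₁ h₂ h₃]
  exact hasSum_integral_unit (continuous_graphTerm a₁ a₂ a₃ ht) hs hK fun x hx =>
    (Summable.of_norm_bounded hs fun p => hK p x hx).hasSum

/-- The contribution of fixed `(n₁, n₂)` to the constant mode. -/
def modeAt (a₁ a₂ a₃ : ℕ) (t : ℝ) (n : ℤ × ℤ) : ℝ :=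
  ∑' m : ℤ × ℤ, ∫ x in (0 : ℝ)..1, graphTerm a₁ a₂ a₃ t (n, m) x

theorem hasSum_modeAt {a₁ a₂ a₃ : ℕ} (h₁ : 1 ≤ a₁) (h₂ : 1 ≤ a₂) (h₃ : 1 ≤ a₃) {t : ℝ}
    (ht : 0 < t) : HasSum (modeAt a₁ a₂ a₃ t) (constantMode ![a₁, a₂, a₃] t) := by
  have h := hasSum_constantMode h₁ h₂ h₃ ht
  exact h.prod_fiberwise fun n => (h.summable.prod_factor n).hasSum

/-! ### Dual windings and the average over `τ₁` -/

/-- The integral over `u` of a product of three resummed edge factors. -/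
def kernInt (a₁ a₂ a₃ : ℕ) (y : ℝ) (n₁ n₂ n₃ : ℤ) (l : ℤ × ℤ × ℤ) : ℝ :=
  ∫ u in (0 : ℝ)..1, kern a₁ y n₁ l.1 u * (kern a₂ y n₂ l.2.1 u * kern a₃ y n₃ l.2.2 u)

theorem norm_mul₃_le {𝕜 : Type*} [NormedField 𝕜] {A B C : 𝕜} {a b c : ℝ} (hA : ‖A‖ ≤ a)
    (hB : ‖B‖ ≤ b) (hC : ‖C‖ ≤ c) : ‖A * (B * C)‖ ≤ a * (b * c) := by
  rw [norm_mul, norm_mul]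
  exact mul_le_mul hA (mul_le_mul hB hC (norm_nonneg _) ((norm_nonneg _).trans hB))
    (by positivity) ((norm_nonneg _).trans hA)

theorem norm_cexp_phase (c : ℝ) : ‖Complex.exp (-(2 * π * Complex.I * c))‖ = 1 := by
  simp [Complex.norm_exp]

/-- Since the `n_r` add up to zero, `u` drops out of the total phase, leaving the character of `x`
with frequency `-n · l`. -/
theorem integral_kern_mul_phase (a₁ a₂ a₃ : ℕ) (y x : ℝ) {n₁ n₂ n₃ : ℤ} (hn : n₁ + n₂ + n₃ = 0)
    (l : ℤ × ℤ × ℤ) :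
    ∫ u in (0 : ℝ)..1,
      ((kern a₁ y n₁ l.1 u : ℂ) * Complex.exp (-(2 * π * Complex.I * (n₁ * x) * (u + l.1)))) *
      (((kern a₂ y n₂ l.2.1 u : ℂ) * Complex.exp (-(2 * π * Complex.I * (n₂ * x) * (u + l.2.1)))) *
      ((kern a₃ y n₃ l.2.2 u : ℂ) * Complex.exp (-(2 * π * Complex.I * (n₃ * x) * (u + l.2.2))))) =
    (kernInt a₁ a₂ a₃ y n₁ n₂ n₃ l : ℂ) * Complex.exp (2 * π * Complex.I *
      ((-(n₁ * l.1 + n₂ * l.2.1 + n₃ * l.2.2) : ℤ) : ℂ) * x) := by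
  have hn' : (n₃ : ℂ) = -n₁ - n₂ := by
    have : n₃ = -n₁ - n₂ := by omega
    rw [this]; push_cast; ring
  rw [kernInt, ← intervalIntegral.integral_ofReal, ← intervalIntegral.integral_mul_const]
  congr 1
  ext u
  have : Complex.exp (2 * π * Complex.I *
      ((-(n₁ * l.1 + n₂ * l.2.1 + n₃ * l.2.2) : ℤ) : ℂ) * x) =
      Complex.exp (-(2 * π * Complex.I * (n₁ * x) * (u + l.1))) *
      (Complex.exp (-(2 * π * Complex.I * (n₂ * x) * (u + l.2.1))) *
      Complex.exp (-(2 * π * Complex.I * (n₃ * x) * (u + l.2.2)))) := by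
    rw [← Complex.exp_add, ← Complex.exp_add]
    congr 1
    push_cast
    rw [hn']
    ring
  rw [this]
  push_cast
  ring

theorem hasSum_kernInt_mul_phase (a₁ a₂ a₃ : ℕ) {y : ℝ} (hy : 0 < y) (x : ℝ) {n₁ n₂ n₃ : ℤ}
    (hn : n₁ + n₂ + n₃ = 0) :
    HasSum (fun l : ℤ × ℤ × ℤ => (kernInt a₁ a₂ a₃ y n₁ n₂ n₃ l : ℂ) *
      Complex.exp (2 * π * Complex.I * ((-(n₁ * l.1 + n₂ * l.2.1 + n₃ * l.2.2) : ℤ) : ℂ) * x))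
    (∫ u in (0 : ℝ)..1,
      (∑' l : ℤ, (kern a₁ y n₁ l u : ℂ) * Complex.exp (-(2 * π * Complex.I * (n₁ * x) * (u + l)))) *
      ((∑' l : ℤ, (kern a₂ y n₂ l u : ℂ) * Complex.exp (-(2 * π * Complex.I * (n₂ * x) * (u + l)))) *
      ∑' l : ℤ, (kern a₃ y n₃ l u : ℂ) *
        Complex.exp (-(2 * π * Complex.I * (n₃ * x) * (u + l))))) := by
  obtain ⟨M₁, s₁, b₁⟩ := exists_kern_le a₁ hy n₁
  obtain ⟨M₂, s₂, b₂⟩ := exists_kern_le a₂ hy n₂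
  obtain ⟨M₃, s₃, b₃⟩ := exists_kern_le a₃ hy n₃
  have h0 : (0 : ℝ) ∈ Set.Icc (0 : ℝ) 1 := by simp
  have hM := summable_mul₃ s₁ s₂ s₃ (fun l => (abs_nonneg _).trans (b₁ l 0 h0))
    (fun l => (abs_nonneg _).trans (b₂ l 0 h0)) (fun l => (abs_nonneg _).trans (b₃ l 0 h0))
  have ph : ∀ (a : ℕ) (n l : ℤ) (u : ℝ), ‖(kern a y n l u : ℂ) *
      Complex.exp (-(2 * π * Complex.I * (n * x) * (u + l)))‖ = |kern a y n l u| := by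
    intro a n l u
    have := norm_cexp_phase (n * x * (u + l))
    push_cast at this
    rw [norm_mul, Complex.norm_real, Real.norm_eq_abs, mul_assoc (2 * π * Complex.I) (n * x : ℂ),
      this, mul_one]
  have hs : ∀ {a : ℕ} {n : ℤ} {M : ℤ → ℝ}, Summable M →
      (∀ l, ∀ u ∈ Set.Icc (0 : ℝ) 1, |kern a y n l u| ≤ M l) → ∀ u ∈ Set.Icc (0 : ℝ) 1,
      Summable fun l : ℤ => ‖(kern a y n l u : ℂ) *
        Complex.exp (-(2 * π * Complex.I * (n * x) * (u + l)))‖ := by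
    intro a n M hM hb u hu
    simp_rw [ph]
    exact Summable.of_nonneg_of_le (fun _ => abs_nonneg _) (fun l => hb l u hu) hM
  simp_rw [← integral_kern_mul_phase a₁ a₂ a₃ y x hn]
  have ck := fun a n l => continuous_kern a y n l
  refine hasSum_integral_unit (fun q => ?_) hM (fun q u hu => ?_) (fun u hu => ?_)
  · have c1 := ck a₁ n₁ q.1
    have c2 := ck a₂ n₂ q.2.1
    have c3 := ck a₃ n₃ q.2.2
    fun_prop
  · exact norm_mul₃_le (by rw [ph]; exact b₁ _ u hu) (by rw [ph]; exact b₂ _ u hu)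
      (by rw [ph]; exact b₃ _ u hu)
  · exact hasSum_mul₃
      (f₁ := fun l : ℤ => (kern a₁ y n₁ l u : ℂ) *
        Complex.exp (-(2 * π * Complex.I * (n₁ * x) * (u + l))))
      (f₂ := fun l : ℤ => (kern a₂ y n₂ l u : ℂ) *
        Complex.exp (-(2 * π * Complex.I * (n₂ * x) * (u + l))))
      (f₃ := fun l : ℤ => (kern a₃ y n₃ l u : ℂ) *
        Complex.exp (-(2 * π * Complex.I * (n₃ * x) * (u + l))))
      (hs s₁ b₁ u hu) (hs s₂ b₂ u hu) (hs s₃ b₃ u hu)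

theorem exists_kernInt_le (a₁ a₂ a₃ : ℕ) {y : ℝ} (hy : 0 < y) (n₁ n₂ n₃ : ℤ) :
    ∃ M : ℤ × ℤ × ℤ → ℝ, Summable M ∧ ∀ l, |kernInt a₁ a₂ a₃ y n₁ n₂ n₃ l| ≤ M l := by
  obtain ⟨M₁, s₁, b₁⟩ := exists_kern_le a₁ hy n₁
  obtain ⟨M₂, s₂, b₂⟩ := exists_kern_le a₂ hy n₂
  obtain ⟨M₃, s₃, b₃⟩ := exists_kern_le a₃ hy n₃
  have h0 : (0 : ℝ) ∈ Set.Icc (0 : ℝ) 1 := by simp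
  refine ⟨_, summable_mul₃ s₁ s₂ s₃ (fun l => (abs_nonneg _).trans (b₁ l 0 h0))
    (fun l => (abs_nonneg _).trans (b₂ l 0 h0)) (fun l => (abs_nonneg _).trans (b₃ l 0 h0)),
    fun l => ?_⟩
  have := intervalIntegral.norm_integral_le_of_norm_le_const (a := (0 : ℝ)) (b := 1)
    (C := M₁ l.1 * (M₂ l.2.1 * M₃ l.2.2))
    (f := fun u => kern a₁ y n₁ l.1 u * (kern a₂ y n₂ l.2.1 u * kern a₃ y n₃ l.2.2 u))
    (fun u hu => by
      rw [Set.uIoc_of_le zero_le_one] at hu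
      have hu : u ∈ Set.Icc (0 : ℝ) 1 := ⟨hu.1.le, hu.2⟩
      exact norm_mul₃_le (b₁ _ u hu) (b₂ _ u hu) (b₃ _ u hu))
  simpa [kernInt] using this

theorem hasSum_graphTerm {a₁ a₂ a₃ : ℕ} (h₁ : 1 ≤ a₁) (h₂ : 1 ≤ a₂) (h₃ : 1 ≤ a₃) {t x : ℝ}
    (ht : 0 < t) (hx : x ∈ Set.Icc (0 : ℝ) 1) (n₁ n₂ : ℤ) :
    HasSum (fun m : ℤ × ℤ => (graphTerm a₁ a₂ a₃ t ((n₁, n₂), m) x : ℂ))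
      (∑' l : ℤ × ℤ × ℤ, (kernInt a₁ a₂ a₃ (4 * π * t) n₁ n₂ (-n₁ - n₂) l : ℂ) *
        Complex.exp (2 * π * Complex.I *
          ((-(n₁ * l.1 + n₂ * l.2.1 + (-n₁ - n₂) * l.2.2) : ℤ) : ℂ) * x)) := by
  have hs : ∀ {a : ℕ} (_ : 1 ≤ a) (n : ℤ), Summable fun m : ℤ => ‖(edge a t x n m : ℂ)‖ := by
    intro a ha n
    simp_rw [Complex.norm_real]
    exact (summable_edge a ha ht hx n).norm
  have h := hasSum_convolution (hs h₁ n₁) (hs h₂ n₂) (hs h₃ (-n₁ - n₂))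
  rw [(hasSum_kernInt_mul_phase a₁ a₂ a₃ (by positivity : 0 < 4 * π * t) x
    (show n₁ + n₂ + (-n₁ - n₂) = 0 by ring)).tsum_eq]
  convert h using 1
  · ext m
    simp [graphTerm]
  · refine intervalIntegral.integral_congr fun u hu => ?_
    rw [Set.uIcc_of_le zero_le_one] at hu
    simp only [tsum_edge_mul_cexp h₁ ht hx hu, tsum_edge_mul_cexp h₂ ht hx hu,
      tsum_edge_mul_cexp h₃ ht hx hu]

/-- The contribution of `(n₁, n₂)` as a sum over the dual winding numbers `l`. -/
theorem hasSum_kernInt {a₁ a₂ a₃ : ℕ} (h₁ : 1 ≤ a₁) (h₂ : 1 ≤ a₂) (h₃ : 1 ≤ a₃) {t : ℝ}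
    (ht : 0 < t) (n₁ n₂ : ℤ) :
    HasSum (fun l : ℤ × ℤ × ℤ => if n₁ * l.1 + n₂ * l.2.1 + (-n₁ - n₂) * l.2.2 = 0 then
      kernInt a₁ a₂ a₃ (4 * π * t) n₁ n₂ (-n₁ - n₂) l else 0) (modeAt a₁ a₂ a₃ t (n₁, n₂)) := by
  obtain ⟨K, hK⟩ := exists_graphTerm_le h₁ h₂ h₃ ht
  have hsb : Summable fun m => K * sizeBound ((n₁, n₂), m) :=
    (summable_sizeBound.mul_left K).prod_factor (n₁, n₂)
  have A := hasSum_integral_unit (F := fun m x => (graphTerm a₁ a₂ a₃ t ((n₁, n₂), m) x : ℂ))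
    (fun m => Complex.continuous_ofReal.comp (continuous_graphTerm a₁ a₂ a₃ ht _)) hsb
    (fun m x hx => by rw [Complex.norm_real]; exact hK _ x hx)
    (fun x hx => hasSum_graphTerm h₁ h₂ h₃ ht hx n₁ n₂)
  obtain ⟨M, sM, bM⟩ := exists_kernInt_le a₁ a₂ a₃ (by positivity : 0 < 4 * π * t) n₁ n₂ (-n₁ - n₂)
  have nb : ∀ (l : ℤ × ℤ × ℤ) (x : ℝ), ‖(kernInt a₁ a₂ a₃ (4 * π * t) n₁ n₂ (-n₁ - n₂) l : ℂ) *
        Complex.exp (2 * π * Complex.I *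
          ((-(n₁ * l.1 + n₂ * l.2.1 + (-n₁ - n₂) * l.2.2) : ℤ) : ℂ) * x)‖ ≤ M l := by
    intro l x
    rw [norm_mul, norm_cexp_int, mul_one, Complex.norm_real]
    exact bM l
  have B := hasSum_integral_unit (F := fun (l : ℤ × ℤ × ℤ) (x : ℝ) =>
      (kernInt a₁ a₂ a₃ (4 * π * t) n₁ n₂ (-n₁ - n₂) l : ℂ) *
        Complex.exp (2 * π * Complex.I *
          ((-(n₁ * l.1 + n₂ * l.2.1 + (-n₁ - n₂) * l.2.2) : ℤ) : ℂ) * x))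
    (fun l => by fun_prop) sM (fun l x _ => nb l x)
    (fun x _ => (Summable.of_norm_bounded sM fun l => nb l x).hasSum)
  rw [← A.tsum_eq] at B
  have e : ∑' m : ℤ × ℤ, ∫ x in (0 : ℝ)..1, (graphTerm a₁ a₂ a₃ t ((n₁, n₂), m) x : ℂ) =
      ((modeAt a₁ a₂ a₃ t (n₁, n₂) : ℝ) : ℂ) := by
    rw [modeAt, Complex.ofReal_tsum]
    simp_rw [intervalIntegral.integral_ofReal]
  rw [e] at B
  rw [← Complex.hasSum_ofReal]
  refine Eq.mp (congrArg (fun f => HasSum f _) (funext fun l => ?_)) B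
  -- The integral over `x` retains exactly the windings with `n · l = 0`.
  rw [intervalIntegral.integral_const_mul, integral_cexp_int]
  simp only [neg_eq_zero]
  split_ifs <;> simp

/-! ### The class of admissible expansions -/

/-- A Laurent polynomial with exponents in `[1 - w, w]` plus an exponential series with rational
coefficients and exponents in `[2 - w, w - 3]`, as a function of `y = 4 π τ₂`. -/
def IsExpansion (w : ℕ) (G : ℝ → ℝ) : Prop :=
  ∃ (c : ℤ → ℝ) (f : ℤ → ℕ+ → ℚ),
    (∀ m, ∀ ε : ℝ, 0 < ε → Summable fun n : ℕ+ => |(f m n : ℝ)| * exp (-(ε * n))) ∧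
    ∀ y : ℝ, 0 < y → G y = ∑ k ∈ Finset.Icc (1 - (w : ℤ)) w, c k * y ^ k +
      ∑ m ∈ Finset.Icc (2 - (w : ℤ)) (w - 3), y ^ m * ∑' n : ℕ+, (f m n : ℝ) * exp (-(y * n))

theorem summable_of_summable_abs_mul {ι : Type*} {f : ι → ℝ} {g : ι → ℝ} (hg : ∀ i, 0 ≤ g i)
    (h : Summable fun i => |f i| * g i) : Summable fun i => f i * g i := by
  refine Summable.of_norm ?_
  simpa [abs_of_nonneg, hg] using h

namespace IsExpansion

variable {w : ℕ} {G H : ℝ → ℝ}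

theorem congr (hG : IsExpansion w G) (h : ∀ y, 0 < y → H y = G y) : IsExpansion w H := by
  obtain ⟨c, f, hs, he⟩ := hG
  exact ⟨c, f, hs, fun y hy => (h y hy).trans (he y hy)⟩

theorem zero : IsExpansion w fun _ => 0 := by
  refine ⟨0, 0, fun m ε _ => ?_, fun y _ => ?_⟩
  · simp [summable_zero]
  · simp

theorem add (hG : IsExpansion w G) (hH : IsExpansion w H) : IsExpansion w fun y => G y + H y := by
  obtain ⟨c, f, hs, he⟩ := hG
  obtain ⟨c', f', hs', he'⟩ := hH
  refine ⟨fun k => c k + c' k, fun m n => f m n + f' m n, fun m ε hε => ?_, fun y hy => ?_⟩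
  · refine Summable.of_nonneg_of_le (fun n => by positivity) (fun n => ?_)
      ((hs m ε hε).add (hs' m ε hε))
    rw [← add_mul]
    push_cast
    gcongr
    exact abs_add_le _ _
  · dsimp only
    rw [he y hy, he' y hy]
    have e : ∀ m, ∑' n : ℕ+, ((f m n + f' m n : ℚ) : ℝ) * exp (-(y * n)) =
        ∑' n : ℕ+, (f m n : ℝ) * exp (-(y * n)) + ∑' n : ℕ+, (f' m n : ℝ) * exp (-(y * n)) := by
      intro m
      rw [← Summable.tsum_add (summable_of_summable_abs_mul (fun _ => (exp_pos _).le) (hs m y hy))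
        (summable_of_summable_abs_mul (fun _ => (exp_pos _).le) (hs' m y hy))]
      refine tsum_congr fun n => ?_
      push_cast
      ring
    simp only [e, mul_add, add_mul, Finset.sum_add_distrib]
    ring

theorem const_mul (q : ℚ) (hG : IsExpansion w G) : IsExpansion w fun y => q * G y := by
  obtain ⟨c, f, hs, he⟩ := hG
  refine ⟨fun k => q * c k, fun m n => q * f m n, fun m ε hε => ?_, fun y hy => ?_⟩
  · refine ((hs m ε hε).mul_left |(q : ℝ)|).congr fun n => ?_
    push_cast
    rw [abs_mul]
    ring
  · dsimp only
    rw [he y hy, mul_add, Finset.mul_sum, Finset.mul_sum]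
    congr 1
    · exact Finset.sum_congr rfl fun k _ => by ring
    · refine Finset.sum_congr rfl fun m _ => ?_
      rw [mul_left_comm, ← tsum_mul_left]
      congr 1
      refine tsum_congr fun n => ?_
      push_cast
      ring

theorem sum {κ : Type*} (S : Finset κ) {F : κ → ℝ → ℝ} (h : ∀ i ∈ S, IsExpansion w (F i)) :
    IsExpansion w fun y => ∑ i ∈ S, F i y := by
  classical
  induction S using Finset.induction_on with
  | empty => simpa using zero
  | insert a S ha ih =>
    simp only [Finset.sum_insert ha]
    exact (h a (Finset.mem_insert_self a S)).add
      (ih fun i hi => h i (Finset.mem_insert_of_mem hi))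

theorem monomial (c : ℝ) {k : ℤ} (h₁ : 1 - (w : ℤ) ≤ k) (h₂ : k ≤ w) :
    IsExpansion w fun y => c * y ^ k := by
  refine ⟨fun j => if j = k then c else 0, 0, fun m ε _ => by simp [summable_zero], fun y _ => ?_⟩
  simp [Finset.sum_ite_eq', h₁, h₂]

end IsExpansion

/-! ### Subexponential families and regrouping by exponent -/

/-- The ring of families of rational numbers of subexponential growth with respect to `s`. -/
def subexp {ι : Type*} (s : ι → ℕ) : Subring (ι → ℚ) where
  carrier := {q | ∀ ε : ℝ, 0 < ε → ∃ K : ℝ, ∀ i, |(q i : ℝ)| ≤ K * exp (ε * s i)}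
  mul_mem' := by
    intro p q hp hq ε hε
    obtain ⟨K, hK⟩ := hp (ε / 2) (by positivity)
    obtain ⟨L, hL⟩ := hq (ε / 2) (by positivity)
    refine ⟨K * L, fun i => ?_⟩
    have : exp (ε * s i) = exp (ε / 2 * s i) * exp (ε / 2 * s i) := by
      rw [← Real.exp_add]; congr 1; ring
    rw [this, Pi.mul_apply, Rat.cast_mul, abs_mul]
    calc _ ≤ (K * exp (ε / 2 * s i)) * (L * exp (ε / 2 * s i)) :=
          mul_le_mul (hK i) (hL i) (abs_nonneg _) ((abs_nonneg _).trans (hK i))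
      _ = _ := by ring
  one_mem' := fun ε hε => ⟨1, fun i => by
    simp only [Pi.one_apply, Rat.cast_one, abs_one, one_mul]
    exact Real.one_le_exp (by positivity)⟩
  add_mem' := by
    intro p q hp hq ε hε
    obtain ⟨K, hK⟩ := hp ε hε
    obtain ⟨L, hL⟩ := hq ε hε
    refine ⟨K + L, fun i => ?_⟩
    rw [Pi.add_apply, Rat.cast_add, add_mul]
    exact (abs_add_le _ _).trans (add_le_add (hK i) (hL i))
  zero_mem' := fun ε _ => ⟨0, fun i => by simp⟩
  neg_mem' := by
    intro p hp ε hε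
    obtain ⟨K, hK⟩ := hp ε hε
    exact ⟨K, fun i => by simpa using hK i⟩

theorem mem_subexp_of_le {ι : Type*} {s : ι → ℕ} {q : ι → ℚ} (K : ℚ)
    (h : ∀ i, |q i| ≤ K * (s i + 1)) : q ∈ subexp s := by
  intro ε hε
  refine ⟨|(K : ℝ)| * (1 / ε + 1), fun i => ?_⟩
  have h1 : |(q i : ℝ)| ≤ K * (s i + 1) := by exact_mod_cast h i
  have h2 : ε * s i ≤ exp (ε * s i) := by linarith [Real.add_one_le_exp (ε * s i)]
  have h3 : 1 ≤ exp (ε * s i) := Real.one_le_exp (by positivity)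
  have h4 : (s i : ℝ) ≤ 1 / ε * exp (ε * s i) := by
    rw [div_mul_eq_mul_div, le_div_iff₀ hε, one_mul, mul_comm]; exact h2
  calc |(q i : ℝ)| ≤ K * (s i + 1) := h1
    _ ≤ |(K : ℝ)| * (s i + 1) := by gcongr; exact le_abs_self _
    _ ≤ |(K : ℝ)| * (1 / ε * exp (ε * s i) + exp (ε * s i)) := by gcongr
    _ = _ := by ring

theorem mem_subexp_of_bounded {ι : Type*} {s : ι → ℕ} {q : ι → ℚ} (K : ℚ)
    (h : ∀ i, |q i| ≤ K) : q ∈ subexp s := by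
  refine mem_subexp_of_le |K| fun i => (h i).trans ((le_abs_self K).trans ?_)
  have : (0 : ℚ) ≤ s i := Nat.cast_nonneg _
  nlinarith [abs_nonneg K]

section Regroup

variable {ι : Type*} {s N : ι → ℕ} {C : ℝ} {q : ι → ℚ}

/-- The bound `s ≤ C N` turns `e^{-εN}` into decay in `s`; half of that rate absorbs the growth of
`q` and the other half gives convergence. -/
theorem summable_abs_mul_exp (hs : ∀ ε : ℝ, 0 < ε → Summable fun i => exp (-(ε * s i)))
    (hN : ∀ i, N i ≠ 0 → (s i : ℝ) ≤ C * N i) (hq : q ∈ subexp s) {ε : ℝ} (hε : 0 < ε) :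
    Summable fun i : {i // N i ≠ 0} => |(q i : ℝ)| * exp (-(ε * N i)) := by
  have hC : 0 < max C 1 := lt_max_of_lt_right one_pos
  set D := max C 1
  obtain ⟨K, hK⟩ := hq (ε / D / 2) (by positivity)
  have h := ((hs (ε / D / 2) (by positivity)).mul_left K).subtype {i | N i ≠ 0}
  refine Summable.of_nonneg_of_le (fun i => by positivity) (fun i => ?_) h
  have h1 : (s i : ℝ) ≤ D * N i :=
    (hN i i.2).trans (by gcongr; exact le_max_left _ _)
  have h2 : ε / D * s i ≤ ε * N i := by
    calc ε / D * s i ≤ ε / D * (D * N i) := by gcongr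
      _ = ε * N i := by field_simp
  have hK0 := hK i
  calc |(q i : ℝ)| * exp (-(ε * N i)) ≤ (K * exp (ε / D / 2 * s i)) * exp (-(ε / D * s i)) := by
        gcongr
        exact (abs_nonneg _).trans hK0
    _ = K * exp (-(ε / D / 2 * s i)) := by
        rw [mul_assoc, ← Real.exp_add]
        congr 2
        ring

/-- Finiteness is what keeps coefficients rational: each coefficient of `e^{-ny}` is a finite sum of
rationals. -/
theorem finite_fiber (hs : ∀ ε : ℝ, 0 < ε → Summable fun i => exp (-(ε * s i)))
    (hN : ∀ i, N i ≠ 0 → (s i : ℝ) ≤ C * N i) (n : ℕ+) :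
    {i | N i = n}.Finite := by
  have h := (hs 1 one_pos).tendsto_cofinite_zero
  have h2 := h.eventually (gt_mem_nhds (exp_pos (-(C * n))))
  rw [Filter.eventually_cofinite] at h2
  refine h2.subset fun i hi => ?_
  have hi : N i = n := hi
  have := hN i (by rw [hi]; exact n.ne_zero)
  rw [hi] at this
  simp only [Set.mem_ofPred_eq, not_lt, Real.exp_le_exp]
  linarith

/-- A positive exponent as an element of `ℕ+`. -/
def posExponent (N : ι → ℕ) (i : {i // N i ≠ 0}) : ℕ+ := ⟨N i, Nat.pos_of_ne_zero i.2⟩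

theorem exists_regroup (hs : ∀ ε : ℝ, 0 < ε → Summable fun i => exp (-(ε * s i)))
    (hN : ∀ i, N i ≠ 0 → (s i : ℝ) ≤ C * N i) (hq : q ∈ subexp s) :
    ∃ f : ℕ+ → ℚ, (∀ ε : ℝ, 0 < ε → Summable fun n : ℕ+ => |(f n : ℝ)| * exp (-(ε * n))) ∧
      ∀ y : ℝ, 0 < y → ∑' i : {i // N i ≠ 0}, (q i : ℝ) * exp (-(y * N i)) =
        ∑' n : ℕ+, (f n : ℝ) * exp (-(y * n)) := by
  have hfin : ∀ n : ℕ+, Finite {i : {i // N i ≠ 0} // posExponent N i = n} := by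
    intro n
    have := (finite_fiber hs hN n).to_subtype
    refine Finite.of_injective (β := {i | N i = n})
      (fun i => ⟨i.1.1, congrArg PNat.val i.2⟩) ?_
    intro i j h
    have h' : i.1.1 = j.1.1 := congrArg (fun z => z.1) h
    exact Subtype.ext (Subtype.ext h')
  let e := Equiv.sigmaFiberEquiv (posExponent N)
  have hexp : ∀ (n : ℕ+) (i : {i : {i // N i ≠ 0} // posExponent N i = n}), N i.1.1 = n := by
    intro n i
    exact congrArg PNat.val i.2
  have hs1 := fun ε hε => e.summable_iff.2 (summable_abs_mul_exp hs hN hq (ε := ε) hε)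
  have cast_f : ∀ n : ℕ+, ((∑ᶠ i : {i : {i // N i ≠ 0} // posExponent N i = n}, q i.1.1 : ℚ) : ℝ) =
      ∑' i : {i : {i // N i ≠ 0} // posExponent N i = n}, (q i.1.1 : ℝ) := by
    intro n
    have := hfin n
    let _ := Fintype.ofFinite {i : {i // N i ≠ 0} // posExponent N i = n}
    rw [tsum_fintype, finsum_eq_sum_of_fintype, Rat.cast_sum]
  refine ⟨fun n => ∑ᶠ i : {i : {i // N i ≠ 0} // posExponent N i = n}, q i.1.1, fun ε hε => ?_,
    fun y hy => ?_⟩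
  · refine Summable.of_nonneg_of_le (fun n => by positivity) (fun n => ?_) (hs1 ε hε).sigma
    dsimp only
    rw [cast_f n]
    have := hfin n
    let _ := Fintype.ofFinite {i : {i // N i ≠ 0} // posExponent N i = n}
    rw [tsum_fintype, tsum_fintype]
    refine (mul_le_mul_of_nonneg_right (Finset.abs_sum_le_sum_abs _ _) (exp_pos _).le).trans ?_
    rw [Finset.sum_mul]
    refine Finset.sum_le_sum fun i _ => le_of_eq ?_
    have := hexp n i
    simp only [Function.comp, e, Equiv.sigmaFiberEquiv_apply]
    rw [this]
  · have h2 := summable_of_summable_abs_mul (fun _ => (exp_pos _).le)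
      (summable_abs_mul_exp hs hN hq hy)
    have h3 := Summable.tsum_sigma (e.summable_iff.2 h2)
    simp only [Function.comp] at h3
    rw [← e.tsum_eq, h3]
    refine tsum_congr fun n => ?_
    rw [cast_f n, ← tsum_mul_right]
    refine tsum_congr fun i => ?_
    have := hexp n i
    simp only [e, Equiv.sigmaFiberEquiv_apply]
    rw [this]

theorem summable_mul_exp (hs : ∀ ε : ℝ, 0 < ε → Summable fun i => exp (-(ε * s i)))
    (hN : ∀ i, N i ≠ 0 → (s i : ℝ) ≤ C * N i) (hq : q ∈ subexp s)
    (h0 : Summable fun i : {i // N i = 0} => (q i : ℝ)) {y : ℝ} (hy : 0 < y) :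
    Summable fun i => (q i : ℝ) * exp (-(y * N i)) := by
  rw [← summable_subtype_and_compl (s := {i | N i = 0})]
  refine ⟨?_, ?_⟩
  · refine h0.congr fun i => ?_
    have : N i = 0 := i.2
    simp [this]
  · exact summable_of_summable_abs_mul (fun _ => (exp_pos _).le) (summable_abs_mul_exp hs hN hq hy)

/-- Indices with `N = 0` contribute an infinite sum, possibly irrational, but only to the real
Laurent coefficient of `y^m`. The remaining ones are regrouped into the exponential series. -/
theorem isExpansion_tsum (hs : ∀ ε : ℝ, 0 < ε → Summable fun i => exp (-(ε * s i)))
    (hN : ∀ i, N i ≠ 0 → (s i : ℝ) ≤ C * N i) (hq : q ∈ subexp s)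
    (h0 : Summable fun i : {i // N i = 0} => (q i : ℝ)) {w : ℕ} {m : ℤ} (h₁ : 2 - (w : ℤ) ≤ m)
    (h₂ : m ≤ w - 3) :
    IsExpansion w fun y => y ^ m * ∑' i, (q i : ℝ) * exp (-(y * N i)) := by
  obtain ⟨f, hf, hfe⟩ := exists_regroup hs hN hq
  have A : IsExpansion w fun y => (∑' i : {i // N i = 0}, (q i : ℝ)) * y ^ m :=
    IsExpansion.monomial _ (by omega) (by omega)
  have B : IsExpansion w fun y => y ^ m * ∑' n : ℕ+, (f n : ℝ) * exp (-(y * n)) := by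
    refine ⟨0, fun k => if k = m then f else 0, fun k ε hε => ?_, fun y _ => ?_⟩
    · dsimp only
      split_ifs
      · exact hf ε hε
      · simp [summable_zero]
    · rw [Finset.sum_eq_single_of_mem m (Finset.mem_Icc.2 ⟨h₁, h₂⟩)]
      · simp
      · intro k _ hk
        simp [hk]
  refine (A.add B).congr fun y hy => ?_
  rw [← (summable_mul_exp hs hN hq h0 hy).tsum_subtype_add_tsum_subtype_compl {i | N i = 0},
    mul_add, mul_comm]
  congr 1
  · congr 1
    refine tsum_congr fun i => ?_
    have : N i = 0 := i.2
    simp [this]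
  · congr 1
    exact hfe y hy

/-- A family of functions whose sum has an expansion. -/
def IsExpFamily (w : ℕ) (F : ι → ℝ → ℝ) : Prop :=
  (∀ y : ℝ, 0 < y → Summable fun i => F i y) ∧ IsExpansion w fun y => ∑' i, F i y

namespace IsExpFamily

variable {w : ℕ} {F G : ι → ℝ → ℝ}

theorem congr (hF : IsExpFamily w F) (h : ∀ i y, 0 < y → G i y = F i y) : IsExpFamily w G :=
  ⟨fun y hy => (hF.1 y hy).congr fun i => (h i y hy).symm,
    hF.2.congr fun y hy => tsum_congr fun i => h i y hy⟩

theorem add (hF : IsExpFamily w F) (hG : IsExpFamily w G) :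
    IsExpFamily w fun i y => F i y + G i y :=
  ⟨fun y hy => (hF.1 y hy).add (hG.1 y hy),
    (hF.2.add hG.2).congr fun y hy => (hF.1 y hy).tsum_add (hG.1 y hy)⟩

theorem const_mul (hF : IsExpFamily w F) (c : ℚ) : IsExpFamily w fun i y => c * F i y :=
  ⟨fun y hy => (hF.1 y hy).mul_left _, (hF.2.const_mul c).congr fun _ _ => tsum_mul_left⟩

theorem sum {κ : Type*} (S : Finset κ) {F : κ → ι → ℝ → ℝ} (h : ∀ k ∈ S, IsExpFamily w (F k)) :
    IsExpFamily w fun i y => ∑ k ∈ S, F k i y :=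
  ⟨fun y hy => summable_sum fun k hk => (h k hk).1 y hy,
    (IsExpansion.sum S fun k hk => (h k hk).2).congr fun y hy =>
      Summable.tsum_finsetSum fun k hk => (h k hk).1 y hy⟩

theorem of_subexp (hs : ∀ ε : ℝ, 0 < ε → Summable fun i => exp (-(ε * s i)))
    (hN : ∀ i, N i ≠ 0 → (s i : ℝ) ≤ C * N i) (hq : q ∈ subexp s)
    (h0 : Summable fun i : {i // N i = 0} => (q i : ℝ)) {m : ℤ} (h₁ : 2 - (w : ℤ) ≤ m)
    (h₂ : m ≤ w - 3) : IsExpFamily w fun i y => y ^ m * ((q i : ℝ) * exp (-(y * N i))) :=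
  ⟨fun _ hy => (summable_mul_exp hs hN hq h0 hy).mul_left _,
    (isExpansion_tsum hs hN hq h0 h₁ h₂).congr fun _ _ => tsum_mul_left⟩

end IsExpFamily

end Regroup

/-! ### Exponential sums and integrals of polynomials against exponentials -/

theorem summable_exp_add {α β : Type*} {f : α → ℝ} {g : β → ℝ} (hf : Summable fun a => exp (-f a))
    (hg : Summable fun b => exp (-g b)) : Summable fun p : α × β => exp (-(f p.1 + g p.2)) := by
  have h := Summable.mul_of_nonneg hf hg (fun _ => (exp_pos _).le) (fun _ => (exp_pos _).le)
  refine h.congr fun p => ?_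
  rw [← Real.exp_add]
  congr 1
  ring

theorem summable_exp_natAbs {ε : ℝ} (hε : 0 < ε) :
    Summable fun l : ℤ => exp (-(ε * (l.natAbs : ℝ))) := by
  have h := (summable_pow_mul_exp_int 0 hε).mul_right (exp (-ε))
  refine h.congr fun l => ?_
  rw [pow_zero, one_mul, ← Real.exp_add, Nat.cast_natAbs, Int.cast_abs]
  congr 1
  ring

-- Repeated integration by parts in closed form: `W = Σ c^{-i-1} P^{(i)}` solves `cW - W' = P`, so
-- `-W e^{-cu}` is an antiderivative.
open Polynomial in
theorem integral_eval_mul_exp (P : ℝ[X]) {D : ℕ} (hD : P.natDegree ≤ D) {c : ℝ} (hc : c ≠ 0) :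
    ∫ u in (0 : ℝ)..1, P.eval u * exp (-(c * u)) =
      ∑ i ∈ Finset.range (D + 1), (c ^ (i + 1))⁻¹ *
        ((derivative^[i] P).eval 0 - exp (-c) * (derivative^[i] P).eval 1) := by
  set W : ℝ[X] := ∑ i ∈ Finset.range (D + 1), C (c ^ (i + 1))⁻¹ * derivative^[i] P with hW
  have hrec : C c * W - derivative W = P := by
    have e1 : C c * W = ∑ i ∈ Finset.range (D + 1), C (c ^ i)⁻¹ * derivative^[i] P := by
      rw [hW, Finset.mul_sum]
      refine Finset.sum_congr rfl fun i _ => ?_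
      rw [← mul_assoc, ← C_mul]
      congr 2
      field_simp
      ring
    have e2 : derivative W =
        ∑ i ∈ Finset.range (D + 1), C (c ^ (i + 1))⁻¹ * derivative^[i + 1] P := by
      rw [hW, derivative_sum]
      refine Finset.sum_congr rfl fun i _ => ?_
      rw [derivative_C_mul, Function.iterate_succ_apply']
    rw [e1, e2, Finset.sum_range_succ', Finset.sum_range_succ,
      iterate_derivative_eq_zero (Nat.lt_succ_of_le hD)]
    simp
  have hder : ∀ u : ℝ, HasDerivAt (fun u => -(W.eval u * exp (-(c * u))))
      (P.eval u * exp (-(c * u))) u := by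
    intro u
    have h1 : HasDerivAt (fun u => exp (-(c * u))) (exp (-(c * u)) * (-c)) u := by
      have := ((hasDerivAt_id u).const_mul c).neg.exp
      simpa using this
    refine ((W.hasDerivAt u).mul h1).neg.congr_deriv ?_
    have := congrArg (Polynomial.eval u) hrec
    simp only [eval_sub, eval_mul, eval_C] at this
    rw [← this]
    ring
  rw [intervalIntegral.integral_eq_sub_of_hasDerivAt (fun u _ => hder u)
    (Continuous.intervalIntegrable (by fun_prop) _ _)]
  have hev : ∀ v, W.eval v =
      ∑ i ∈ Finset.range (D + 1), (c ^ (i + 1))⁻¹ * (derivative^[i] P).eval v := by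
    intro v
    simp [hW, eval_finsetSum]
  rw [hev, hev]
  simp only [mul_sub, Finset.sum_sub_distrib, mul_one, mul_zero, neg_zero, exp_zero]
  rw [sub_neg_eq_add, neg_add_eq_sub, Finset.sum_mul]
  congr 1
  exact Finset.sum_congr rfl fun i _ => by ring

/-! ### Three nonzero momenta -/

/-- The sign of `u + l` for `u ∈ (0, 1)`. -/
def sgn (l : ℤ) : ℤ := if 0 ≤ l then 1 else -1

theorem abs_add_eq_sgn {u : ℝ} (hu : u ∈ Set.Icc (0 : ℝ) 1) (l : ℤ) :
    |u + l| = sgn l * (u + l) := by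
  unfold sgn
  split_ifs with h
  · have : (0 : ℝ) ≤ l := by exact_mod_cast h
    rw [abs_of_nonneg (by linarith [hu.1])]
    simp
  · have : (l : ℝ) ≤ -1 := by exact_mod_cast (by omega : l ≤ -1)
    rw [abs_of_nonpos (by linarith [hu.2])]
    simp

theorem natAbs_eq_sgn (l : ℤ) : (l.natAbs : ℤ) = sgn l * l := by
  unfold sgn; split_ifs <;> omega

/-- Valid at `l = 0` and at `l = -1` because `sgn 0 = 1`; the sign is that of the open interval `(l,
l + 1)`. -/
theorem natAbs_add_one (l : ℤ) : ((l + 1).natAbs : ℤ) = l.natAbs + sgn l := by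
  unfold sgn; split_ifs <;> omega

theorem abs_sgn (l : ℤ) : |sgn l| = 1 := by
  unfold sgn; split_ifs <;> simp

/-- Half of `∑ |n_r| |l_r|`. -/
def halfNorm (n₁ n₂ n₃ l₁ l₂ l₃ : ℤ) : ℕ :=
  (n₁.natAbs * l₁.natAbs + n₂.natAbs * l₂.natAbs + n₃.natAbs * l₃.natAbs) / 2

/-- Taking absolute values does not change parity, and `n · l = 0` is even, so the division by 2 is
exact. -/
theorem two_mul_halfNorm {n₁ n₂ n₃ l₁ l₂ l₃ : ℤ} (h : n₁ * l₁ + n₂ * l₂ + n₃ * l₃ = 0) :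
    2 * halfNorm n₁ n₂ n₃ l₁ l₂ l₃ =
      n₁.natAbs * l₁.natAbs + n₂.natAbs * l₂.natAbs + n₃.natAbs * l₃.natAbs := by
  unfold halfNorm
  simp only [← Int.natAbs_mul]
  omega

/-- Up to a common sign, `Σ n_r = 0` is the only signed relation `Σ ±|n_r| = 0` among nonzero `n_r`.
If the sum vanished, the signs of the `l_r` would therefore match those of the `n_r` up to a common
sign, and all `n_r l_r` would have one weak sign. Then `n · l = 0` forces every `l_r = 0`, and the
sum is `Σ |n_r| > 0`. -/
theorem sum_sgn_mul_ne_zero {n₁ n₂ n₃ l₁ l₂ l₃ : ℤ} (h₁ : n₁ ≠ 0) (h₂ : n₂ ≠ 0) (h₃ : n₃ ≠ 0)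
    (hn : n₁ + n₂ + n₃ = 0) (h : n₁ * l₁ + n₂ * l₂ + n₃ * l₃ = 0) :
    sgn l₁ * n₁.natAbs + sgn l₂ * n₂.natAbs + sgn l₃ * n₃.natAbs ≠ 0 := by
  have key : ∀ {n l : ℤ}, n ≠ 0 → (0 < n ∧ 0 ≤ n * l ∧ sgn l * n.natAbs = n) ∨
      (0 < n ∧ n * l < 0 ∧ sgn l * n.natAbs = -n) ∨ (n < 0 ∧ n * l ≤ 0 ∧ sgn l * n.natAbs = -n) ∨
      (n < 0 ∧ 0 < n * l ∧ sgn l * n.natAbs = n) := by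
    intro n l hn
    unfold sgn
    rcases lt_or_gt_of_ne hn with h | h
    · rcases lt_or_ge l 0 with hl | hl
      · have := mul_pos_of_neg_of_neg h hl
        rw [if_neg (not_le.2 hl)]
        omega
      · have := mul_nonpos_of_nonpos_of_nonneg h.le hl
        rw [if_pos hl]
        omega
    · rcases lt_or_ge l 0 with hl | hl
      · have := mul_neg_of_pos_of_neg h hl
        rw [if_neg (not_le.2 hl)]
        omega
      · have := mul_nonneg h.le hl
        rw [if_pos hl]
        omega
  have k₁ := key (l := l₁) h₁
  have k₂ := key (l := l₂) h₂
  have k₃ := key (l := l₃) h₃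
  generalize sgn l₁ * n₁.natAbs = x₁ at *
  generalize sgn l₂ * n₂.natAbs = x₂ at *
  generalize sgn l₃ * n₃.natAbs = x₃ at *
  generalize n₁ * l₁ = z₁ at *
  generalize n₂ * l₂ = z₂ at *
  generalize n₃ * l₃ = z₃ at *
  omega

/-- If some `n_r l_r` is nonzero, then at least two are, since they add up to zero. This bounds two
of the `|n_r|` by the products, hence also the third; the `|l_r|` are bounded because `|n_r| ≥ 1`.
The constant 18 is not sharp. -/
theorem le_halfNorm {n₁ n₂ n₃ l₁ l₂ l₃ : ℤ} (h₁ : n₁ ≠ 0) (h₂ : n₂ ≠ 0) (h₃ : n₃ ≠ 0)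
    (hn : n₁ + n₂ + n₃ = 0) (h : n₁ * l₁ + n₂ * l₂ + n₃ * l₃ = 0)
    (h0 : halfNorm n₁ n₂ n₃ l₁ l₂ l₃ ≠ 0) :
    n₁.natAbs + n₂.natAbs + n₃.natAbs + (l₁.natAbs + l₂.natAbs + l₃.natAbs) ≤
      18 * halfNorm n₁ n₂ n₃ l₁ l₂ l₃ := by
  have hN := two_mul_halfNorm h
  set N := halfNorm n₁ n₂ n₃ l₁ l₂ l₃
  have key : ∀ {n l : ℤ}, n ≠ 0 → l.natAbs ≤ n.natAbs * l.natAbs ∧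
      ((n * l = 0 ∧ n.natAbs * l.natAbs = 0) ∨ n.natAbs ≤ n.natAbs * l.natAbs) := by
    intro n l hn
    refine ⟨Nat.le_mul_of_pos_left _ (Int.natAbs_pos.2 hn), ?_⟩
    by_cases hl : l = 0
    · left; simp [hl]
    · right; exact Nat.le_mul_of_pos_right _ (Int.natAbs_pos.2 hl)
  have key2 : ∀ n l : ℤ, n * l = 0 → n.natAbs * l.natAbs = 0 := by
    intro n l h; rw [← Int.natAbs_mul, h]; rfl
  have k₁ := key (l := l₁) h₁
  have k₂ := key (l := l₂) h₂
  have k₃ := key (l := l₃) h₃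
  have z₁ := key2 n₁ l₁
  have z₂ := key2 n₂ l₂
  have z₃ := key2 n₃ l₃
  generalize n₁.natAbs * l₁.natAbs = x₁ at *
  generalize n₂.natAbs * l₂.natAbs = x₂ at *
  generalize n₃.natAbs * l₃.natAbs = x₃ at *
  generalize n₁ * l₁ = y₁ at *
  generalize n₂ * l₂ = y₂ at *
  generalize n₃ * l₃ = y₃ at *
  omega

/-- Pairs of nonvanishing momenta `n` and dual windings `l` with `n · l = 0`. -/
def Windings : Type :=
  {q : (ℤ × ℤ) × (ℤ × ℤ × ℤ) // (q.1.1 ≠ 0 ∧ q.1.2 ≠ 0 ∧ -q.1.1 - q.1.2 ≠ 0) ∧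
    q.1.1 * q.2.1 + q.1.2 * q.2.2.1 + (-q.1.1 - q.1.2) * q.2.2.2 = 0}

namespace Windings

variable (i : Windings)

def n₁ : ℤ := i.1.1.1
def n₂ : ℤ := i.1.1.2
def n₃ : ℤ := -i.1.1.1 - i.1.1.2
def l₁ : ℤ := i.1.2.1
def l₂ : ℤ := i.1.2.2.1
def l₃ : ℤ := i.1.2.2.2

theorem n₁_ne : i.n₁ ≠ 0 := i.2.1.1
theorem n₂_ne : i.n₂ ≠ 0 := i.2.1.2.1
theorem n₃_ne : i.n₃ ≠ 0 := i.2.1.2.2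

theorem n_sum : i.n₁ + i.n₂ + i.n₃ = 0 := by
  unfold n₁ n₂ n₃; ring

theorem dot_eq : i.n₁ * i.l₁ + i.n₂ * i.l₂ + i.n₃ * i.l₃ = 0 := i.2.2

theorem dot_eq' : i.n₁ * (i.l₁ + 1) + i.n₂ * (i.l₂ + 1) + i.n₃ * (i.l₃ + 1) = 0 := by
  linear_combination i.dot_eq + i.n_sum

/-- The height of a pair `(n, l)`. -/
def height : ℕ := i.n₁.natAbs + i.n₂.natAbs + i.n₃.natAbs +
  (i.l₁.natAbs + i.l₂.natAbs + i.l₃.natAbs)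

/-- The exponent of the boundary term at `u = 0`. -/
def N₀ : ℕ := halfNorm i.n₁ i.n₂ i.n₃ i.l₁ i.l₂ i.l₃

/-- The exponent of the boundary term at `u = 1`. -/
def N₁ : ℕ := halfNorm i.n₁ i.n₂ i.n₃ (i.l₁ + 1) (i.l₂ + 1) (i.l₃ + 1)

/-- The decay rate in `u`. -/
def β : ℤ := i.N₁ - i.N₀

theorem two_mul_N₀ : (2 * i.N₀ : ℤ) = i.n₁.natAbs * (sgn i.l₁ * i.l₁) +
    i.n₂.natAbs * (sgn i.l₂ * i.l₂) + i.n₃.natAbs * (sgn i.l₃ * i.l₃) := by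
  have := two_mul_halfNorm i.dot_eq
  rw [← natAbs_eq_sgn, ← natAbs_eq_sgn, ← natAbs_eq_sgn]
  exact_mod_cast this

theorem two_mul_β : 2 * i.β = sgn i.l₁ * i.n₁.natAbs + sgn i.l₂ * i.n₂.natAbs +
    sgn i.l₃ * i.n₃.natAbs := by
  have h0 := i.two_mul_N₀
  have h1 : (2 * i.N₁ : ℤ) = i.n₁.natAbs * (i.l₁ + 1).natAbs + i.n₂.natAbs * (i.l₂ + 1).natAbs +
      i.n₃.natAbs * (i.l₃ + 1).natAbs := by exact_mod_cast two_mul_halfNorm i.dot_eq'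
  rw [natAbs_add_one, natAbs_add_one, natAbs_add_one, natAbs_eq_sgn i.l₁, natAbs_eq_sgn i.l₂,
    natAbs_eq_sgn i.l₃] at h1
  unfold β
  linear_combination h1 - h0

/-- A zero slope would make the integrand a pure polynomial times `e^{-yN₀}`; excluding it makes
division by powers of `β` legitimate. -/
theorem β_ne : i.β ≠ 0 := by
  have h := sum_sgn_mul_ne_zero i.n₁_ne i.n₂_ne i.n₃_ne i.n_sum i.dot_eq
  rw [← i.two_mul_β] at h
  omega

theorem height_le_N₀ (h : i.N₀ ≠ 0) : (i.height : ℝ) ≤ 36 * i.N₀ := by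
  have : i.height ≤ 18 * i.N₀ := le_halfNorm i.n₁_ne i.n₂_ne i.n₃_ne i.n_sum i.dot_eq h
  have : i.height ≤ 36 * i.N₀ := by omega
  exact_mod_cast this

theorem height_le_N₁ (h : i.N₁ ≠ 0) : (i.height : ℝ) ≤ 36 * i.N₁ := by
  have h1 := le_halfNorm i.n₁_ne i.n₂_ne i.n₃_ne i.n_sum i.dot_eq' h
  -- Replacing `l_r` by `l_r + 1` changes the height by at most 3, which doubling the constant
  -- absorbs since `N₁ ≥ 1`.
  have : i.height ≤ 36 * i.N₁ := by
    unfold height N₁ at *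
    omega
  exact_mod_cast this

theorem summable_exp_height {ε : ℝ} (hε : 0 < ε) :
    Summable fun i : Windings => exp (-(ε * i.height)) := by
  have h := summable_exp_natAbs hε
  have h2 := summable_exp_add h h
  have h3 := summable_exp_add h h2
  have h5 := summable_exp_add h2 h3
  refine Summable.of_nonneg_of_le (fun i => (exp_pos _).le) (fun i => ?_) (h5.subtype
    {q | (q.1.1 ≠ 0 ∧ q.1.2 ≠ 0 ∧ -q.1.1 - q.1.2 ≠ 0) ∧
    q.1.1 * q.2.1 + q.1.2 * q.2.2.1 + (-q.1.1 - q.1.2) * q.2.2.2 = 0})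
  simp only [Function.comp, Real.exp_le_exp, neg_le_neg_iff]
  -- The weight of `n₃` is discarded: the other five coordinates range over independent integers.
  have : (0 : ℝ) ≤ ε * (i.n₃.natAbs : ℝ) := by positivity
  unfold height
  push_cast
  simp only [n₁, n₂, l₁, l₂, l₃] at *
  linarith

theorem l_eq_zero (h : i.N₀ = 0) : i.l₁ = 0 ∧ i.l₂ = 0 ∧ i.l₃ = 0 := by
  have h1 := two_mul_halfNorm i.dot_eq
  rw [show halfNorm i.n₁ i.n₂ i.n₃ i.l₁ i.l₂ i.l₃ = 0 from h] at h1
  have a := i.n₁_ne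
  have b := i.n₂_ne
  have c := i.n₃_ne
  simp only [mul_zero] at h1
  have h2 := h1.symm
  simp only [Nat.add_eq_zero_iff, Nat.mul_eq_zero, Int.natAbs_eq_zero, a, b, c, false_or] at h2
  exact ⟨h2.1.1, h2.1.2, h2.2⟩

theorem l_eq_neg_one (h : i.N₁ = 0) : i.l₁ = -1 ∧ i.l₂ = -1 ∧ i.l₃ = -1 := by
  have h1 := two_mul_halfNorm i.dot_eq'
  rw [show halfNorm i.n₁ i.n₂ i.n₃ (i.l₁ + 1) (i.l₂ + 1) (i.l₃ + 1) = 0 from h] at h1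
  have a := i.n₁_ne
  have b := i.n₂_ne
  have c := i.n₃_ne
  simp only [mul_zero] at h1
  have h2 := h1.symm
  simp only [Nat.add_eq_zero_iff, Nat.mul_eq_zero, Int.natAbs_eq_zero, a, b, c, false_or] at h2
  omega

/-- In either case all windings are equal, so `2|β| = Σ |n_r|`, and a sum of zero makes each `|n_r|`
at most half of that. -/
theorem natAbs_le_β (h : i.N₀ = 0 ∨ i.N₁ = 0) :
    i.n₁.natAbs ≤ i.β.natAbs ∧ i.n₂.natAbs ≤ i.β.natAbs := by
  have hβ := i.two_mul_β
  have hn := i.n_sum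
  rcases h with h | h
  · obtain ⟨e1, e2, e3⟩ := i.l_eq_zero h
    rw [e1, e2, e3, show sgn 0 = 1 by simp [sgn]] at hβ
    omega
  · obtain ⟨e1, e2, e3⟩ := i.l_eq_neg_one h
    rw [e1, e2, e3, show sgn (-1) = -1 by simp [sgn]] at hβ
    omega

theorem injOn_of_l_eq {S : Set Windings} {a b c : ℤ}
    (hS : ∀ i ∈ S, i.l₁ = a ∧ i.l₂ = b ∧ i.l₃ = c) :
    Function.Injective fun i : S => ((i.1.n₁, i.1.n₂) : ℤ × ℤ) := by
  rintro ⟨i, hi⟩ ⟨j, hj⟩ h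
  obtain ⟨a1, a2, a3⟩ := hS i hi
  obtain ⟨b1, b2, b3⟩ := hS j hj
  simp only [Prod.mk.injEq] at h
  apply Subtype.ext
  apply Subtype.ext
  refine Prod.ext (Prod.ext h.1 h.2) (Prod.ext ?_ (Prod.ext ?_ ?_))
  · exact a1.trans b1.symm
  · exact a2.trans b2.symm
  · exact a3.trans b3.symm

/-- Summability over the pairs with fixed `l` for which a boundary exponent vanishes. -/
theorem summable_of_le {S : Set Windings} {a b c : ℤ}
    (hS : ∀ i ∈ S, i.l₁ = a ∧ i.l₂ = b ∧ i.l₃ = c) (hβ : ∀ i ∈ S, i.N₀ = 0 ∨ i.N₁ = 0)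
    {q : S → ℝ} (K : ℝ)
    (hq : ∀ i : S, |q i| ≤ K * (|(i.1.n₁ : ℝ)|⁻¹ * |(i.1.n₂ : ℝ)|⁻¹ * |(i.1.β : ℝ)|⁻¹)) :
    Summable q := by
  -- As `|β|` dominates both momenta, `|β|⁻¹ ≤ |n₁|^{-1/2} |n₂|^{-1/2}`, which raises both exponents
  -- to the summable `3/2`.
  have h1 := Real.summable_abs_int_rpow (b := 3 / 2) (by norm_num)
  have h2 := Summable.mul_of_nonneg h1 h1 (fun _ => by positivity) (fun _ => by positivity)
  have h3 := (h2.mul_left |K|).comp_injective (injOn_of_l_eq hS)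
  refine Summable.of_norm_bounded h3 fun i => (hq i).trans ?_
  obtain ⟨b1, b2⟩ := i.1.natAbs_le_β (hβ i.1 i.2)
  have p1 := one_le_abs_cast i.1.n₁_ne
  have p2 := one_le_abs_cast i.1.n₂_ne
  have e1 : |(i.1.n₁ : ℝ)| ≤ |(i.1.β : ℝ)| := by
    rw [← Int.cast_abs, ← Int.cast_abs, Int.abs_eq_natAbs, Int.abs_eq_natAbs]; exact_mod_cast b1
  have e2 : |(i.1.n₂ : ℝ)| ≤ |(i.1.β : ℝ)| := by
    rw [← Int.cast_abs, ← Int.cast_abs, Int.abs_eq_natAbs, Int.abs_eq_natAbs]; exact_mod_cast b2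
  simp only [Function.comp]
  generalize |(i.1.n₁ : ℝ)| = A at *
  generalize |(i.1.n₂ : ℝ)| = B at *
  generalize |(i.1.β : ℝ)| = b at *
  have hA : 0 < A := by linarith
  have hB : 0 < B := by linarith
  have hb : 0 < b := by linarith
  have r : ∀ x : ℝ, 0 < x → x ^ (-(3 / 2) : ℝ) = x⁻¹ * (x ^ (1 / 2 : ℝ))⁻¹ := by
    intro x hx
    rw [← Real.rpow_neg hx.le, ← Real.rpow_neg_one x, ← Real.rpow_add hx]
    norm_num
  have s : b⁻¹ ≤ (A ^ (1 / 2 : ℝ))⁻¹ * (B ^ (1 / 2 : ℝ))⁻¹ := by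
    rw [← mul_inv]
    have hbb : b = b ^ (1 / 2 : ℝ) * b ^ (1 / 2 : ℝ) := by
      rw [← Real.rpow_add hb]; norm_num
    apply inv_anti₀ (by positivity)
    rw [hbb]
    gcongr
  rw [r A hA, r B hB]
  calc K * (A⁻¹ * B⁻¹ * b⁻¹) ≤ |K| * (A⁻¹ * B⁻¹ * b⁻¹) := by
        gcongr; exact le_abs_self K
    _ ≤ |K| * (A⁻¹ * B⁻¹ * ((A ^ (1 / 2 : ℝ))⁻¹ * (B ^ (1 / 2 : ℝ))⁻¹)) := by gcongr
    _ = _ := by ring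

end Windings

open Polynomial in
/-- The polynomial `∏ (sgn l_r * (X + l_r)) ^ j_r`. -/
def windingPoly (j₁ j₂ j₃ : ℕ) (l₁ l₂ l₃ : ℤ) : ℝ[X] :=
  (C (sgn l₁ : ℝ) * (X + C (l₁ : ℝ))) ^ j₁ * ((C (sgn l₂ : ℝ) * (X + C (l₂ : ℝ))) ^ j₂ *
    (C (sgn l₃ : ℝ) * (X + C (l₃ : ℝ))) ^ j₃)

open Polynomial in
theorem natDegree_windingPoly (j₁ j₂ j₃ : ℕ) (l₁ l₂ l₃ : ℤ) :
    (windingPoly j₁ j₂ j₃ l₁ l₂ l₃).natDegree ≤ j₁ + (j₂ + j₃) := by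
  have h : ∀ (j : ℕ) (l : ℤ), ((C (sgn l : ℝ) * (X + C (l : ℝ))) ^ j).natDegree ≤ j := by
    intro j l
    refine (natDegree_pow_le_of_le j (natDegree_C_mul_le _ _)).trans ?_
    rw [natDegree_X_add_C, mul_one]
  exact natDegree_mul_le_of_le (h _ _) (natDegree_mul_le_of_le (h _ _) (h _ _))

theorem eval_windingPoly (j₁ j₂ j₃ : ℕ) (l₁ l₂ l₃ : ℤ) {u : ℝ} (hu : u ∈ Set.Icc (0 : ℝ) 1) :
    (windingPoly j₁ j₂ j₃ l₁ l₂ l₃).eval u =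
      |u + l₁| ^ j₁ * (|u + l₂| ^ j₂ * |u + l₃| ^ j₃) := by
  rw [abs_add_eq_sgn hu, abs_add_eq_sgn hu, abs_add_eq_sgn hu]
  simp [windingPoly]

/-- Evaluation of a family of rational numbers at an index. -/
def subexpEval {ι : Type*} (s : ι → ℕ) (i : ι) : subexp s →+* ℝ :=
  (Rat.castHom ℝ).comp ((Pi.evalRingHom (fun _ => ℚ) i).comp (subexp s).subtype)

theorem subexpEval_apply {ι : Type*} (s : ι → ℕ) (i : ι) (q : subexp s) :
    subexpEval s i q = ((q.1 i : ℚ) : ℝ) := rfl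

-- Working with polynomials over the ring of subexponential families makes every derivative value
-- rational and subexponential without estimates; evaluation at an index recovers the real
-- polynomial.
open Polynomial in
theorem subexpEval_iterate_derivative {ι : Type*} (s : ι → ℕ) (i : ι) (Q : (subexp s)[X]) (k : ℕ)
    (e : ℕ) : subexpEval s i ((derivative^[k] Q).eval (e : subexp s)) =
      (derivative^[k] (Q.map (subexpEval s i))).eval (e : ℝ) := by
  rw [iterate_derivative_map, eval_natCast_map]

namespace Windings

theorem sgn_mem (l : Windings → ℤ) : (fun i => (sgn (l i) : ℚ)) ∈ subexp height :=
  mem_subexp_of_bounded 1 fun i => by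
    rw [← Int.cast_abs, abs_sgn]; simp

theorem natAbs_le_mem {l : Windings → ℤ} (h : ∀ i, (l i).natAbs ≤ i.height) :
    (fun i => (l i : ℚ)) ∈ subexp height :=
  mem_subexp_of_le 1 fun i => by
    have h1 : ((l i).natAbs : ℚ) ≤ i.height := Nat.cast_le.2 (h i)
    rw [Nat.cast_natAbs, Int.cast_abs] at h1
    linarith

theorem l₁_mem : (fun i : Windings => (i.l₁ : ℚ)) ∈ subexp height :=
  natAbs_le_mem fun i => by unfold height; omega

theorem l₂_mem : (fun i : Windings => (i.l₂ : ℚ)) ∈ subexp height :=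
  natAbs_le_mem fun i => by unfold height; omega

theorem l₃_mem : (fun i : Windings => (i.l₃ : ℚ)) ∈ subexp height :=
  natAbs_le_mem fun i => by unfold height; omega

open Polynomial in
/-- `windingPoly` as a polynomial with coefficients in the ring of subexponential families. -/
def poly (j₁ j₂ j₃ : ℕ) : (subexp height)[X] :=
  (C ⟨_, sgn_mem l₁⟩ * (X + C ⟨_, l₁_mem⟩)) ^ j₁ * ((C ⟨_, sgn_mem l₂⟩ * (X + C ⟨_, l₂_mem⟩)) ^ j₂ *
    (C ⟨_, sgn_mem l₃⟩ * (X + C ⟨_, l₃_mem⟩)) ^ j₃)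

theorem map_poly (j₁ j₂ j₃ : ℕ) (i : Windings) :
    (poly j₁ j₂ j₃).map (subexpEval height i) = windingPoly j₁ j₂ j₃ i.l₁ i.l₂ i.l₃ := by
  simp [poly, windingPoly, subexpEval_apply]

open Polynomial in
/-- Coefficients of the boundary terms at `u = e`. -/
def coeff (e : ℕ) (f₁ f₂ f₃ : ℤ) (j₁ j₂ j₃ k : ℕ) (i : Windings) : ℚ :=
  |(i.n₁ : ℚ)| ^ f₁ * |(i.n₂ : ℚ)| ^ f₂ * |(i.n₃ : ℚ)| ^ f₃ * ((i.β : ℚ) ^ (k + 1))⁻¹ *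
    ((derivative^[k] (poly j₁ j₂ j₃)).eval (e : subexp height)).1 i

open Polynomial in
theorem coeff_eq (e : ℕ) (f₁ f₂ f₃ : ℤ) (j₁ j₂ j₃ k : ℕ) (i : Windings) :
    (coeff e f₁ f₂ f₃ j₁ j₂ j₃ k i : ℝ) =
      |(i.n₁ : ℝ)| ^ f₁ * |(i.n₂ : ℝ)| ^ f₂ * |(i.n₃ : ℝ)| ^ f₃ * ((i.β : ℝ) ^ (k + 1))⁻¹ *
      (derivative^[k] (windingPoly j₁ j₂ j₃ i.l₁ i.l₂ i.l₃)).eval (e : ℝ) := by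
  rw [← map_poly, ← subexpEval_iterate_derivative, subexpEval_apply, coeff]
  push_cast
  rfl

theorem zpow_le_inv {x : ℝ} (hx : 1 ≤ x) {f : ℤ} (hf : f ≤ -1) : x ^ f ≤ x⁻¹ := by
  rw [← zpow_neg_one]
  exact zpow_le_zpow_right₀ hx hf

theorem abs_zpow_mem {n : Windings → ℤ} (hn : ∀ i, n i ≠ 0) {f : ℤ} (hf : f ≤ 0) :
    (fun i => |(n i : ℚ)| ^ f) ∈ subexp height :=
  mem_subexp_of_bounded 1 fun i => by
    have h : (1 : ℚ) ≤ |(n i : ℚ)| := by exact_mod_cast Int.one_le_abs (hn i)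
    rw [abs_of_nonneg (by positivity)]
    exact zpow_le_one_of_nonpos₀ h hf

theorem coeff_mem (e : ℕ) {f₁ f₂ f₃ : ℤ} (h₁ : f₁ ≤ 0) (h₂ : f₂ ≤ 0) (h₃ : f₃ ≤ 0)
    (j₁ j₂ j₃ k : ℕ) : coeff e f₁ f₂ f₃ j₁ j₂ j₃ k ∈ subexp height := by
  refine mul_mem (mul_mem (mul_mem (mul_mem (abs_zpow_mem n₁_ne h₁) (abs_zpow_mem n₂_ne h₂))
    (abs_zpow_mem n₃_ne h₃)) (mem_subexp_of_bounded 1 fun i => ?_)) (Subtype.property _)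
  have h : (1 : ℚ) ≤ |(i.β : ℚ)| := by exact_mod_cast Int.one_le_abs i.β_ne
  rw [abs_inv, abs_pow]
  exact inv_le_one_of_one_le₀ (one_le_pow₀ h)

/-- With `l` fixed the polynomial value is a constant, and convergence over `n` comes from the
factors `|n₁|⁻¹ |n₂|⁻¹ |β|⁻¹` alone. -/
theorem summable_coeff (e : ℕ) {f₁ f₂ f₃ : ℤ} (h₁ : f₁ ≤ -1) (h₂ : f₂ ≤ -1) (h₃ : f₃ ≤ -1)
    (j₁ j₂ j₃ k : ℕ) {S : Set Windings} {a b c : ℤ}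
    (hS : ∀ i ∈ S, i.l₁ = a ∧ i.l₂ = b ∧ i.l₃ = c) (hβ : ∀ i ∈ S, i.N₀ = 0 ∨ i.N₁ = 0) :
    Summable fun i : S => (coeff e f₁ f₂ f₃ j₁ j₂ j₃ k i : ℝ) := by
  set v := (Polynomial.derivative^[k] (windingPoly j₁ j₂ j₃ a b c)).eval (e : ℝ) with hv
  refine summable_of_le hS hβ |v| fun i => ?_
  obtain ⟨ha, hb, hc⟩ := hS i.1 i.2
  rw [coeff_eq, ha, hb, hc, ← hv, abs_mul, mul_comm]
  refine mul_le_mul_of_nonneg_left ?_ (abs_nonneg v)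
  have p₁ := one_le_abs_cast i.1.n₁_ne
  have p₂ := one_le_abs_cast i.1.n₂_ne
  have p₃ := one_le_abs_cast i.1.n₃_ne
  have pβ := one_le_abs_cast i.1.β_ne
  have hβ' : ((|(i.1.β : ℝ)|) ^ (k + 1))⁻¹ ≤ |(i.1.β : ℝ)|⁻¹ :=
    inv_anti₀ (by positivity) (le_self_pow₀ pβ (by omega))
  have b₁ := zpow_le_inv p₁ h₁
  have b₂ := zpow_le_inv p₂ h₂
  have b₃ : |(i.1.n₃ : ℝ)| ^ f₃ ≤ 1 := zpow_le_one_of_nonpos₀ p₃ (by omega)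
  rw [abs_mul, abs_inv, abs_pow, abs_of_nonneg (by positivity :
    0 ≤ |(i.1.n₁ : ℝ)| ^ f₁ * |(i.1.n₂ : ℝ)| ^ f₂ * |(i.1.n₃ : ℝ)| ^ f₃)]
  calc _ ≤ |(i.1.n₁ : ℝ)|⁻¹ * |(i.1.n₂ : ℝ)|⁻¹ * 1 * |(i.1.β : ℝ)|⁻¹ := by gcongr
    _ = _ := by ring

theorem isExpFamily_left {w : ℕ} {f₁ f₂ f₃ : ℤ} (h₁ : f₁ ≤ -1) (h₂ : f₂ ≤ -1) (h₃ : f₃ ≤ -1)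
    (j₁ j₂ j₃ k : ℕ) {m : ℤ} (hm : 2 - (w : ℤ) ≤ m) (hm' : m ≤ w - 3) :
    IsExpFamily w fun i y => y ^ m * ((coeff 0 f₁ f₂ f₃ j₁ j₂ j₃ k i : ℝ) * exp (-(y * i.N₀))) :=
  IsExpFamily.of_subexp (s := height) (N := N₀) (C := 36) (fun _ hε => summable_exp_height hε)
    height_le_N₀ (coeff_mem 0 (by omega) (by omega) (by omega) _ _ _ _)
    (summable_coeff 0 h₁ h₂ h₃ j₁ j₂ j₃ k (S := {i | N₀ i = 0}) (fun i hi => i.l_eq_zero hi)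
      fun _ hi => Or.inl hi) hm hm'

theorem isExpFamily_right {w : ℕ} {f₁ f₂ f₃ : ℤ} (h₁ : f₁ ≤ -1) (h₂ : f₂ ≤ -1) (h₃ : f₃ ≤ -1)
    (j₁ j₂ j₃ k : ℕ) {m : ℤ} (hm : 2 - (w : ℤ) ≤ m) (hm' : m ≤ w - 3) :
    IsExpFamily w fun i y => y ^ m * ((coeff 1 f₁ f₂ f₃ j₁ j₂ j₃ k i : ℝ) * exp (-(y * i.N₁))) :=
  IsExpFamily.of_subexp (s := height) (N := N₁) (C := 36) (fun _ hε => summable_exp_height hε)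
    height_le_N₁ (coeff_mem 1 (by omega) (by omega) (by omega) _ _ _ _)
    (summable_coeff 1 h₁ h₂ h₃ j₁ j₂ j₃ k (S := {i | N₁ i = 0}) (fun i hi => i.l_eq_neg_one hi)
      fun _ hi => Or.inr hi) hm hm'

/-- The contribution of one term of each of the three resummed edge factors. -/
def integralTerm (f₁ f₂ f₃ : ℤ) (j₁ j₂ j₃ : ℕ) (i : Windings) (y : ℝ) : ℝ :=
  |(i.n₁ : ℝ)| ^ f₁ * |(i.n₂ : ℝ)| ^ f₂ * |(i.n₃ : ℝ)| ^ f₃ *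
    ∫ u in (0 : ℝ)..1, |u + i.l₁| ^ j₁ * (|u + i.l₂| ^ j₂ * |u + i.l₃| ^ j₃) *
      exp (-(y * (i.N₀ + i.β * u)))

/-- The exponent is affine in `u`, so `integral_eval_mul_exp` with `c = yβ` yields boundary terms at
`N₀` and `N₁ = N₀ + β`; each derivative costs one more power of `yβ`. -/
theorem integralTerm_eq (f₁ f₂ f₃ : ℤ) (j₁ j₂ j₃ : ℕ) (i : Windings) {y : ℝ} (hy : 0 < y) (m : ℤ) :
    y ^ m * integralTerm f₁ f₂ f₃ j₁ j₂ j₃ i y = ∑ k ∈ Finset.range (j₁ + (j₂ + j₃) + 1),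
      (y ^ (m - (k + 1)) * ((coeff 0 f₁ f₂ f₃ j₁ j₂ j₃ k i : ℝ) * exp (-(y * i.N₀))) +
        ((-1 : ℚ) : ℝ) *
          (y ^ (m - (k + 1)) * ((coeff 1 f₁ f₂ f₃ j₁ j₂ j₃ k i : ℝ) * exp (-(y * i.N₁))))) := by
  have hβ : (i.β : ℝ) ≠ 0 := by exact_mod_cast i.β_ne
  have hc : y * i.β ≠ 0 := mul_ne_zero hy.ne' hβ
  have e : ∫ u in (0 : ℝ)..1, |u + i.l₁| ^ j₁ * (|u + i.l₂| ^ j₂ * |u + i.l₃| ^ j₃) *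
      exp (-(y * (i.N₀ + i.β * u))) = exp (-(y * i.N₀)) *
      ∫ u in (0 : ℝ)..1, (windingPoly j₁ j₂ j₃ i.l₁ i.l₂ i.l₃).eval u *
        exp (-(y * i.β * u)) := by
    rw [← intervalIntegral.integral_const_mul]
    refine intervalIntegral.integral_congr fun u hu => ?_
    rw [Set.uIcc_of_le zero_le_one] at hu
    rw [eval_windingPoly _ _ _ _ _ _ hu, show -(y * (i.N₀ + i.β * u)) =
      -(y * i.N₀) + -(y * i.β * u) by ring, Real.exp_add]
    ring
  have hN : exp (-(y * i.N₁)) = exp (-(y * i.N₀)) * exp (-(y * i.β)) := by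
    rw [← Real.exp_add]
    congr 1
    unfold β
    push_cast
    ring
  rw [integralTerm, e, integral_eval_mul_exp _ (natDegree_windingPoly _ _ _ _ _ _) hc,
    Finset.mul_sum, Finset.mul_sum, Finset.mul_sum]
  refine Finset.sum_congr rfl fun k _ => ?_
  rw [coeff_eq, coeff_eq, hN, zpow_sub₀ hy.ne', show ((k : ℤ) + 1) = ((k + 1 : ℕ) : ℤ) by push_cast; ring,
    zpow_natCast, mul_pow, mul_inv]
  push_cast
  ring

/-- The polynomial has degree at most `j₁ + j₂ + j₃`, so at most one more than that many powers of
`y` are lost; the bounds on `m` keep the result within `[2 - w, w - 3]`. -/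
theorem isExpFamily_integralTerm {w : ℕ} {f₁ f₂ f₃ : ℤ} (h₁ : f₁ ≤ -1) (h₂ : f₂ ≤ -1)
    (h₃ : f₃ ≤ -1) (j₁ j₂ j₃ : ℕ) {m : ℤ} (hm : 3 - (w : ℤ) + (j₁ + (j₂ + j₃)) ≤ m)
    (hm' : m ≤ w - 2) :
    IsExpFamily w fun i y => y ^ m * integralTerm f₁ f₂ f₃ j₁ j₂ j₃ i y := by
  refine (IsExpFamily.sum (Finset.range (j₁ + (j₂ + j₃) + 1)) fun k hk => ?_).congr
    fun i y hy => integralTerm_eq f₁ f₂ f₃ j₁ j₂ j₃ i hy m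
  have hk := Finset.mem_range.1 hk
  exact (isExpFamily_left h₁ h₂ h₃ j₁ j₂ j₃ k (by omega) (by omega)).add
    ((isExpFamily_right h₁ h₂ h₃ j₁ j₂ j₃ k (by omega) (by omega)).const_mul (-1))

theorem exp_mul_exp_mul_exp (i : Windings) (y : ℝ) {u : ℝ} (hu : u ∈ Set.Icc (0 : ℝ) 1) :
    exp (-(y * |(i.n₁ : ℝ)| / 2 * |u + i.l₁|)) * (exp (-(y * |(i.n₂ : ℝ)| / 2 * |u + i.l₂|)) *
      exp (-(y * |(i.n₃ : ℝ)| / 2 * |u + i.l₃|))) = exp (-(y * (i.N₀ + i.β * u))) := by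
  rw [← Real.exp_add, ← Real.exp_add, abs_add_eq_sgn hu, abs_add_eq_sgn hu, abs_add_eq_sgn hu]
  congr 1
  have h1 := congrArg (Int.cast : ℤ → ℝ) i.two_mul_N₀
  have h2 := congrArg (Int.cast : ℤ → ℝ) i.two_mul_β
  push_cast at h1 h2
  linear_combination (y / 2) * h1 + (y / 2 * u) * h2

theorem kernInt_eq (a₁ a₂ a₃ : ℕ) {y : ℝ} (hy : 0 < y) (i : Windings) :
    kernInt a₁ a₂ a₃ y i.n₁ i.n₂ i.n₃ (i.l₁, i.l₂, i.l₃) =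
      ∑ j₁ ∈ Finset.range a₁, ∑ j₂ ∈ Finset.range a₂, ∑ j₃ ∈ Finset.range a₃,
        ((edgeCoeff a₁ j₁ * edgeCoeff a₂ j₂ * edgeCoeff a₃ j₃ : ℚ) : ℝ) *
          (y ^ (((j₁ : ℤ) + 1 - a₁) + ((j₂ : ℤ) + 1 - a₂) + ((j₃ : ℤ) + 1 - a₃)) *
          integralTerm ((j₁ : ℤ) + 1 - 2 * a₁) ((j₂ : ℤ) + 1 - 2 * a₂) ((j₃ : ℤ) + 1 - 2 * a₃)
            j₁ j₂ j₃ i y) := by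
  have pt : ∀ u ∈ Set.uIcc (0 : ℝ) 1, kern a₁ y i.n₁ i.l₁ u * (kern a₂ y i.n₂ i.l₂ u *
      kern a₃ y i.n₃ i.l₃ u) =
      ∑ j₁ ∈ Finset.range a₁, ∑ j₂ ∈ Finset.range a₂, ∑ j₃ ∈ Finset.range a₃,
        ((edgeCoeff a₁ j₁ * edgeCoeff a₂ j₂ * edgeCoeff a₃ j₃ : ℚ) : ℝ) *
          (y ^ (((j₁ : ℤ) + 1 - a₁) + ((j₂ : ℤ) + 1 - a₂) + ((j₃ : ℤ) + 1 - a₃)) *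
          (|(i.n₁ : ℝ)| ^ ((j₁ : ℤ) + 1 - 2 * a₁) * |(i.n₂ : ℝ)| ^ ((j₂ : ℤ) + 1 - 2 * a₂) *
            |(i.n₃ : ℝ)| ^ ((j₃ : ℤ) + 1 - 2 * a₃) *
            (|u + i.l₁| ^ j₁ * (|u + i.l₂| ^ j₂ * |u + i.l₃| ^ j₃) *
              exp (-(y * (i.N₀ + i.β * u)))))) := by
    intro u hu
    rw [Set.uIcc_of_le zero_le_one] at hu
    rw [kern, kern, kern, if_neg i.n₁_ne, if_neg i.n₂_ne, if_neg i.n₃_ne, Finset.sum_mul_sum,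
      Finset.sum_mul]
    refine Finset.sum_congr rfl fun j₁ _ => ?_
    rw [Finset.mul_sum]
    refine Finset.sum_congr rfl fun j₂ _ => ?_
    rw [Finset.mul_sum]
    refine Finset.sum_congr rfl fun j₃ _ => ?_
    rw [← exp_mul_exp_mul_exp i y hu, zpow_add₀ hy.ne', zpow_add₀ hy.ne']
    push_cast
    ring
  rw [kernInt, intervalIntegral.integral_congr pt, intervalIntegral.integral_finsetSum fun _ _ =>
    Continuous.intervalIntegrable (by fun_prop) _ _]
  refine Finset.sum_congr rfl fun j₁ _ => ?_
  rw [intervalIntegral.integral_finsetSum fun _ _ =>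
    Continuous.intervalIntegrable (by fun_prop) _ _]
  refine Finset.sum_congr rfl fun j₂ _ => ?_
  rw [intervalIntegral.integral_finsetSum fun _ _ =>
    Continuous.intervalIntegrable (by fun_prop) _ _]
  refine Finset.sum_congr rfl fun j₃ _ => ?_
  rw [intervalIntegral.integral_const_mul, intervalIntegral.integral_const_mul,
    intervalIntegral.integral_const_mul, integralTerm]

theorem isExpFamily_kernInt {a₁ a₂ a₃ : ℕ} (h₂ : 1 ≤ a₂) (h₃ : 1 ≤ a₃) :
    IsExpFamily (a₁ + a₂ + a₃) fun (i : Windings) y =>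
      kernInt a₁ a₂ a₃ y i.n₁ i.n₂ i.n₃ (i.l₁, i.l₂, i.l₃) := by
  refine IsExpFamily.congr ?_ fun i y hy => kernInt_eq a₁ a₂ a₃ hy i
  refine IsExpFamily.sum _ fun j₁ hj₁ => IsExpFamily.sum _ fun j₂ hj₂ =>
    IsExpFamily.sum _ fun j₃ hj₃ => IsExpFamily.const_mul ?_ _
  have hj₁ := Finset.mem_range.1 hj₁
  have hj₂ := Finset.mem_range.1 hj₂
  have hj₃ := Finset.mem_range.1 hj₃
  -- The power of `y` is `3 - w + Σ j_r`, exactly the least allowed; each `|n_r|` has exponent at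
  -- most `-a_r ≤ -1`.
  refine isExpFamily_integralTerm (by omega) (by omega) (by omega) j₁ j₂ j₃ ?_ ?_
  · push_cast; omega
  · push_cast; omega

end Windings

/-- The sum over `n` with all three momenta nonzero. -/
theorem hasSum_modeAt_of_ne_zero {a₁ a₂ a₃ : ℕ} (h₁ : 1 ≤ a₁) (h₂ : 1 ≤ a₂) (h₃ : 1 ≤ a₃) {t : ℝ}
    (ht : 0 < t) :
    HasSum (fun n : ℤ × ℤ => if n.1 ≠ 0 ∧ n.2 ≠ 0 ∧ -n.1 - n.2 ≠ 0 then modeAt a₁ a₂ a₃ t n else 0)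
      (∑' i : Windings, kernInt a₁ a₂ a₃ (4 * π * t) i.n₁ i.n₂ i.n₃ (i.l₁, i.l₂, i.l₃)) := by
  have hs := (Windings.isExpFamily_kernInt (a₁ := a₁) h₂ h₃).1 (4 * π * t) (by positivity)
  let S : Set ((ℤ × ℤ) × (ℤ × ℤ × ℤ)) := {q | (q.1.1 ≠ 0 ∧ q.1.2 ≠ 0 ∧ -q.1.1 - q.1.2 ≠ 0) ∧
    q.1.1 * q.2.1 + q.1.2 * q.2.2.1 + (-q.1.1 - q.1.2) * q.2.2.2 = 0}
  let g : (ℤ × ℤ) × (ℤ × ℤ × ℤ) → ℝ := fun q =>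
    kernInt a₁ a₂ a₃ (4 * π * t) q.1.1 q.1.2 (-q.1.1 - q.1.2) q.2
  have h : HasSum (S.indicator g) (∑' i : Windings,
      kernInt a₁ a₂ a₃ (4 * π * t) i.n₁ i.n₂ i.n₃ (i.l₁, i.l₂, i.l₃)) :=
    hasSum_subtype_iff_indicator.1 hs.hasSum
  refine h.prod_fiberwise fun n => ?_
  by_cases hn : n.1 ≠ 0 ∧ n.2 ≠ 0 ∧ -n.1 - n.2 ≠ 0
  · rw [if_pos hn]
    convert hasSum_kernInt h₁ h₂ h₃ ht n.1 n.2 using 1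
    ext l
    by_cases hl : n.1 * l.1 + n.2 * l.2.1 + (-n.1 - n.2) * l.2.2 = 0
    · rw [if_pos hl, Set.indicator_of_mem (show (n, l) ∈ S from ⟨hn, hl⟩)]
    · rw [if_neg hl, Set.indicator_of_notMem (show (n, l) ∉ S from fun h => hl h.2)]
  · rw [if_neg hn]
    convert hasSum_zero using 1
    ext l
    exact Set.indicator_of_notMem (show (n, l) ∉ S from fun h => hn h.1) _

/-! ### One vanishing momentum -/

/-- Constant families, as elements of the ring of subexponential families. -/
def constFamily {ι : Type*} (s : ι → ℕ) : ℚ →+* subexp s :=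
  RingHom.codRestrict (algebraMap ℚ (ι → ℚ)) (subexp s) fun q =>
    mem_subexp_of_bounded |q| fun _ => le_rfl

/-- Index set for the terms with exactly one vanishing momentum. -/
abbrev Ladder : Type := {n : ℤ // n ≠ 0} × ℕ

namespace Ladder

def height (i : Ladder) : ℕ := i.1.1.natAbs + i.2

def N₀ (i : Ladder) : ℕ := i.1.1.natAbs * i.2

def N₁ (i : Ladder) : ℕ := i.1.1.natAbs * (i.2 + 1)

theorem natAbs_pos (i : Ladder) : 1 ≤ i.1.1.natAbs := Int.natAbs_pos.2 i.1.2

theorem height_le_N₁ (i : Ladder) : (height i : ℝ) ≤ 2 * N₁ i := by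
  have h := natAbs_pos i
  have : height i ≤ 2 * N₁ i := by
    unfold height N₁
    nlinarith
  exact_mod_cast this

theorem height_le_N₀ (i : Ladder) (h0 : N₀ i ≠ 0) : (height i : ℝ) ≤ 2 * N₀ i := by
  have h := natAbs_pos i
  have h2 : 1 ≤ i.2 := Nat.pos_of_ne_zero fun h => h0 (by simp [N₀, h])
  have : height i ≤ 2 * N₀ i := by
    unfold height N₀
    nlinarith
  exact_mod_cast this

theorem summable_exp_height {ε : ℝ} (hε : 0 < ε) :
    Summable fun i : Ladder => exp (-(ε * height i)) := by
  have h := (summable_exp_natAbs hε).subtype {n | n ≠ 0}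
  have h' : Summable fun L : ℕ => exp (-(ε * L)) := by
    simpa using Real.summable_pow_mul_exp_neg_nat_mul 0 hε
  refine (summable_exp_add (f := fun n : {n : ℤ // n ≠ 0} => ε * (n.1.natAbs : ℝ)) h h').congr
    fun i => ?_
  unfold height
  push_cast
  congr 1
  ring

theorem level_mem : (fun i : Ladder => (i.2 : ℚ)) ∈ subexp height :=
  mem_subexp_of_le 1 fun i => by
    rw [abs_of_nonneg (Nat.cast_nonneg _)]
    have : (i.2 : ℚ) ≤ height i := Nat.cast_le.2 (by unfold height; omega)
    linarith

theorem natDegree_bernoulli_le (b : ℕ) : (Polynomial.bernoulli b).natDegree ≤ b := by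
  rw [Polynomial.bernoulli]
  exact Polynomial.natDegree_sum_le_of_forall_le _ _ fun i _ =>
    (Polynomial.natDegree_monomial_le _).trans (by omega)

open Polynomial in
/-- The polynomial `B * (X + L) ^ d` for `B` the Bernoulli polynomial of degree `b`. -/
def ladderPoly (b d L : ℕ) : ℝ[X] :=
  (Polynomial.bernoulli b).map (algebraMap ℚ ℝ) * (X + C (L : ℝ)) ^ d

open Polynomial in
theorem natDegree_ladderPoly (b d L : ℕ) : (ladderPoly b d L).natDegree ≤ b + d := by
  refine natDegree_mul_le_of_le (natDegree_map_le.trans ?_) ?_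
  · exact natDegree_bernoulli_le b
  · exact (natDegree_pow_le_of_le d (natDegree_X_add_C _).le).trans (by simp)

open Polynomial in
theorem coeff_ladderPoly (b d L : ℕ) :
    (ladderPoly b d L).coeff (b + d) = (((Polynomial.bernoulli b).coeff b : ℚ) : ℝ) := by
  rw [ladderPoly, coeff_mul_add_eq_of_natDegree_le (natDegree_map_le.trans (natDegree_bernoulli_le b))
    ((natDegree_pow_le_of_le d (natDegree_X_add_C _).le).trans (by simp)), coeff_map]
  have : ((X + C (L : ℝ)) ^ d).coeff d = 1 := by
    have h := (monic_X_add_C (L : ℝ)).pow d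
    have hd : ((X + C (L : ℝ)) ^ d).natDegree = d := by
      rw [(monic_X_add_C (L : ℝ)).natDegree_pow, natDegree_X_add_C, mul_one]
    have hc := h.coeff_natDegree
    rwa [hd] at hc
  rw [this, mul_one]
  rfl

-- The top derivative is a constant depending on the leading coefficient only, hence neither on the
-- endpoint nor on the level `L`.
open Polynomial in
theorem eval_iterate_derivative_ladderPoly (b d L : ℕ) (v : ℝ) :
    (derivative^[b + d] (ladderPoly b d L)).eval v =
      (((b + d).factorial * (Polynomial.bernoulli b).coeff b : ℚ) : ℝ) := by
  have h : (derivative^[b + d] (ladderPoly b d L)).natDegree = 0 :=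
    Nat.le_zero.1 ((natDegree_iterate_derivative _ _).trans (by
      have := natDegree_ladderPoly b d L
      omega))
  rw [eq_C_of_natDegree_eq_zero h, eval_C, coeff_iterate_derivative, zero_add, coeff_ladderPoly,
    Nat.descFactorial_self]
  push_cast
  rw [nsmul_eq_mul]

open Polynomial in
/-- `ladderPoly` as a polynomial with coefficients in the ring of subexponential families. -/
def poly (b d : ℕ) : (subexp height)[X] :=
  (Polynomial.bernoulli b).map (constFamily height) * (X + C ⟨_, level_mem⟩) ^ d

theorem map_poly (b d : ℕ) (i : Ladder) :
    (poly b d).map (subexpEval height i) = ladderPoly b d i.2 := by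
  rw [poly, ladderPoly, Polynomial.map_mul, Polynomial.map_map,
    Subsingleton.elim ((subexpEval height i).comp (constFamily height)) (algebraMap ℚ ℝ)]
  simp [subexpEval_apply]

open Polynomial in
/-- Coefficients of the boundary terms at `u = e`. -/
def coeff (e : ℕ) (f : ℤ) (b d k : ℕ) (i : Ladder) : ℚ :=
  |(i.1.1 : ℚ)| ^ f * ((derivative^[k] (poly b d)).eval (e : subexp height)).1 i

open Polynomial in
theorem coeff_eq (e : ℕ) (f : ℤ) (b d k : ℕ) (i : Ladder) :
    (coeff e f b d k i : ℝ) =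
      |(i.1.1 : ℝ)| ^ f * (derivative^[k] (ladderPoly b d i.2)).eval (e : ℝ) := by
  rw [← map_poly, ← subexpEval_iterate_derivative, subexpEval_apply, coeff]
  push_cast
  rfl

theorem abs_zpow_mem {f : ℤ} (hf : f ≤ 0) :
    (fun i : Ladder => |(i.1.1 : ℚ)| ^ f) ∈ subexp height :=
  mem_subexp_of_bounded 1 fun i => by
    have h : (1 : ℚ) ≤ |(i.1.1 : ℚ)| := by exact_mod_cast Int.one_le_abs i.1.2
    rw [abs_of_nonneg (by positivity)]
    exact zpow_le_one_of_nonpos₀ h hf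

theorem coeff_mem (e : ℕ) {f : ℤ} (hf : f ≤ 0) (b d k : ℕ) : coeff e f b d k ∈ subexp height :=
  mul_mem (abs_zpow_mem hf) (Subtype.property _)

theorem summable_abs_zpow {f : ℤ} (hf : f ≤ -2) :
    Summable fun n : {n : ℤ // n ≠ 0} => |(n.1 : ℝ)| ^ f := by
  have h := (Real.summable_one_div_int_pow (p := 2)).2 (by norm_num)
  refine Summable.of_nonneg_of_le (fun n => by positivity) (fun n => ?_) (h.subtype {n | n ≠ 0})
  have h1 := one_le_abs_cast n.2
  refine (zpow_le_zpow_right₀ h1 hf).trans (le_of_eq ?_)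
  simp [zpow_neg]

theorem summable_coeff_zero {f : ℤ} (hf : f ≤ -2) (b d k : ℕ) :
    Summable fun i : {i // N₀ i = 0} => (coeff 0 f b d k i : ℝ) := by
  have hL : ∀ i : {i // N₀ i = 0}, i.1.2 = 0 := fun i =>
    (Nat.mul_eq_zero.1 i.2).resolve_left (by have := natAbs_pos i.1; omega)
  have hinj : Function.Injective fun i : {i // N₀ i = 0} => i.1.1 := by
    intro i j h
    exact Subtype.ext (Prod.ext h ((hL i).trans (hL j).symm))
  refine (((summable_abs_zpow hf).comp_injective hinj).mul_right
    ((Polynomial.derivative^[k] (ladderPoly b d 0)).eval ((0 : ℕ) : ℝ))).congr fun i => ?_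
  rw [coeff_eq, hL i]
  rfl

theorem isExpFamily_left {w : ℕ} {f : ℤ} (hf : f ≤ -2) (b d k : ℕ) {m : ℤ}
    (hm : 2 - (w : ℤ) ≤ m) (hm' : m ≤ w - 3) :
    IsExpFamily w fun i y => y ^ m * ((coeff 0 f b d k i : ℝ) * exp (-(y * N₀ i))) :=
  IsExpFamily.of_subexp (s := height) (N := N₀) (C := 2) (fun _ hε => summable_exp_height hε)
    height_le_N₀ (coeff_mem 0 (by omega) _ _ _) (summable_coeff_zero hf b d k) hm hm'

theorem isExpFamily_right {w : ℕ} {f : ℤ} (hf : f ≤ -2) (b d k : ℕ) {m : ℤ}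
    (hm : 2 - (w : ℤ) ≤ m) (hm' : m ≤ w - 3) :
    IsExpFamily w fun i y => y ^ m * ((coeff 1 f b d k i : ℝ) * exp (-(y * N₁ i))) := by
  have : IsEmpty {i // N₁ i = 0} := ⟨fun i =>
    (Nat.mul_pos (natAbs_pos i.1) (Nat.succ_pos i.1.2)).ne' i.2⟩
  exact IsExpFamily.of_subexp (s := height) (N := N₁) (C := 2) (fun _ hε => summable_exp_height hε)
    (fun i _ => height_le_N₁ i) (coeff_mem 1 (by omega) _ _ _) summable_empty hm hm'

theorem hasSum_exp_sub {c : ℝ} (hc : 0 < c) :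
    HasSum (fun L : ℕ => exp (-(c * L)) - exp (-(c * (L + 1)))) 1 := by
  have h1 : exp (-c) < 1 := by rw [Real.exp_lt_one_iff]; linarith
  have h := (hasSum_geometric_of_lt_one (exp_pos (-c)).le h1).mul_right (1 - exp (-c))
  rw [inv_mul_cancel₀ (by linarith)] at h
  refine h.congr_fun fun L => ?_
  rw [← Real.exp_nat_mul, mul_sub, mul_one, ← Real.exp_add]
  congr 1
  · congr 1; ring
  · congr 1; ring

/-- For fixed `n` the differences telescope over `L` to 1, because `N₁` at level `L` is `N₀` at
level `L + 1`. The exponentials disappear and a Laurent monomial remains, so the wider range of `m`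
is allowed. -/
theorem isExpFamily_top {w : ℕ} {f : ℤ} (hf : f ≤ -2) {m : ℤ} (hm : 1 - (w : ℤ) ≤ m)
    (hm' : m ≤ w) : IsExpFamily w fun (i : Ladder) y =>
      y ^ m * (|(i.1.1 : ℝ)| ^ f * (exp (-(y * N₀ i)) - exp (-(y * N₁ i)))) := by
  have hsum : ∀ y : ℝ, 0 < y → ∀ n : {n : ℤ // n ≠ 0}, HasSum (fun L : ℕ =>
      y ^ m * (|(n.1 : ℝ)| ^ f * (exp (-(y * N₀ (n, L))) - exp (-(y * N₁ (n, L))))))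
      (y ^ m * |(n.1 : ℝ)| ^ f) := by
    intro y hy n
    have h1 := one_le_abs_cast n.2
    have h := (hasSum_exp_sub (by positivity : 0 < y * |(n.1 : ℝ)|)).mul_left
      (y ^ m * |(n.1 : ℝ)| ^ f)
    rw [mul_one] at h
    refine h.congr_fun fun L => ?_
    unfold N₀ N₁
    push_cast
    simp only [Nat.cast_natAbs, Int.cast_abs]
    ring_nf
  have hnn : ∀ y : ℝ, 0 < y → ∀ i : Ladder,
      0 ≤ y ^ m * (|(i.1.1 : ℝ)| ^ f * (exp (-(y * N₀ i)) - exp (-(y * N₁ i)))) := by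
    intro y hy i
    have : exp (-(y * N₁ i)) ≤ exp (-(y * N₀ i)) := by
      rw [Real.exp_le_exp, neg_le_neg_iff]
      gcongr
      unfold N₀ N₁
      gcongr
      omega
    have := sub_nonneg.2 this
    positivity
  have hs : ∀ y : ℝ, 0 < y → Summable fun i : Ladder =>
      y ^ m * (|(i.1.1 : ℝ)| ^ f * (exp (-(y * N₀ i)) - exp (-(y * N₁ i)))) := by
    intro y hy
    rw [summable_prod_of_nonneg (hnn y hy)]
    refine ⟨fun n => (hsum y hy n).summable, ?_⟩
    simp_rw [fun n => (hsum y hy n).tsum_eq]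
    exact (summable_abs_zpow hf).mul_left _
  refine ⟨hs, (IsExpansion.monomial (∑' n : {n : ℤ // n ≠ 0}, |(n.1 : ℝ)| ^ f) hm hm').congr
    fun y hy => ?_⟩
  rw [(hs y hy).tsum_prod' fun n => (hsum y hy n).summable]
  simp_rw [fun n => (hsum y hy n).tsum_eq]
  rw [tsum_mul_left, mul_comm]

/-- The contribution of one term of each of the two resummed edge factors. -/
def integralTerm (f : ℤ) (b d : ℕ) (i : Ladder) (y : ℝ) : ℝ :=
  |(i.1.1 : ℝ)| ^ f * ∫ u in (0 : ℝ)..1, bernoulliFun b u * (u + i.2) ^ d *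
      exp (-(y * |(i.1.1 : ℝ)| * (u + i.2)))

/-- The last integration by parts is split off because its power of `y` may be `1 - w`, outside the
range permitted beside exponentials. -/
theorem integralTerm_eq (f : ℤ) (b d : ℕ) (i : Ladder) {y : ℝ} (hy : 0 < y) (m : ℤ) :
    y ^ m * integralTerm f b d i y = ∑ k ∈ Finset.range (b + d),
      (y ^ (m - (k + 1)) * ((coeff 0 (f - (k + 1)) b d k i : ℝ) * exp (-(y * N₀ i))) +
        ((-1 : ℚ) : ℝ) *
          (y ^ (m - (k + 1)) * ((coeff 1 (f - (k + 1)) b d k i : ℝ) * exp (-(y * N₁ i))))) +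
      (((b + d).factorial * (Polynomial.bernoulli b).coeff b : ℚ) : ℝ) *
        (y ^ (m - ((b + d : ℕ) + 1)) * (|(i.1.1 : ℝ)| ^ (f - ((b + d : ℕ) + 1)) *
          (exp (-(y * N₀ i)) - exp (-(y * N₁ i))))) := by
  have hn : 0 < |(i.1.1 : ℝ)| := by have := one_le_abs_cast i.1.2; positivity
  have hc : y * |(i.1.1 : ℝ)| ≠ 0 := by positivity
  have e0 : exp (-(y * N₀ i)) = exp (-(y * |(i.1.1 : ℝ)| * i.2)) := by
    unfold N₀
    push_cast
    simp only [Nat.cast_natAbs, Int.cast_abs]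
    ring_nf
  have e1 : exp (-(y * N₁ i)) = exp (-(y * N₀ i)) * exp (-(y * |(i.1.1 : ℝ)|)) := by
    rw [← Real.exp_add]
    unfold N₀ N₁
    push_cast
    simp only [Nat.cast_natAbs, Int.cast_abs]
    ring_nf
  have e : ∫ u in (0 : ℝ)..1, bernoulliFun b u * (u + i.2) ^ d *
      exp (-(y * |(i.1.1 : ℝ)| * (u + i.2))) = exp (-(y * N₀ i)) *
      ∫ u in (0 : ℝ)..1, (ladderPoly b d i.2).eval u * exp (-(y * |(i.1.1 : ℝ)| * u)) := by
    rw [← intervalIntegral.integral_const_mul]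
    refine intervalIntegral.integral_congr fun u _ => ?_
    simp only [ladderPoly, Polynomial.eval_mul, Polynomial.eval_pow, Polynomial.eval_add,
      Polynomial.eval_X, Polynomial.eval_C, bernoulliFun]
    rw [e0, show -(y * |(i.1.1 : ℝ)| * (u + i.2)) =
      -(y * |(i.1.1 : ℝ)| * i.2) + -(y * |(i.1.1 : ℝ)| * u) by ring, Real.exp_add]
    ring
  have hz : ∀ (x : ℝ) (_ : 0 < x) (r : ℤ) (k : ℕ), x ^ (r - ((k : ℤ) + 1)) =
      x ^ r * (x ^ (k + 1))⁻¹ := by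
    intro x hx r k
    rw [zpow_sub₀ hx.ne', show ((k : ℤ) + 1) = ((k + 1 : ℕ) : ℤ) by push_cast; ring, zpow_natCast,
      div_eq_mul_inv]
  rw [integralTerm, e, integral_eval_mul_exp _ (natDegree_ladderPoly _ _ _) hc,
    Finset.sum_range_succ, mul_add, mul_add, mul_add, Finset.mul_sum, Finset.mul_sum,
    Finset.mul_sum]
  congr 1
  · refine Finset.sum_congr rfl fun k _ => ?_
    rw [coeff_eq, coeff_eq, e1, hz y hy, hz _ hn, mul_pow, mul_inv]
    push_cast
    ring
  · rw [eval_iterate_derivative_ladderPoly, eval_iterate_derivative_ladderPoly, e1, hz y hy,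
      hz _ hn, mul_pow, mul_inv]
    ring

theorem isExpFamily_integralTerm {w : ℕ} {f : ℤ} (hf : f ≤ -1) (b d : ℕ) {m : ℤ}
    (hm : 2 - (w : ℤ) + (b + d) ≤ m) (hm' : m ≤ w - 2) :
    IsExpFamily w fun i y => y ^ m * integralTerm f b d i y := by
  refine IsExpFamily.congr ?_ fun i y hy => integralTerm_eq f b d i hy m
  refine IsExpFamily.add (IsExpFamily.sum _ fun k hk => ?_) (IsExpFamily.const_mul ?_ _)
  · have hk := Finset.mem_range.1 hk
    exact (isExpFamily_left (by omega) b d k (by omega) (by omega)).add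
      ((isExpFamily_right (by omega) b d k (by omega) (by omega)).const_mul (-1))
  · exact isExpFamily_top (by omega) (by push_cast; omega) (by push_cast; omega)

theorem kernInt_eq (a₁ a₂ a₃ : ℕ) {y : ℝ} (hy : 0 < y) (i : Ladder) :
    kernInt a₁ a₂ a₃ y i.1.1 (-i.1.1) 0 ((i.2 : ℤ), (i.2 : ℤ), 0) =
      ∑ j₁ ∈ Finset.range a₁, ∑ j₂ ∈ Finset.range a₂,
        ((edgeCoeff a₁ j₁ * edgeCoeff a₂ j₂ * ((-1) ^ (a₃ + 1) / (2 * a₃).factorial) : ℚ) : ℝ) *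
          (y ^ (((j₁ : ℤ) + 1 - a₁) + ((j₂ : ℤ) + 1 - a₂) + a₃) *
          integralTerm (((j₁ : ℤ) + 1 - 2 * a₁) + ((j₂ : ℤ) + 1 - 2 * a₂)) (2 * a₃)
            (j₁ + j₂) i y) := by
  have hn : 0 < |(i.1.1 : ℝ)| := by have := one_le_abs_cast i.1.2; positivity
  have pt : ∀ u ∈ Set.uIcc (0 : ℝ) 1, kern a₁ y i.1.1 (i.2 : ℤ) u * (kern a₂ y (-i.1.1) (i.2 : ℤ) u *
      kern a₃ y 0 0 u) =
      ∑ j₁ ∈ Finset.range a₁, ∑ j₂ ∈ Finset.range a₂,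
        ((edgeCoeff a₁ j₁ * edgeCoeff a₂ j₂ * ((-1) ^ (a₃ + 1) / (2 * a₃).factorial) : ℚ) : ℝ) *
          (y ^ (((j₁ : ℤ) + 1 - a₁) + ((j₂ : ℤ) + 1 - a₂) + a₃) *
          (|(i.1.1 : ℝ)| ^ (((j₁ : ℤ) + 1 - 2 * a₁) + ((j₂ : ℤ) + 1 - 2 * a₂)) *
            (bernoulliFun (2 * a₃) u * (u + i.2) ^ (j₁ + j₂) *
              exp (-(y * |(i.1.1 : ℝ)| * (u + i.2)))))) := by
    intro u hu
    rw [Set.uIcc_of_le zero_le_one] at hu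
    have hu0 : 0 ≤ u + ((i.2 : ℤ) : ℝ) := by
      have := hu.1
      positivity
    have he : exp (-(y * |(i.1.1 : ℝ)| * (u + i.2))) =
        exp (-(y * |(i.1.1 : ℝ)| / 2 * (u + i.2))) * exp (-(y * |(i.1.1 : ℝ)| / 2 * (u + i.2))) := by
      rw [← Real.exp_add]; congr 1; ring
    rw [kern, kern, kern, if_neg i.1.2, if_neg (neg_ne_zero.2 i.1.2), if_pos rfl, if_pos rfl,
      ← mul_assoc, Finset.sum_mul_sum, Finset.sum_mul]
    refine Finset.sum_congr rfl fun j₁ _ => ?_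
    rw [Finset.sum_mul]
    refine Finset.sum_congr rfl fun j₂ _ => ?_
    rw [abs_of_nonneg hu0, he, zpow_add₀ hy.ne', zpow_add₀ hy.ne', zpow_add₀ hn.ne', pow_add,
      Int.cast_neg, abs_neg, Int.cast_natCast]
    push_cast
    ring
  have hB := continuous_bernoulliFun (k := 2 * a₃)
  rw [kernInt, intervalIntegral.integral_congr pt, intervalIntegral.integral_finsetSum fun _ _ =>
    Continuous.intervalIntegrable (by fun_prop) _ _]
  refine Finset.sum_congr rfl fun j₁ _ => ?_
  rw [intervalIntegral.integral_finsetSum fun _ _ =>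
    Continuous.intervalIntegrable (by fun_prop) _ _]
  refine Finset.sum_congr rfl fun j₂ _ => ?_
  rw [intervalIntegral.integral_const_mul, intervalIntegral.integral_const_mul,
    intervalIntegral.integral_const_mul, integralTerm]

theorem isExpFamily_kernInt {a₁ a₂ a₃ : ℕ} (h₁ : 1 ≤ a₁) (h₂ : 1 ≤ a₂) :
    IsExpFamily (a₁ + a₂ + a₃) fun (i : Ladder) y =>
      kernInt a₁ a₂ a₃ y i.1.1 (-i.1.1) 0 ((i.2 : ℤ), (i.2 : ℤ), 0) := by
  refine IsExpFamily.congr ?_ fun i y hy => kernInt_eq a₁ a₂ a₃ hy i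
  refine IsExpFamily.sum _ fun j₁ hj₁ => IsExpFamily.sum _ fun j₂ hj₂ =>
    IsExpFamily.const_mul ?_ _
  have hj₁ := Finset.mem_range.1 hj₁
  have hj₂ := Finset.mem_range.1 hj₂
  -- The power of `y` is `2 - w + 2a₃ + j₁ + j₂`, the least allowed for a polynomial of degree `2a₃
  -- + j₁ + j₂`.
  refine isExpFamily_integralTerm (by omega) _ _ ?_ ?_
  · push_cast; omega
  · push_cast; omega

end Ladder

/-! ### Assembling the constant mode -/

theorem hasSum_kernInt_of_add_eq_zero {a₁ a₂ a₃ : ℕ} (h₁ : 1 ≤ a₁) (h₂ : 1 ≤ a₂) (h₃ : 1 ≤ a₃)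
    {t : ℝ} (ht : 0 < t) {n₁ n₂ n₃ : ℤ} (hn : n₁ + n₂ + n₃ = 0) :
    HasSum (fun l : ℤ × ℤ × ℤ => if n₁ * l.1 + n₂ * l.2.1 + n₃ * l.2.2 = 0 then
      kernInt a₁ a₂ a₃ (4 * π * t) n₁ n₂ n₃ l else 0) (modeAt a₁ a₂ a₃ t (n₁, n₂)) := by
  obtain rfl : n₃ = -n₁ - n₂ := by omega
  exact hasSum_kernInt h₁ h₂ h₃ ht n₁ n₂

theorem kernInt_rotate (a₁ a₂ a₃ : ℕ) (y : ℝ) (n₁ n₂ n₃ l₁ l₂ l₃ : ℤ) :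
    kernInt a₂ a₃ a₁ y n₂ n₃ n₁ (l₂, l₃, l₁) = kernInt a₁ a₂ a₃ y n₁ n₂ n₃ (l₁, l₂, l₃) :=
  intervalIntegral.integral_congr fun u _ => by ring

/-- Cyclic symmetry reduces the three cases of one vanishing momentum to `n₃ = 0`. -/
theorem modeAt_rotate {a₁ a₂ a₃ : ℕ} (h₁ : 1 ≤ a₁) (h₂ : 1 ≤ a₂) (h₃ : 1 ≤ a₃)
    {t : ℝ} (ht : 0 < t) {n₁ n₂ n₃ : ℤ} (hn : n₁ + n₂ + n₃ = 0) :
    modeAt a₁ a₂ a₃ t (n₁, n₂) = modeAt a₂ a₃ a₁ t (n₂, n₃) := by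
  have h := hasSum_kernInt_of_add_eq_zero h₂ h₃ h₁ ht (show n₂ + n₃ + n₁ = 0 by omega)
  have h' := ((Equiv.prodComm ℤ (ℤ × ℤ)).trans (Equiv.prodAssoc ℤ ℤ ℤ)).hasSum_iff.2 h
  refine (hasSum_kernInt_of_add_eq_zero h₁ h₂ h₃ ht hn).unique (h'.congr_fun ?_)
  rintro ⟨l₁, l₂, l₃⟩
  change _ = if n₂ * l₂ + n₃ * l₃ + n₁ * l₁ = 0 then
    kernInt a₂ a₃ a₁ (4 * π * t) n₂ n₃ n₁ (l₂, l₃, l₁) else 0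
  rw [kernInt_rotate a₁ a₂ a₃ _ n₁ n₂ n₃, show n₂ * l₂ + n₃ * l₃ + n₁ * l₁ = n₁ * l₁ + n₂ * l₂ + n₃ * l₃ by ring]

theorem kern_zero_of_ne_zero (a : ℕ) (y : ℝ) {l : ℤ} (hl : l ≠ 0) (u : ℝ) : kern a y 0 l u = 0 := by
  rw [kern, if_pos rfl, if_neg hl]

theorem kern_zero_one_sub (a : ℕ) (y : ℝ) (l : ℤ) (u : ℝ) :
    kern a y 0 l (1 - u) = kern a y 0 l u := by
  rw [kern, kern, bernoulliFun_eval_one_sub]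
  simp

theorem kern_one_sub (a : ℕ) (y : ℝ) {n : ℤ} (hn : n ≠ 0) (l : ℤ) (u : ℝ) :
    kern a y n l (1 - u) = kern a y n (-(l + 1)) u := by
  have : |1 - u + l| = |u + ((-(l + 1) : ℤ) : ℝ)| := by
    rw [← abs_neg]
    push_cast
    congr 1
    ring
  rw [kern, kern, if_neg hn, if_neg hn, this]

/-- The substitution `u ↦ 1 - u` sends the winding `l` to `-(l + 1)` and fixes the Bernoulli
polynomial of even degree. It folds the sum over integers onto `L ≥ 0`, with the factor 2 of
`hasSum_modeAt_neg`. -/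
theorem kernInt_reflect (a₁ a₂ a₃ : ℕ) (y : ℝ) {n : ℤ} (hn : n ≠ 0) (l : ℤ) :
    kernInt a₁ a₂ a₃ y n (-n) 0 (-(l + 1), -(l + 1), 0) =
      kernInt a₁ a₂ a₃ y n (-n) 0 (l, l, 0) := by
  have h := intervalIntegral.integral_comp_sub_left (a := 0) (b := 1)
    (fun u => kern a₁ y n l u * (kern a₂ y (-n) l u * kern a₃ y 0 0 u)) 1
  simp only [sub_self, sub_zero] at h
  rw [kernInt, kernInt, ← h]
  refine intervalIntegral.integral_congr fun u _ => ?_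
  simp only [kern_one_sub _ _ hn, kern_one_sub _ _ (neg_ne_zero.2 hn), kern_zero_one_sub]

theorem hasSum_modeAt_neg {a₁ a₂ a₃ : ℕ} (h₁ : 1 ≤ a₁) (h₂ : 1 ≤ a₂) (h₃ : 1 ≤ a₃)
    {t : ℝ} (ht : 0 < t) {n : ℤ} (hn : n ≠ 0) :
    HasSum (fun L : ℕ => 2 * kernInt a₁ a₂ a₃ (4 * π * t) n (-n) 0 ((L : ℤ), (L : ℤ), 0))
      (modeAt a₁ a₂ a₃ t (n, -n)) := by
  have h := hasSum_kernInt_of_add_eq_zero h₁ h₂ h₃ ht (show n + -n + 0 = 0 by ring)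
  have hinj : Function.Injective fun l : ℤ => (l, l, (0 : ℤ)) := fun _ _ h => congrArg Prod.fst h
  rw [← hinj.hasSum_iff] at h
  · refine h.nat_add_neg_add_one.congr_fun fun L => ?_
    have e : ∀ l : ℤ, n * l + -n * l + 0 * 0 = 0 := fun l => by ring
    simp only [Function.comp_apply, e, if_true]
    rw [kernInt_reflect _ _ _ _ hn, two_mul]
  · rintro ⟨l₁, l₂, l₃⟩ hl
    split_ifs with hc
    · have h0 : l₃ ≠ 0 := by
        rintro rfl
        refine hl ⟨l₁, ?_⟩
        have : n * (l₁ - l₂) = 0 := by linear_combination hc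
        have := (mul_eq_zero.1 this).resolve_left hn
        simp only [Prod.mk.injEq, and_true, true_and]
        omega
      simp [kernInt, kern_zero_of_ne_zero _ _ h0]
    · rfl

theorem hasSum_of_hasSum_two_mul {α β : Type*} {F : α × β → ℝ} {G : α → ℝ} (hF : Summable F)
    (h : ∀ a, HasSum (fun b => 2 * F (a, b)) (G a)) : HasSum G (2 * ∑' i, F i) :=
  (hF.hasSum.mul_left 2).prod_fiberwise h

theorem hasSum_modeAt_ladder {a₁ a₂ a₃ : ℕ} (h₁ : 1 ≤ a₁) (h₂ : 1 ≤ a₂) (h₃ : 1 ≤ a₃)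
    {t : ℝ} (ht : 0 < t) :
    HasSum (fun n : {n : ℤ // n ≠ 0} => modeAt a₁ a₂ a₃ t (n.1, -n.1))
      (2 * ∑' i : Ladder, kernInt a₁ a₂ a₃ (4 * π * t) i.1.1 (-i.1.1) 0 ((i.2 : ℤ), (i.2 : ℤ), 0)) := by
  have hs := (Ladder.isExpFamily_kernInt (a₃ := a₃) h₁ h₂).1 (4 * π * t) (by positivity)
  have h : ∀ n : {n : ℤ // n ≠ 0}, HasSum (fun L : ℕ => 2 *
      kernInt a₁ a₂ a₃ (4 * π * t) n.1 (-n.1) 0 ((L : ℤ), (L : ℤ), 0))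
      (modeAt a₁ a₂ a₃ t (n.1, -n.1)) := fun n => hasSum_modeAt_neg h₁ h₂ h₃ ht n.2
  exact hasSum_of_hasSum_two_mul hs h

theorem kernInt_zero (a₁ a₂ a₃ : ℕ) {y : ℝ} (hy : 0 < y) :
    kernInt a₁ a₂ a₃ y 0 0 0 (0, 0, 0) =
      kernInt a₁ a₂ a₃ 1 0 0 0 (0, 0, 0) * y ^ ((a₁ + a₂ + a₃ : ℕ) : ℤ) := by
  rw [kernInt, kernInt, ← intervalIntegral.integral_mul_const]
  refine intervalIntegral.integral_congr fun u _ => ?_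
  simp only [kern, if_true, one_zpow]
  push_cast
  rw [zpow_add₀ hy.ne', zpow_add₀ hy.ne']
  ring

theorem modeAt_zero {a₁ a₂ a₃ : ℕ} (h₁ : 1 ≤ a₁) (h₂ : 1 ≤ a₂) (h₃ : 1 ≤ a₃)
    {t : ℝ} (ht : 0 < t) :
    modeAt a₁ a₂ a₃ t (0, 0) = kernInt a₁ a₂ a₃ (4 * π * t) 0 0 0 (0, 0, 0) := by
  have h := hasSum_kernInt_of_add_eq_zero h₁ h₂ h₃ ht (show (0 : ℤ) + 0 + 0 = 0 by ring)
  refine h.unique ?_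
  have := hasSum_single (f := fun l : ℤ × ℤ × ℤ => if 0 * l.1 + 0 * l.2.1 + 0 * l.2.2 = 0 then
      kernInt a₁ a₂ a₃ (4 * π * t) 0 0 0 l else 0) (0, 0, 0) ?_
  · simpa using this
  · rintro ⟨l₁, l₂, l₃⟩ hl
    simp only [zero_mul, add_zero, if_true, kernInt]
    by_cases e₁ : l₁ = 0
    · by_cases e₂ : l₂ = 0
      · have e₃ : l₃ ≠ 0 := fun e₃ => hl (by rw [e₁, e₂, e₃])
        simp [kern_zero_of_ne_zero _ _ e₃]
      · simp [kern_zero_of_ne_zero _ _ e₂]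
    · simp [kern_zero_of_ne_zero _ _ e₁]

theorem hasSum_ite_range {α β : Type*} {f : β → ℝ} {g : α → β} (hg : Function.Injective g) {s : ℝ}
    (h : HasSum (fun x => f (g x)) s) (P : β → Prop) [DecidablePred P]
    (hP : ∀ x, P x ↔ x ∈ Set.range g) : HasSum (fun x => if P x then f x else 0) s := by
  rw [← hg.hasSum_iff fun x hx => if_neg fun h => hx ((hP x).1 h)]
  exact h.congr_fun fun x => if_pos ((hP _).2 ⟨x, rfl⟩)

/-- The momenta `(n₁, n₂)` split disjointly into the origin, the three punctured lines on which
exactly one `n_r` vanishes, and the rest. -/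
theorem constantMode_eq {a₁ a₂ a₃ : ℕ} (h₁ : 1 ≤ a₁) (h₂ : 1 ≤ a₂) (h₃ : 1 ≤ a₃)
    {t : ℝ} (ht : 0 < t) :
    constantMode ![a₁, a₂, a₃] t =
      kernInt a₁ a₂ a₃ (4 * π * t) 0 0 0 (0, 0, 0) +
      (2 * ∑' i : Ladder,
        kernInt a₁ a₂ a₃ (4 * π * t) i.1.1 (-i.1.1) 0 ((i.2 : ℤ), (i.2 : ℤ), 0)) +
      (2 * ∑' i : Ladder,
        kernInt a₂ a₃ a₁ (4 * π * t) i.1.1 (-i.1.1) 0 ((i.2 : ℤ), (i.2 : ℤ), 0)) +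
      (2 * ∑' i : Ladder,
        kernInt a₃ a₁ a₂ (4 * π * t) i.1.1 (-i.1.1) 0 ((i.2 : ℤ), (i.2 : ℤ), 0)) +
      ∑' i : Windings, kernInt a₁ a₂ a₃ (4 * π * t) i.n₁ i.n₂ i.n₃ (i.l₁, i.l₂, i.l₃) := by
  have H0 := hasSum_ite_eq ((0, 0) : ℤ × ℤ) (modeAt a₁ a₂ a₃ t (0, 0))
  have H3 := hasSum_ite_range (f := modeAt a₁ a₂ a₃ t)
    (g := fun n : {n : ℤ // n ≠ 0} => (n.1, -n.1))
    (fun n m h => Subtype.ext (congrArg Prod.fst h)) (hasSum_modeAt_ladder h₁ h₂ h₃ ht)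
    (fun n => n.1 ≠ 0 ∧ n.2 = -n.1) (by
      rintro ⟨n₁, n₂⟩
      simp [Set.mem_range, eq_comm])
  have H1 := hasSum_ite_range (f := modeAt a₁ a₂ a₃ t)
    (g := fun n : {n : ℤ // n ≠ 0} => (0, n.1))
    (fun n m h => Subtype.ext (congrArg Prod.snd h))
    ((hasSum_modeAt_ladder h₂ h₃ h₁ ht).congr_fun fun n =>
      modeAt_rotate h₁ h₂ h₃ ht (by ring))
    (fun n => n.1 = 0 ∧ n.2 ≠ 0) (by
      rintro ⟨n₁, n₂⟩
      simp [Set.mem_range, eq_comm])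
  have H2 := hasSum_ite_range (f := modeAt a₁ a₂ a₃ t)
    (g := fun n : {n : ℤ // n ≠ 0} => (-n.1, 0))
    (fun n m h => Subtype.ext (neg_injective (congrArg Prod.fst h)))
    ((hasSum_modeAt_ladder h₃ h₁ h₂ ht).congr_fun fun n =>
      (modeAt_rotate h₃ h₁ h₂ ht (by ring)).symm)
    (fun n => n.1 ≠ 0 ∧ n.2 = 0) (by
      rintro ⟨n₁, n₂⟩
      simp only [Set.mem_range, Prod.mk.injEq, Subtype.exists]
      constructor
      · rintro ⟨h, rfl⟩
        exact ⟨-n₁, neg_ne_zero.2 h, neg_neg _, rfl⟩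
      · rintro ⟨m, hm, rfl, rfl⟩
        exact ⟨neg_ne_zero.2 hm, rfl⟩)
  have HW := hasSum_modeAt_of_ne_zero h₁ h₂ h₃ ht
  rw [← modeAt_zero h₁ h₂ h₃ ht]
  refine (hasSum_modeAt h₁ h₂ h₃ ht).unique (((((H0.add H3).add H1).add H2).add HW).congr_fun ?_)
  rintro ⟨n₁, n₂⟩
  dsimp only
  by_cases e₁ : n₁ = 0
  · by_cases e₂ : n₂ = 0
    · simp [e₁, e₂]
    · simp [e₁, e₂]
  · by_cases e₂ : n₂ = 0
    · simp [e₁, e₂, eq_comm]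
    · by_cases e₃ : n₂ = -n₁
      · simp [e₁, e₃]
      · have : -n₁ - n₂ ≠ 0 := by omega
        simp [e₁, e₂, e₃, this]

theorem isExpansion_constantMode {a₁ a₂ a₃ : ℕ} (h₁ : 1 ≤ a₁) (h₂ : 1 ≤ a₂) (h₃ : 1 ≤ a₃) :
    IsExpansion (a₁ + a₂ + a₃) fun y => constantMode ![a₁, a₂, a₃] (y / (4 * π)) := by
  have H0 := IsExpansion.monomial (w := a₁ + a₂ + a₃) (kernInt a₁ a₂ a₃ 1 0 0 0 (0, 0, 0))
    (k := ((a₁ + a₂ + a₃ : ℕ) : ℤ)) (by omega) le_rfl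
  have H3 := (Ladder.isExpFamily_kernInt (a₃ := a₃) h₁ h₂).2.const_mul 2
  have H1 := (Ladder.isExpFamily_kernInt (a₃ := a₁) h₂ h₃).2.const_mul 2
  have H2 := (Ladder.isExpFamily_kernInt (a₃ := a₂) h₃ h₁).2.const_mul 2
  rw [show a₂ + a₃ + a₁ = a₁ + a₂ + a₃ by ring] at H1
  rw [show a₃ + a₁ + a₂ = a₁ + a₂ + a₃ by ring] at H2
  have HW := (Windings.isExpFamily_kernInt (a₁ := a₁) h₂ h₃).2
  refine ((((H0.add H3).add H1).add H2).add HW).congr fun y hy => ?_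
  have hpi := pi_pos
  rw [constantMode_eq h₁ h₂ h₃ (by positivity : 0 < y / (4 * π)), mul_div_cancel₀ _ (by positivity),
    kernInt_zero _ _ _ hy]
  push_cast
  rfl

/-! ### Exponential decay and uniqueness -/

open Asymptotics Topology

theorem isBigO_tsum_mul_exp {f : ℕ+ → ℝ} (hf : Summable fun n : ℕ+ => |f n| * exp (-(1 * n))) :
    (fun y : ℝ => ∑' n : ℕ+, f n * exp (-(y * n))) =O[atTop] fun y => exp (-y) := by
  refine IsBigO.of_bound ((∑' n : ℕ+, |f n| * exp (-(1 * n))) * exp 1) ?_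
  filter_upwards [eventually_ge_atTop 1] with y hy
  rw [norm_of_nonneg (exp_pos _).le, mul_assoc, ← Real.exp_add]
  refine tsum_of_norm_bounded (hf.hasSum.mul_right (exp (1 + -y))) fun n => ?_
  have hn : (1 : ℝ) ≤ n := by exact_mod_cast n.2
  rw [norm_mul, norm_of_nonneg (exp_pos _).le, mul_assoc, ← Real.exp_add, Real.norm_eq_abs]
  gcongr
  nlinarith

/-- Half of the decay rate is given up to absorb the power of `y`. -/
theorem isBigO_zpow_mul_tsum {f : ℕ+ → ℝ} (hf : Summable fun n : ℕ+ => |f n| * exp (-(1 * n)))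
    (m : ℤ) : (fun y : ℝ => y ^ m * ∑' n : ℕ+, f n * exp (-(y * n))) =O[atTop]
      fun y => exp (-(1 / 2) * y) := by
  refine ((isLittleO_zpow_exp_pos_mul_atTop m (by norm_num : (0 : ℝ) < 1 / 2)).isBigO.mul
    (isBigO_tsum_mul_exp hf)).congr_right fun y => ?_
  rw [← Real.exp_add]
  congr 1
  ring

/-- The exponential series with coefficients `f`, as a function of `τ₂`. -/
def expSeries (w : ℕ) (f : ℤ → ℕ+ → ℚ) (t : ℝ) : ℝ :=
  ∑ m ∈ Finset.Icc (2 - (w : ℤ)) (w - 3),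
    (4 * π * t) ^ m * ∑' n : ℕ+, (f m n : ℝ) * exp (-(4 * π * t * n))

theorem isBigO_expSeries {w : ℕ} {f : ℤ → ℕ+ → ℚ}
    (hf : ∀ m, ∀ ε : ℝ, 0 < ε → Summable fun n : ℕ+ => |(f m n : ℝ)| * exp (-(ε * n))) :
    expSeries w f =O[atTop] fun t => exp (-(2 * π) * t) := by
  have htop : Tendsto (fun t : ℝ => 4 * π * t) atTop atTop :=
    tendsto_id.const_mul_atTop (by positivity)
  have h := IsBigO.sum (s := Finset.Icc (2 - (w : ℤ)) (w - 3)) fun m _ =>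
    ((isBigO_zpow_mul_tsum (hf m 1 one_pos) m).comp_tendsto htop)
  refine h.congr (fun t => ?_) fun t => ?_
  · simp only [expSeries, Finset.sum_apply, Function.comp_apply]
  · simp only [Function.comp_apply]
    congr 1
    ring

theorem exists_isExponentialPart_expSeries {a₁ a₂ a₃ : ℕ} (h₁ : 1 ≤ a₁) (h₂ : 1 ≤ a₂)
    (h₃ : 1 ≤ a₃) : ∃ f : ℤ → ℕ+ → ℚ,
      (∀ m, ∀ ε : ℝ, 0 < ε → Summable fun n : ℕ+ => |(f m n : ℝ)| * exp (-(ε * n))) ∧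
      IsExponentialPart a₁ a₂ a₃ (expSeries (a₁ + a₂ + a₃) f) := by
  obtain ⟨c, f, hf, h⟩ := isExpansion_constantMode h₁ h₂ h₃
  refine ⟨f, hf, ⟨fun k => c k * (4 * π) ^ k, fun t ht => ?_⟩, 2 * π, by positivity,
    isBigO_expSeries hf⟩
  have hpi : 4 * π ≠ 0 := by positivity
  have := h (4 * π * t) (by positivity)
  simp only [mul_div_cancel_left₀ _ hpi] at this
  rw [this]
  congr 1
  exact Finset.sum_congr rfl fun k _ => by rw [mul_zpow, mul_assoc]

theorem tendsto_pow_mul_of_isBigO_exp {E : ℝ → ℝ} {κ : ℝ} (hκ : 0 < κ)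
    (hE : E =O[atTop] fun t => exp (-κ * t)) (w : ℕ) :
    Tendsto (fun t => t ^ w * E t) atTop (𝓝 0) := by
  rw [← isLittleO_one_iff ℝ]
  refine ((isLittleO_pow_exp_pos_mul_atTop w hκ).mul_isBigO hE).congr_right fun t => ?_
  rw [← Real.exp_add, neg_mul, add_neg_cancel, Real.exp_zero]

/-- Multiplied by `t^w`, the difference of two exponential parts is a polynomial for `t > 0`. It
tends to zero at infinity, hence is the zero polynomial. -/
theorem IsExponentialPart.unique {a₁ a₂ a₃ : ℕ} {E E' : ℝ → ℝ} (h : IsExponentialPart a₁ a₂ a₃ E)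
    (h' : IsExponentialPart a₁ a₂ a₃ E') {t : ℝ} (ht : 0 < t) : E t = E' t := by
  obtain ⟨⟨c, hc⟩, κ, hκ, hE⟩ := h
  obtain ⟨⟨c', hc'⟩, κ', hκ', hE'⟩ := h'
  set w := a₁ + a₂ + a₃
  let P : Polynomial ℝ := ∑ k ∈ Finset.Icc (1 - (w : ℤ)) w,
    Polynomial.C (c' k - c k) * Polynomial.X ^ (w + k).toNat
  have hP : ∀ t : ℝ, 0 < t → P.eval t = t ^ w * E t - t ^ w * E' t := by
    intro t ht
    have e : P.eval t = t ^ w * (∑ k ∈ Finset.Icc (1 - (w : ℤ)) w, c' k * t ^ k -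
        ∑ k ∈ Finset.Icc (1 - (w : ℤ)) w, c k * t ^ k) := by
      rw [Polynomial.eval_finsetSum, ← Finset.sum_sub_distrib, Finset.mul_sum]
      refine Finset.sum_congr rfl fun k hk => ?_
      have hk := (Finset.mem_Icc.1 hk).1
      have : t ^ (w + k).toNat = t ^ w * t ^ k := by
        rw [← zpow_natCast, Int.toNat_of_nonneg (by omega), zpow_add₀ ht.ne', zpow_natCast]
      rw [Polynomial.eval_mul, Polynomial.eval_C, Polynomial.eval_pow, Polynomial.eval_X, this]
      ring
    rw [e]
    linear_combination t ^ w * ((hc' t ht).symm.trans (hc t ht))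
  have hlim : Tendsto (fun t => P.eval t) atTop (𝓝 0) := by
    have := (tendsto_pow_mul_of_isBigO_exp hκ hE w).sub (tendsto_pow_mul_of_isBigO_exp hκ' hE' w)
    rw [sub_zero] at this
    refine this.congr' ?_
    filter_upwards [eventually_gt_atTop 0] with t ht using (hP t ht).symm
  have hP0 : P = 0 := Polynomial.leadingCoeff_eq_zero.1 (P.tendsto_nhds_iff.1 hlim).1
  have := hP t ht
  rw [hP0, Polynomial.eval_zero, ← mul_sub, eq_comm, mul_eq_zero, sub_eq_zero] at this
  exact this.resolve_left (pow_ne_zero _ ht.ne')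

/-- The coefficients of an exponential series, placed at `s = 1`. The boundary terms of the unit
interval integrals account for the whole exponential part, so no `Ei` terms occur. -/
def seriesCoeff (f : ℤ → ℕ+ → ℚ) (s n : ℕ) (m : ℤ) : ℚ :=
  if s = 1 then f m n.toPNat' else 0

theorem expTerm_seriesCoeff (w : ℕ) (f : ℤ → ℕ+ → ℚ) (s : ℕ) (n : ℕ+) (t : ℝ) :
    expTerm w 0 0 (seriesCoeff f) s n t = if s = 1 then
      ∑ m ∈ Finset.Icc (2 - (w : ℤ)) (w - 3),
        (4 * π * t) ^ m * ((f m n : ℝ) * exp (-(4 * π * t * n))) else 0 := by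
  unfold expTerm seriesCoeff
  split_ifs with h
  · simp only [Pi.zero_apply, Rat.cast_zero, zero_mul, add_zero, zero_add, PNat.coe_toPNat',
      Finset.mul_sum]
    refine Finset.sum_congr rfl fun m _ => ?_
    rw [show 4 * π * n * t = 4 * π * t * n by ring]
    ring
  · simp

end ModularGraph

end

theorem theorem3 (a₁ a₂ a₃ : ℕ) (h₁ : 1 ≤ a₁) (h₂ : 1 ≤ a₂) (h₃ : 1 ≤ a₃) :
    (∃ E : ℝ → ℝ, ModularGraph.IsExponentialPart a₁ a₂ a₃ E) ∧
    ∀ E : ℝ → ℝ, ModularGraph.IsExponentialPart a₁ a₂ a₃ E →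
      ∃ (fp fm : ℕ → ℕ → ℚ) (f : ℕ → ℕ → ℤ → ℚ), ∀ t : ℝ, 0 < t →
        (∀ s ∈ Finset.Icc 1 (a₁ + a₂ + a₃ - 2),
          Summable fun n : ℕ+ => ModularGraph.expTerm (a₁ + a₂ + a₃) fp fm f s n t) ∧
        E t = ∑ s ∈ Finset.Icc 1 (a₁ + a₂ + a₃ - 2),
          ∑' n : ℕ+, ModularGraph.expTerm (a₁ + a₂ + a₃) fp fm f s n t := by
  obtain ⟨f, hf, hE₀⟩ := ModularGraph.exists_isExponentialPart_expSeries h₁ h₂ h₃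
  refine ⟨⟨_, hE₀⟩, fun E hE => ⟨0, 0, ModularGraph.seriesCoeff f, fun t ht => ?_⟩⟩
  have hs : ∀ m, Summable fun n : ℕ+ =>
      (4 * π * t) ^ m * ((f m n : ℝ) * exp (-(4 * π * t * n))) := fun m =>
    (ModularGraph.summable_of_summable_abs_mul (fun _ => (exp_pos _).le)
      (hf m (4 * π * t) (by positivity))).mul_left _
  simp only [ModularGraph.expTerm_seriesCoeff]
  refine ⟨fun s _ => ?_, ?_⟩
  · by_cases h : s = 1
    · simpa only [if_pos h] using summable_sum fun m _ => hs m
    · simpa only [if_neg h] using summable_zero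
  -- The value `s = 1` is available since `w ≥ 3`; all other values of `s` contribute nothing.
  · rw [Finset.sum_eq_single_of_mem 1 (Finset.mem_Icc.2 ⟨le_rfl, by omega⟩) fun s _ h => by
      simp [if_neg h], hE.unique hE₀ ht, ModularGraph.expSeries]
    simp only [if_true]
    rw [Summable.tsum_finsetSum fun m _ => hs m]
    simp only [tsum_mul_left]
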